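/- Let $n\ge 1$, $m\ge 0$ be integers, $\nu\in\mathbb C$ with $\operatorname{Re}\nu>0$, and $p>1+\frac{m+3}{n}$. Let $f:\mathbb C\to\mathbb C$ satisfy $f(0)=0$ and, for some $K>0$, $|f(\xi)-f(\eta)|\le K(|\xi|^{p-1}+|\eta|^{p-1})|\xi-\eta|$ for all $\xi,\eta\in\mathbb C$. Write $\|\cdot\|_q$ for the norm of $L^q=L^q(\mathbb R^n;\mathbb C)$ and use multi-index notation for $\alpha,\beta,\gamma\in\mathbb Z_{\ge0}^n$. Put $$G_\nu(x)=(4\pi\nu)^{-n/2}\exp\Bigl(-\frac{|x|^2}{4\nu}\Bigr)\ \text{(principal power)},\qquad e^{t\nu\Delta}\varphi=G_{t\nu}*\varphi\ (t>0),\qquad e^{0\nu\Delta}\varphi=\varphi .$$ Let $u_0\in L^1\cap L^\infty$ with $x^\alpha u_0\in L^1$ for all $|\alpha|\le m+1$. Let $u$ be a global mild solution of $\partial_tu-\nu\Delta u=f(u)$, $u(0)=u_0$, that is, $u$ is bounded and continuous from $[0,\infty)$ to $L^1$ and from $(0,\infty)$ to $L^\infty$, and for all $t>0$ $$u(t)=e^{t\nu\Delta}u_0+\int_0^te^{(t-s)\nu\Delta}f(u(s))\,ds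 .$$ Assume that $\sup_{q\in[1,\infty]}\sup_{t>0}t^{\frac n2(1-\frac1q)}\|u(t)\|_q<\infty$. Define $$\psi_k=\int_0^\infty s^kf(u(s))\,ds\ \ (\text{Bochner integral in }L^1),\qquad \mathcal M_\beta(\varphi)=\frac1{\beta!}\int_{\mathbb R^n}y^\beta\varphi(y)\,dy,\qquad(\delta_t\varphi)(x)=t^{-n/2}\varphi(t^{-1/2}x),$$ $$h_{\nu,\alpha}(x)=\sum_{2\beta\le\alpha}\frac{(-1)^{|\beta|}\alpha!}{\beta!(\alpha-2\beta)!}\nu^{-|\alpha-\beta|}x^{\alpha-2\beta},$$ $$\Lambda_{\alpha,N}(t;\varphi)=(-2)^{-|\alpha|}t^{-|\alpha|/2}\sum_{k=0}^N2^{-k}t^{-k/2}\sum_{|\beta|=k}\mathcal M_\beta(\varphi)\,\delta_t(h_{\nu,\alpha+\beta}G_\nu),$$ $$\mathcal A_k(t)=\Lambda_{0,k}(t;u_0)+\sum_{|\gamma|\le k/2}\frac{(-\nu)^{|\gamma|}}{\gamma!}\Lambda_{2\gamma,k-2|\gamma|}(t;\psi_{|\gamma|}).$$ Then all the integrals entering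 $\mathcal A_k$ for $k\le m+1$ converge ($f(u(s))\in L^1$ for $s>0$; $s\mapsto s^kf(u(s))$ is Bochner integrable on $(0,\infty)$ in $L^1$ if $2k\le m+1$; and $y^\beta\psi_k\in L^1$ if $|\beta|+2k\le m+1$), and for every $q\in[1,\infty]$ $$\lim_{t\to\infty}t^{\frac n2(1-\frac1q)+\frac m2+\frac12}\|u(t)-\mathcal A_m(t)\|_q=\|\mathcal A_{m+1}(1)-\mathcal A_m(1)\|_q .$$ Moreover, the following are equivalent: (i) $\mathcal A_{m+1}(1)-\mathcal A_m(1)\not\equiv0$. (ii) There is $\alpha\in\mathbb Z_{\ge0}^n$ with $|\alpha|=m+1$ such that $$\mathcal M_\alpha(u_0)+\sum_{\substack{\beta+2\gamma=\alpha\\|\gamma|\le(m+1)/2}}\frac{(-\nu)^{|\gamma|}}{\gamma!}\mathcal M_\beta(\psi_{|\gamma|})\ne0 .$$ (iii) For every $q\in[1,\infty]$ and $\varepsilon\in(0,1)$ there is $t_0>0$ such that for all $t>t_0$ $$0<t^{-\frac12}(1-\varepsilon)\|\mathcal A_{m+1}(1)-\mathcal A_m(1)\|_q\le t^{\frac n2(1-\frac1q)+\frac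 m2}\|u(t)-\mathcal A_m(t)\|_q\le t^{-\frac12}(1+\varepsilon)\|\mathcal A_{m+1}(1)-\mathcal A_m(1)\|_q .$$ -/

import Mathlib

open MeasureTheory Set Filter Topology
open scoped ENNReal Convolution

noncomputable section

namespace CGL

/-- The Euclidean space `ℝⁿ`, with Lebesgue measure `volume`. -/
abbrev Rn (n : ℕ) : Type := EuclideanSpace ℝ (Fin n)

/-- The Banach space `L¹(ℝⁿ; ℂ)`. -/
abbrev L1 (n : ℕ) : Type := Lp ℂ 1 (volume : Measure (Rn n))

/-- The Banach space `L^∞(ℝⁿ; ℂ)`. -/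
abbrev Linf (n : ℕ) : Type := Lp ℂ ∞ (volume : Measure (Rn n))

/-! ### Multi-indices -/

/-- The length `|α| = α₁ + ⋯ + αₙ`. -/
def mlen {n : ℕ} (α : Fin n → ℕ) : ℕ := ∑ j, α j

/-- The factorial `α! = α₁! ⋯ αₙ!`. -/
def mfact {n : ℕ} (α : Fin n → ℕ) : ℕ := ∏ j, (α j).factorial

/-- The monomial `x^α = x₁^α₁ ⋯ xₙ^αₙ`. -/
def mpow {n : ℕ} (x : Rn n) (α : Fin n → ℕ) : ℝ := ∏ j, x j ^ α j

/-- The finite set of the multi-indices `β` with `|β| = k`. -/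
def multiIdx (n k : ℕ) : Finset (Fin n → ℕ) := Finset.piAntidiag Finset.univ k

theorem mem_multiIdx {n k : ℕ} {β : Fin n → ℕ} : β ∈ multiIdx n k ↔ mlen β = k := by
  simp [multiIdx, mlen]

/-! ### Function spaces -/

/-- `φ ∈ L¹_m(ℝⁿ)`: `φ ∈ L¹` and `x^α φ ∈ L¹` for all `|α| ≤ m`. -/
def MemWeightedL1 {n : ℕ} (m : ℕ) (φ : Rn n → ℂ) : Prop :=
  MemLp φ 1 volume ∧
    ∀ α : Fin n → ℕ, mlen α ≤ m → MemLp (fun x => (mpow x α : ℂ) * φ x) 1 volume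

open Classical in
/-- The class in `L¹(ℝⁿ)` of a function (zero if the function is not in `L¹`). -/
def toL1 {n : ℕ} (g : Rn n → ℂ) : L1 n :=
  if h : MemLp g 1 (volume : Measure (Rn n)) then h.toLp g else 0

/-- The solution space
`X = (C ∩ L^∞)([0,∞); L¹(ℝⁿ)) ∩ (C ∩ L^∞)((0,∞); L^∞(ℝⁿ))`; a function of time is a map on `ℝ`
of which only the values at times `t ≥ 0` matter. -/
def MemX {n : ℕ} (u : ℝ → L1 n) : Prop :=
  ContinuousOn u (Ici 0) ∧ (∃ C : ℝ, ∀ t, 0 ≤ t → ‖u t‖ ≤ C) ∧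
    ∃ v : ℝ → Linf n,
      (∀ t, 0 < t → (u t : Rn n →ₘ[volume] ℂ) = (v t : Rn n →ₘ[volume] ℂ)) ∧
      ContinuousOn v (Ioi 0) ∧ ∃ C : ℝ, ∀ t, 0 < t → ‖v t‖ ≤ C

/-! ### The semigroup and mild solutions -/

/-- The Gaussian `G_ν(x) = (4πν)^(-n/2) exp(-|x|²/(4ν))`, with the principal power; the fundamental
solution at time `t` is `G_{tν}`. -/
def gauss {n : ℕ} (ν : ℂ) (x : Rn n) : ℂ :=
  (4 * (Real.pi : ℂ) * ν) ^ (-(n : ℂ) / 2) * Complex.exp (-((‖x‖ ^ 2 : ℝ) : ℂ) / (4 * ν))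

/-- The semigroup `e^{tνΔ} φ = G_{tν} * φ` for `t > 0`, and `φ` for `t = 0`. -/
def semigroup {n : ℕ} (ν : ℂ) (t : ℝ) (φ : Rn n → ℂ) : Rn n → ℂ :=
  if 0 < t then
    (fun x => gauss ((t : ℂ) * ν) x) ⋆[ContinuousLinearMap.mul ℝ ℂ, volume] φ
  else φ

theorem integrable_gauss {n : ℕ} {ν : ℂ} (hν : 0 < ν.re) :
    Integrable (gauss ν : Rn n → ℂ) volume := by
  have hb : 0 < ((4 * ν)⁻¹).re := by
    have h4 : 0 < (4 * ν).re := by simpa using hν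
    rw [Complex.inv_re]
    exact div_pos h4 (Complex.normSq_pos.2 (fun h => by simp [h] at h4))
  have h := (GaussianFourier.integrable_cexp_neg_mul_sq_norm_add hb 0 (0 : Rn n)).const_mul
    ((4 * (Real.pi : ℂ) * ν) ^ (-(n : ℂ) / 2))
  refine h.congr (Filter.Eventually.of_forall fun x => ?_)
  simp [gauss, div_eq_mul_inv, mul_comm]

/-- The semigroup maps `L¹` to `L¹`, so `toL1` is the class of the function wherever it is applied
to the semigroup below. -/
theorem memLp_semigroup {n : ℕ} {ν : ℂ} (hν : 0 < ν.re) (t : ℝ) {φ : Rn n → ℂ}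
    (hφ : MemLp φ 1 volume) : MemLp (semigroup ν t φ) 1 volume := by
  unfold semigroup
  split_ifs with ht
  · rw [memLp_one_iff_integrable] at hφ ⊢
    refine Integrable.integrable_convolution _ (integrable_gauss ?_) hφ
    simpa using mul_pos ht hν
  · exact hφ

/-- `f(u(s))`, as an element of `L¹(ℝⁿ)`. -/
def nonlin {n : ℕ} (f : ℂ → ℂ) (u : ℝ → L1 n) (s : ℝ) : L1 n := toL1 (fun x => f (u s x))

/-- `e^{(t-s)νΔ} f(u(s))`, as an element of `L¹(ℝⁿ)`. -/
def duhamel {n : ℕ} (ν : ℂ) (f : ℂ → ℂ) (u : ℝ → L1 n) (t s : ℝ) : L1 n :=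
  toL1 (semigroup ν (t - s) (nonlin f u s))

/-- `u ∈ X` is a global mild solution of `∂ₜu - νΔu = f(u)`, `u(0) = u₀`: for all `t > 0`,
`u(t) = e^{tνΔ}u₀ + ∫₀ᵗ e^{(t-s)νΔ} f(u(s)) ds`, with a (convergent) Bochner integral. -/
def IsGlobalSolution {n : ℕ} (ν : ℂ) (f : ℂ → ℂ) (u₀ : Rn n → ℂ) (u : ℝ → L1 n) : Prop :=
  MemX u ∧ ∀ t : ℝ, 0 < t →
    IntervalIntegrable (duhamel ν f u t) volume 0 t ∧
      u t = toL1 (semigroup ν t u₀) + ∫ s in (0 : ℝ)..t, duhamel ν f u t s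

/-- The exponent `(n/2)(1 - 1/q)`, for `1 ≤ q ≤ ∞`. -/
def decayExp (n : ℕ) (q : ℝ≥0∞) : ℝ := (n : ℝ) / 2 * (1 - (q⁻¹).toReal)

/-- `sup_{1 ≤ q ≤ ∞} sup_{t > 0} t^{(n/2)(1-1/q)} ‖u(t)‖_q < ∞`. -/
def HasFreeDecay {n : ℕ} (u : ℝ → L1 n) : Prop :=
  (⨆ q ∈ Ici (1 : ℝ≥0∞), ⨆ t ∈ Ioi (0 : ℝ),
    ENNReal.ofReal (t ^ decayExp n q) * eLpNorm (u t) q volume) < ∞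

/-! ### The asymptotic profiles -/

/-- The moment `M_β(φ) = (1/β!) ∫ y^β φ(y) dy`. -/
def moment {n : ℕ} (β : Fin n → ℕ) (φ : Rn n → ℂ) : ℂ :=
  (1 / (mfact β : ℂ)) * ∫ y, (mpow y β : ℂ) * φ y

/-- The rescaled Hermite polynomial
`h_{ν,α}(x) = ∑_{2β ≤ α} (-1)^|β| α! / (β! (α-2β)!) ν^(-|α-β|) x^(α-2β)`. -/
def hermitePoly {n : ℕ} (ν : ℂ) (α : Fin n → ℕ) (x : Rn n) : ℂ :=
  ∑ β ∈ (Finset.Icc 0 α).filter (fun β => ∀ j, 2 * β j ≤ α j),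
    ((-1) ^ mlen β * (mfact α : ℂ) / ((mfact β : ℂ) * (mfact (α - 2 • β) : ℂ))) *
      (ν ^ mlen (α - β))⁻¹ * (mpow x (α - 2 • β) : ℂ)

/-- The dilation `(δ_t φ)(x) = t^(-n/2) φ(t^(-1/2) x)`. -/
def dilation {n : ℕ} (t : ℝ) (φ : Rn n → ℂ) (x : Rn n) : ℂ :=
  ((t ^ (-(n : ℝ) / 2) : ℝ) : ℂ) * φ (t ^ (-(1 : ℝ) / 2) • x)

/-- The profile `Λ_{α,N}(t; φ) = (-2)^(-|α|) t^(-|α|/2)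
∑_{k=0}^N 2^(-k) t^(-k/2) ∑_{|β|=k} M_β(φ) δ_t(h_{ν,α+β} G_ν)`. -/
def Lam {n : ℕ} (ν : ℂ) (α : Fin n → ℕ) (N : ℕ) (t : ℝ) (φ : Rn n → ℂ) (x : Rn n) : ℂ :=
  ((-2) ^ mlen α)⁻¹ * ((t ^ (-(mlen α : ℝ) / 2) : ℝ) : ℂ) *
    ∑ k ∈ Finset.range (N + 1), (2 ^ k)⁻¹ * ((t ^ (-(k : ℝ) / 2) : ℝ) : ℂ) *
      ∑ β ∈ multiIdx n k,
        moment β φ * dilation t (fun y => hermitePoly ν (α + β) y * gauss ν y) x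

/-- `ψ_k = ∫₀^∞ s^k f(u(s)) ds`, a Bochner integral in `L¹(ℝⁿ)`. -/
def psi {n : ℕ} (f : ℂ → ℂ) (u : ℝ → L1 n) (k : ℕ) : L1 n :=
  ∫ s in Ioi (0 : ℝ), s ^ k • nonlin f u s

/-- The asymptotic profile `A_m(t) = Λ_{0,m}(t; u₀)
+ ∑_{|γ| ≤ m/2} ((-ν)^|γ| / γ!) Λ_{2γ, m-2|γ|}(t; ψ_{|γ|})`. -/
def profile {n : ℕ} (ν : ℂ) (f : ℂ → ℂ) (u₀ : Rn n → ℂ) (u : ℝ → L1 n) (m : ℕ) (t : ℝ)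
    (x : Rn n) : ℂ :=
  Lam ν 0 m t u₀ x +
    ∑ j ∈ Finset.range (m / 2 + 1), ∑ γ ∈ multiIdx n j,
      ((-ν) ^ mlen γ / (mfact γ : ℂ)) * Lam ν (2 • γ) (m - 2 * mlen γ) t (psi f u (mlen γ)) x

/-- The coefficient `M_α(u₀) + ∑_{β + 2γ = α, |γ| ≤ k/2} ((-ν)^|γ| / γ!) M_β(ψ_{|γ|})`. -/
def profileCoeff {n : ℕ} (ν : ℂ) (f : ℂ → ℂ) (u₀ : Rn n → ℂ) (u : ℝ → L1 n) (k : ℕ)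
    (α : Fin n → ℕ) : ℂ :=
  moment α u₀ +
    ∑ b ∈ (Finset.Icc 0 α ×ˢ Finset.Icc 0 α).filter
        (fun b : (Fin n → ℕ) × (Fin n → ℕ) => b.1 + 2 • b.2 = α ∧ 2 * mlen b.2 ≤ k),
      ((-ν) ^ mlen b.2 / (mfact b.2 : ℂ)) * moment b.1 (psi f u (mlen b.2))

end CGL

end

/-! Parabolic scaling organises the proof: a power of time counts as two space derivatives. Formally
the Duhamel kernel of a source at (s, y) is G_{(t-s)ν}(x-y) = exp(-sνΔ - y·∇) G_{tν}(x). Its Taylor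
polynomial of parabolic degree N is a combination of the ∂^κ G_{tν}, |κ| ≤ N, whose coefficients are
the Hermite-type polynomials `heatCoeff ν κ s y`. Integrating these against u₀ (at s = 0) and
against f(u(s)) over all s > 0 gives exactly the coefficients of 𝒜_N: the substitution κ = β + 2γ
pairs s^|γ| with y^β, which are the moments of ψ_{|γ|} (`profile_eq`,
`DecayingSolution.fullCoeff_eq`).

After rescaling by √t, the Taylor remainder is bounded by Gaussians times r^N min(1, r), with r =
max(√(s/t), |y|/√t) (`exists_norm_remKer_le`). The minimum is decisive. With N = M = m + 1 there are
only M moments, so no rate beyond t^(-M/2) is available; but r^M provides a dominating function,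
while the minimum tends to 0 pointwise. Dominated convergence in y and in s then gives u - 𝒜_{m+1} =
o(t^(-(m+1)/2)) in the scaled norms (`DecayingSolution.tendsto_totalErr`).

The dominating function is integrable because ‖|y|^M u(s)‖_1 grows at most like (1+s)^(M/2)
(`exists_wnorm_le`, a Gronwall argument with truncated weights), while the nonlinearity gains
(1+s)^(-n(p-1)/2). The assumption on p says exactly n(p-1)/2 > M/2 + 1. On t/2 < s < t no expansion
is made: the Duhamel integral is small by the decay alone, and the moments of late sources are
controlled by the same error mass, since r is bounded below there. All estimates are made in L¹ and
L^∞ and then interpolated.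

Finally 𝒜_{m+1} - 𝒜_m is exactly self-similar (`profile_succ_sub`), so its scaled norm does not
depend on t, and the triangle inequality gives the limit. The equivalence of (i) and (ii) is the
linear independence of the ∂^κ G_ν with |κ| = m + 1 (`eq_zero_of_sum_dgauss_eq_zero`); (iii) is the
limit read with a positive finite value. -/

noncomputable section

namespace CGL

/-! ### Hermite polynomials and the one-dimensional heat kernel at complex time. -/

/-- The two-variable Hermite polynomial `∑_{2b ≤ i} A^b B^(i-2b) / (b! (i-2b)!)`. -/
def he (A B : ℂ) (i : ℕ) : ℂ :=
  ∑ b ∈ Finset.range (i / 2 + 1),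
    A ^ b / (b.factorial : ℂ) * (B ^ (i - 2 * b) / ((i - 2 * b).factorial : ℂ))

theorem he_zero (A B : ℂ) : he A B 0 = 1 := by simp [he]

theorem he_one (A B : ℂ) : he A B 1 = B := by simp [he]

/-- This is the derivative of the generating function ∑ λ^i `he A B i` = exp(A λ² + B λ), read off
at λ^(i+1). In each term the proof splits i + 2 as (i + 2 - 2b) + 2b. -/
theorem he_succ_succ (A B : ℂ) (i : ℕ) :
    ((i : ℂ) + 2) * he A B (i + 2) = B * he A B (i + 1) + 2 * A * he A B i := by
  have key : ∀ b ∈ Finset.range ((i + 2) / 2 + 1),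
      ((i : ℂ) + 2) * (A ^ b / (b.factorial : ℂ) *
        (B ^ (i + 2 - 2 * b) / ((i + 2 - 2 * b).factorial : ℂ))) =
      ((i + 2 - 2 * b : ℕ) : ℂ) * (A ^ b / (b.factorial : ℂ) *
        (B ^ (i + 2 - 2 * b) / ((i + 2 - 2 * b).factorial : ℂ))) +
      2 * ((b : ℂ) * (A ^ b / (b.factorial : ℂ))) *
        (B ^ (i + 2 - 2 * b) / ((i + 2 - 2 * b).factorial : ℂ)) := by
    intro b hb
    have hb' : 2 * b ≤ i + 2 := by
      have := Finset.mem_range.1 hb; omega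
    push_cast [Nat.cast_sub hb']
    ring
  have step : ∀ (X : ℂ) (k : ℕ),
      ((k + 1 : ℕ) : ℂ) * (X ^ (k + 1) / ((k + 1).factorial : ℂ)) =
        X * (X ^ k / (k.factorial : ℂ)) := by
    intro X k
    have h1 : (k.factorial : ℂ) ≠ 0 := by exact_mod_cast k.factorial_ne_zero
    have h2 : ((k : ℂ) + 1) ≠ 0 := by exact_mod_cast k.succ_ne_zero
    rw [Nat.factorial_succ]; push_cast; field_simp; ring
  rw [he, Finset.mul_sum, Finset.sum_congr rfl key, Finset.sum_add_distrib]
  congr 1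
  · have hs : Finset.range ((i + 1) / 2 + 1) ⊆ Finset.range ((i + 2) / 2 + 1) := by
      apply Finset.range_mono; omega
    rw [he, Finset.mul_sum, ← Finset.sum_subset hs]
    · refine Finset.sum_congr rfl fun b hb => ?_
      have hb' : 2 * b ≤ i + 1 := by have := Finset.mem_range.1 hb; omega
      obtain ⟨k, hk⟩ := Nat.exists_eq_add_of_le hb'
      have e1 : i + 2 - 2 * b = k + 1 := by omega
      have e2 : i + 1 - 2 * b = k := by omega
      rw [e1, e2, mul_left_comm, step]; ring
    -- The longer range has an extra index only if i + 2 = 2b, and there the factor i + 2 - 2b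
    -- vanishes.
    · intro b _ hb
      have hb1 : i + 2 - 2 * b = 0 := by
        have := Finset.mem_range.not.1 hb; omega
      simp [hb1]
  · have e : (i + 2) / 2 + 1 = (i / 2 + 1) + 1 := by omega
    rw [e, Finset.sum_range_succ', he, Finset.mul_sum]
    simp only [Nat.cast_zero, zero_mul, mul_zero, add_zero]
    refine Finset.sum_congr rfl fun b _ => ?_
    have e2 : i + 2 - 2 * (b + 1) = i - 2 * b := by omega
    rw [e2, step]; ring

/-- Homogeneity of the two-variable Hermite polynomials. -/
theorem he_homog (A B r : ℂ) (i : ℕ) : he (r ^ 2 * A) (r * B) i = r ^ i * he A B i := by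
  rw [he, he, Finset.mul_sum]
  refine Finset.sum_congr rfl fun b hb => ?_
  have hb' : 2 * b ≤ i := by have := Finset.mem_range.1 hb; omega
  have : r ^ i = (r ^ 2) ^ b * r ^ (i - 2 * b) := by
    rw [← pow_mul, ← pow_add]; congr 1; omega
  rw [this, mul_pow, mul_pow]; ring

/-- Since A has parabolic degree two and B degree one, every term is homogeneous of degree i. The
factor i + 1 overcounts the terms, and C^i absorbs C^b. -/
theorem norm_he_le (A B : ℂ) (C r : ℝ) (hC : 1 ≤ C) (hr : 0 ≤ r) (hA : ‖A‖ ≤ C * r ^ 2)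
    (hB : ‖B‖ ≤ r) (i : ℕ) : ‖he A B i‖ ≤ (i + 1) * C ^ i * r ^ i := by
  rw [he]
  refine (norm_sum_le _ _).trans ?_
  have hterm : ∀ b ∈ Finset.range (i / 2 + 1),
      ‖A ^ b / (b.factorial : ℂ) * (B ^ (i - 2 * b) / ((i - 2 * b).factorial : ℂ))‖ ≤
        C ^ i * r ^ i := by
    intro b hb
    have hb' : 2 * b ≤ i := by have := Finset.mem_range.1 hb; omega
    have hf : ∀ k : ℕ, (1 : ℝ) ≤ k.factorial := fun k => by
      exact_mod_cast Nat.succ_le_of_lt k.factorial_pos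
    rw [norm_mul, norm_div, norm_div, norm_pow, norm_pow, Complex.norm_natCast,
      Complex.norm_natCast]
    calc _ ≤ ‖A‖ ^ b * ‖B‖ ^ (i - 2 * b) := by
          gcongr
          · exact div_le_self (by positivity) (hf _)
          · exact div_le_self (by positivity) (hf _)
      _ ≤ (C * r ^ 2) ^ b * r ^ (i - 2 * b) := by gcongr
      _ = C ^ b * r ^ i := by
          rw [mul_pow, mul_assoc, ← pow_mul, ← pow_add]; congr 2; omega
      _ ≤ C ^ i * r ^ i := by
          gcongr
          omega
  refine (Finset.sum_le_card_nsmul _ _ _ hterm).trans ?_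
  rw [Finset.card_range, nsmul_eq_mul, mul_assoc]
  gcongr
  have : i / 2 ≤ i := Nat.div_le_self _ _
  push_cast
  have h2 : ((i / 2 : ℕ) : ℝ) ≤ i := by exact_mod_cast this
  simpa using h2

/-- The one-dimensional heat kernel. -/
def gauss1 (τ : ℂ) (x : ℝ) : ℂ :=
  (4 * (Real.pi : ℂ) * τ) ^ (-(1 : ℂ) / 2) * Complex.exp (-((x ^ 2 : ℝ) : ℂ) / (4 * τ))

/-- The `a`-th derivative of the one-dimensional heat kernel. -/
def dgauss1 (τ : ℂ) (a : ℕ) (x : ℝ) : ℂ :=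
  (a.factorial : ℂ) * he (-1 / (4 * τ)) (-(x : ℂ) / (2 * τ)) a * gauss1 τ x

theorem dgauss1_zero (τ : ℂ) (x : ℝ) : dgauss1 τ 0 x = gauss1 τ x := by
  simp [dgauss1, he_zero]

theorem dgauss1_one (τ : ℂ) (x : ℝ) : dgauss1 τ 1 x = -(x : ℂ) / (2 * τ) * gauss1 τ x := by
  simp [dgauss1, he_one]

/-- Leibniz' rule for G' = -(x/2τ) G. As `dgauss1` is an explicit formula, it is obtained from the
recurrence for `he`. -/
theorem dgauss1_succ_succ (τ : ℂ) (a : ℕ) (x : ℝ) :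
    dgauss1 τ (a + 2) x = -(x : ℂ) / (2 * τ) * dgauss1 τ (a + 1) x
      - ((a : ℂ) + 1) / (2 * τ) * dgauss1 τ a x := by
  have h := he_succ_succ (-1 / (4 * τ)) (-(x : ℂ) / (2 * τ)) a
  rw [dgauss1, dgauss1, dgauss1, Nat.factorial_succ (a + 1), Nat.factorial_succ a]
  push_cast
  calc _ = ((a : ℂ) + 1) * a.factorial *
        (((a : ℂ) + 2) * he (-1 / (4 * τ)) (-(x : ℂ) / (2 * τ)) (a + 2)) * gauss1 τ x := by ring
    _ = _ := by rw [h]; ring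

/-- The heat equation for the kernel and its derivatives, along a curve. -/
theorem hasDerivAt_dgauss1 {τ : ℝ → ℂ} {y : ℝ → ℝ} {τ' : ℂ} {y' l : ℝ}
    (hτ : HasDerivAt τ τ' l) (hy : HasDerivAt y y' l) (hpos : 0 < (τ l).re) (a : ℕ) :
    HasDerivAt (fun l => dgauss1 (τ l) a (y l))
      (τ' * dgauss1 (τ l) (a + 2) (y l) + y' * dgauss1 (τ l) (a + 1) (y l)) l := by
  have h0 : τ l ≠ 0 := fun h => by simp [h] at hpos
  have hyc : HasDerivAt (fun l => (y l : ℂ)) (y' : ℂ) l := hy.ofReal_comp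
  have hpi : (Real.pi : ℂ) ≠ 0 := by exact_mod_cast Real.pi_ne_zero
  -- A positive real part of τ keeps the base of the principal power off the branch cut.
  have hslit : 4 * (Real.pi : ℂ) * τ l ∈ Complex.slitPlane := by
    left
    have : (4 * (Real.pi : ℂ) * τ l).re = 4 * Real.pi * (τ l).re := by
      have : 4 * (Real.pi : ℂ) * τ l = ((4 * Real.pi : ℝ) : ℂ) * τ l := by push_cast; ring
      rw [this, Complex.re_ofReal_mul]
    rw [this]; positivity
  -- The recurrence reduces order b + 2 to b + 1 and b, and order 1 reduces to order 0, which alone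
  -- needs the derivative of the Gaussian. The content is ∂_τ = ∂_x².
  induction a using Nat.strong_induction_on with
  | _ a ih =>
  match a with
  | 0 =>
    simp only [dgauss1_zero, dgauss1_succ_succ, Nat.cast_zero]
    have hA : HasDerivAt (fun l => (4 * (Real.pi : ℂ) * τ l) ^ (-(1 : ℂ) / 2))
        (-(1 : ℂ) / 2 * (4 * (Real.pi : ℂ) * τ l) ^ (-(1 : ℂ) / 2 - 1) *
          (4 * (Real.pi : ℂ) * τ')) l := by
      have h1 : HasDerivAt (fun z : ℂ => z ^ (-(1 : ℂ) / 2))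
          (-(1 : ℂ) / 2 * (4 * (Real.pi : ℂ) * τ l) ^ (-(1 : ℂ) / 2 - 1) * 1)
          (4 * (Real.pi : ℂ) * τ l) := (hasDerivAt_id _).cpow_const hslit
      have h2 := h1.comp l (hτ.const_mul (4 * (Real.pi : ℂ)))
      rw [mul_one] at h2
      exact h2
    have hE : HasDerivAt (fun l => -((y l : ℂ) ^ 2) / (4 * τ l))
        ((-(2 * (y l : ℂ) * y') * (4 * τ l) - -((y l : ℂ) ^ 2) * (4 * τ')) / (4 * τ l) ^ 2) l :=
      ((hyc.pow 2).neg.div (hτ.const_mul 4) (mul_ne_zero (by norm_num) h0)).congr_deriv (by simp)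
    have hG : (fun l => gauss1 (τ l) (y l)) = fun l =>
        (4 * (Real.pi : ℂ) * τ l) ^ (-(1 : ℂ) / 2) * Complex.exp (-((y l : ℂ) ^ 2) / (4 * τ l)) := by
      funext l; simp [gauss1]
    rw [hG]
    refine (hA.mul hE.cexp).congr_deriv ?_
    rw [Complex.cpow_sub _ _ (mul_ne_zero (mul_ne_zero (by norm_num) hpi) h0), Complex.cpow_one]
    simp only [zero_add, dgauss1_one, gauss1]
    push_cast
    field_simp
    ring
  | 1 =>
    have ih0 := ih 0 one_pos
    simp only [dgauss1_zero] at ih0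
    have hB : HasDerivAt (fun l => -(y l : ℂ) / (2 * τ l))
        ((-(y' : ℂ) * (2 * τ l) - -(y l : ℂ) * (2 * τ')) / (2 * τ l) ^ 2) l :=
      hyc.neg.div (hτ.const_mul 2) (mul_ne_zero (by norm_num) h0)
    have := hB.mul ih0
    simp only [dgauss1_one]
    refine this.congr_deriv ?_
    simp only [dgauss1_succ_succ, dgauss1_one, dgauss1_zero]
    push_cast
    field_simp
    ring
  | b + 2 =>
    have ih0 := ih b (by omega)
    have ih1 := ih (b + 1) (by omega)
    have hB : HasDerivAt (fun l => -(y l : ℂ) / (2 * τ l))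
        ((-(y' : ℂ) * (2 * τ l) - -(y l : ℂ) * (2 * τ')) / (2 * τ l) ^ 2) l :=
      hyc.neg.div (hτ.const_mul 2) (mul_ne_zero (by norm_num) h0)
    have hC : HasDerivAt (fun l => ((b : ℂ) + 1) / (2 * τ l))
        ((0 * (2 * τ l) - ((b : ℂ) + 1) * (2 * τ')) / (2 * τ l) ^ 2) l :=
      (hasDerivAt_const l _).div (hτ.const_mul 2) (mul_ne_zero (by norm_num) h0)
    have := (hB.mul ih1).sub (hC.mul ih0)
    simp only [dgauss1_succ_succ _ b]
    refine this.congr_deriv ?_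
    simp only [dgauss1_succ_succ]
    push_cast
    field_simp
    ring

/-- The rate of decay of the Gaussian majorants. -/
def rate (ν : ℂ) : ℝ := (ν⁻¹).re / 16

theorem rate_pos {ν : ℂ} (hν : 0 < ν.re) : 0 < rate ν := by
  have : 0 < (ν⁻¹).re := by
    rw [Complex.inv_re]
    exact div_pos hν (Complex.normSq_pos.2 fun h => by simp [h] at hν)
  exact div_pos this (by norm_num)

/-- For r ≤ 1 the real part of x²/(4rν) is at least 4 `rate ν` x², and r ≥ 1/2 bounds the prefactor.
Of the rate 4 `rate ν`, three quarters are a reserve, spent later on polynomial factors and on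
translations. -/
theorem norm_gauss1_le {ν : ℂ} (hν : 0 < ν.re) {r : ℝ} (hr : 1 / 2 ≤ r) (hr1 : r ≤ 1) (x : ℝ) :
    ‖gauss1 (r * ν) x‖ ≤ ‖2 * (Real.pi : ℂ) * ν‖ ^ (-(1 : ℝ) / 2) *
      Real.exp (-(4 * rate ν) * x ^ 2) := by
  have hν0 : ν ≠ 0 := fun h => by simp [h] at hν
  have hr0 : 0 < r := by linarith
  have e : (-(1 : ℂ) / 2) = ((-(1 : ℝ) / 2 : ℝ) : ℂ) := by push_cast; ring
  rw [gauss1, norm_mul, e, Complex.norm_cpow_real, Complex.norm_exp]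
  have hpos : 0 < ‖2 * (Real.pi : ℂ) * ν‖ := by
    simp [hν0, Real.pi_ne_zero]
  gcongr ?_ * ?_
  · apply Real.rpow_le_rpow_of_nonpos hpos _ (by norm_num)
    simp only [norm_mul, Complex.norm_real, Complex.norm_ofNat, Real.norm_eq_abs, abs_of_pos hr0]
    have := mul_nonneg (mul_nonneg (abs_nonneg Real.pi) (norm_nonneg ν))
      (by linarith : 0 ≤ 4 * r - 2)
    nlinarith
  · apply Real.exp_le_exp.2
    have e2 : -((x ^ 2 : ℝ) : ℂ) / (4 * (r * ν)) = ((-(x ^ 2 / (4 * r)) : ℝ) : ℂ) * ν⁻¹ := by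
      have : (r : ℂ) ≠ 0 := by exact_mod_cast hr0.ne'
      push_cast; field_simp
    rw [e2, Complex.re_ofReal_mul]
    have h3 : (ν⁻¹).re = 16 * rate ν := by rw [rate]; ring
    rw [h3]
    have h4 : x ^ 2 / 4 ≤ x ^ 2 / (4 * r) := by
      apply div_le_div_of_nonneg_left (sq_nonneg x) (by positivity) (by linarith)
    have := mul_le_mul_of_nonneg_right h4 (rate_pos hν).le
    nlinarith

theorem one_add_abs_pow_le {c : ℝ} (hc : 0 < c) (a : ℕ) :
    ∃ C : ℝ, 0 ≤ C ∧ ∀ x : ℝ, (1 + |x|) ^ a ≤ C * Real.exp (c * x ^ 2) := by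
  -- Uses z^a/a! ≤ exp z at z = 1 + |x|, then |x| ≤ c x² + 1/(4c).
  refine ⟨a.factorial * Real.exp (1 + 1 / (4 * c)), by positivity, fun x => ?_⟩
  have h1 := Real.pow_div_factorial_le_exp (x := 1 + |x|) (by positivity) a
  have hf : (0 : ℝ) < a.factorial := by exact_mod_cast a.factorial_pos
  rw [div_le_iff₀ hf] at h1
  refine h1.trans ?_
  rw [mul_comm, mul_assoc, ← Real.exp_add]
  have h2 : |x| ≤ 1 / (4 * c) + c * x ^ 2 := by
    have : 0 ≤ (2 * c * |x| - 1) ^ 2 / (4 * c) := by positivity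
    have e : (2 * c * |x| - 1) ^ 2 / (4 * c) = c * x ^ 2 - |x| + 1 / (4 * c) := by
      rw [← sq_abs x]; field_simp; ring
    linarith
  exact mul_le_mul_of_nonneg_left (Real.exp_le_exp.2 (by linarith)) hf.le

theorem exists_norm_dgauss1_le {ν : ℂ} (hν : 0 < ν.re) (a : ℕ) :
    ∃ C : ℝ, 0 ≤ C ∧ ∀ r : ℝ, 1 / 2 ≤ r → r ≤ 1 → ∀ x y : ℝ, |y| ≤ 1 →
      ‖dgauss1 (r * ν) a (x - y)‖ ≤ C * Real.exp (-rate ν * x ^ 2) := by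
  have hν0 : ν ≠ 0 := fun h => by simp [h] at hν
  have hn : 0 < ‖ν‖ := norm_pos_iff.2 hν0
  have hc := rate_pos hν
  obtain ⟨C₁, hC₁, h₁⟩ := one_add_abs_pow_le (c := 2 * rate ν) (by positivity) a
  set C₂ := ‖2 * (Real.pi : ℂ) * ν‖ ^ (-(1 : ℝ) / 2)
  have hC₂ : 0 ≤ C₂ := by positivity
  set L := 1 / ‖ν‖ with hL
  set C₃ := (a.factorial : ℝ) * ((a + 1) * (1 + ‖ν‖) ^ a * L ^ a)
  have hC₃ : 0 ≤ C₃ := by positivity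
  refine ⟨C₃ * C₁ * C₂ * Real.exp (2 * rate ν), by positivity, fun r hr hr1 x y hy => ?_⟩
  have hr0 : 0 < r := by linarith
  set w := x - y
  -- The parabolic radius is L(1 + |w|) with L = 1/‖ν‖. The constant 1 + ‖ν‖ is needed because the
  -- quadratic coefficient is bounded by L = ‖ν‖ L².
  have hhe : ‖he (-1 / (4 * (r * ν))) (-(w : ℂ) / (2 * (r * ν))) a‖ ≤
      (a + 1) * (1 + ‖ν‖) ^ a * (L * (1 + |w|)) ^ a := by
    apply norm_he_le _ _ _ _ (by linarith) (by positivity)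
    · simp only [norm_div, norm_neg, norm_one, norm_mul, Complex.norm_real, Complex.norm_ofNat,
        Real.norm_eq_abs, abs_of_pos hr0]
      have h1 : 1 / (4 * (r * ‖ν‖)) ≤ L := by
        rw [hL]; apply one_div_le_one_div_of_le hn; nlinarith
      have h2 : (1 + ‖ν‖) * (L * (1 + |w|)) ^ 2 ≥ ‖ν‖ * (L * 1) ^ 2 := by
        gcongr
        · linarith
        · linarith [abs_nonneg w]
      have h3 : ‖ν‖ * (L * 1) ^ 2 = L := by rw [hL]; field_simp
      linarith
    · simp only [norm_div, norm_neg, norm_mul, Complex.norm_real, Complex.norm_ofNat,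
        Real.norm_eq_abs, abs_of_pos hr0]
      rw [div_le_iff₀ (by positivity), hL]
      have e : 1 / ‖ν‖ * (1 + |w|) * (2 * (r * ‖ν‖)) = (1 + |w|) * (2 * r) := by field_simp
      rw [e]
      nlinarith [abs_nonneg w]
  have hg := norm_gauss1_le hν hr hr1 w
  rw [dgauss1, norm_mul, norm_mul, Complex.norm_natCast]
  calc _ ≤ (a.factorial : ℝ) * ((a + 1) * (1 + ‖ν‖) ^ a * (L * (1 + |w|)) ^ a) *
        (C₂ * Real.exp (-(4 * rate ν) * w ^ 2)) := by gcongr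
    _ = C₃ * (1 + |w|) ^ a * C₂ * Real.exp (-(4 * rate ν) * w ^ 2) := by
        rw [mul_pow]; ring
    _ ≤ C₃ * (C₁ * Real.exp (2 * rate ν * w ^ 2)) * C₂ * Real.exp (-(4 * rate ν) * w ^ 2) := by
        gcongr; exact h₁ w
    _ = C₃ * C₁ * C₂ * Real.exp (-(2 * rate ν) * w ^ 2) := by
        have : Real.exp (-(2 * rate ν) * w ^ 2) =
          Real.exp (2 * rate ν * w ^ 2) * Real.exp (-(4 * rate ν) * w ^ 2) := by
          rw [← Real.exp_add]; congr 1; ring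
        rw [this]; ring
    -- Removes the shift: 2(x-y)² ≥ x² - 2y² ≥ x² - 2 when |y| ≤ 1.
    _ ≤ C₃ * C₁ * C₂ * (Real.exp (2 * rate ν) * Real.exp (-rate ν * x ^ 2)) := by
        gcongr
        rw [← Real.exp_add]
        apply Real.exp_le_exp.2
        have hy2 : y ^ 2 ≤ 1 := by rw [← sq_abs]; nlinarith [abs_nonneg y]
        have : 0 ≤ (x - 2 * y) ^ 2 := sq_nonneg _
        have hw : 2 * w ^ 2 ≥ x ^ 2 - 2 := by simp only [w]; nlinarith
        nlinarith
    _ = _ := by ring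

/-! ### Parabolic Taylor expansion in one dimension. -/

/-- The Taylor polynomial along the parabolic curve `λ ↦ ((1 - λ² σ) ν, x - λ z)`. -/
def mehlerSum (ν : ℂ) (σ z : ℝ) (N a : ℕ) (l x : ℝ) : ℂ :=
  ∑ i ∈ Finset.range N, (l : ℂ) ^ i * he (-(ν * σ)) (-(z : ℂ)) i * dgauss1 ν (a + i) x

/-- Along the curve the kernel satisfies d/dλ = -2λσν ∂² - z ∂. The truncations satisfy the same
equation with the order lowered by two and by one, so the remainders do too, and they can be
estimated by induction on the order. For N = 0 both truncations on the right are empty. -/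
theorem hasDerivAt_mehlerSum (ν : ℂ) (σ z : ℝ) (N a : ℕ) (l x : ℝ) :
    HasDerivAt (fun l => mehlerSum ν σ z (N + 1) a l x)
      (-(2 * l * σ * ν) * mehlerSum ν σ z (N - 1) (a + 2) l x
        - z * mehlerSum ν σ z N (a + 1) l x) l := by
  set q := he (-(ν * σ)) (-(z : ℂ)) with hq
  have hrec : ∀ i : ℕ, ((i : ℂ) + 2) * q (i + 2) = -(z : ℂ) * q (i + 1) + 2 * (-(ν * σ)) * q i :=
    fun i => he_succ_succ _ _ i
  have hq1 : q 1 = -(z : ℂ) * q 0 := by rw [hq, he_one, he_zero, mul_one]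
  have hd : HasDerivAt (fun l => mehlerSum ν σ z (N + 1) a l x)
      (∑ i ∈ Finset.range (N + 1), ((i : ℂ) * (l : ℂ) ^ (i - 1)) * q i * dgauss1 ν (a + i) x) l := by
    apply HasDerivAt.fun_sum
    intro i _
    have h1 : HasDerivAt (fun l : ℝ => (l : ℂ) ^ i) ((i : ℂ) * (l : ℂ) ^ (i - 1)) l := by
      refine ((hasDerivAt_id l).ofReal_comp.pow i).congr_deriv ?_
      simp
    exact (h1.mul_const _).mul_const _
  refine hd.congr_deriv ?_
  clear hd
  simp only [mehlerSum, ← hq]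
  induction N with
  | zero => simp
  | succ N ih =>
    rw [Finset.sum_range_succ, ih]
    cases N with
    | zero => simp [hq1, mul_assoc]
    | succ N =>
      simp only [Nat.add_sub_cancel]
      rw [Finset.sum_range_succ (n := N + 1),
        Finset.sum_range_succ (fun i => (l : ℂ) ^ i * q i * dgauss1 ν (a + 2 + i) x) N]
      have h := hrec N
      have e1 : a + (N + 1 + 1) = a + 2 + N := by ring
      have e2 : a + 1 + (N + 1) = a + 2 + N := by ring
      rw [e1, e2]
      push_cast
      linear_combination (l : ℂ) ^ (N + 1) * dgauss1 ν (a + 2 + N) x * h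

theorem mehlerSum_zero_succ (ν : ℂ) (σ z : ℝ) (N a : ℕ) (x : ℝ) :
    mehlerSum ν σ z (N + 1) a 0 x = dgauss1 ν a x := by
  rw [mehlerSum, Finset.sum_range_succ']
  simp [he_zero]

/-- Quantitative Mehler expansion in one dimension. -/
theorem exists_mehler_bound {ν : ℂ} (hν : 0 < ν.re) (N : ℕ) : ∀ a : ℕ,
    ∃ C : ℝ, 0 ≤ C ∧ ∀ ρ : ℝ, 0 ≤ ρ → ρ ≤ 1 / 2 → ∀ σ z : ℝ, 0 ≤ σ → σ ≤ ρ ^ 2 → |z| ≤ ρ →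
      ∀ l ∈ Icc (0 : ℝ) 1, ∀ x : ℝ,
        ‖dgauss1 ((1 - l ^ 2 * σ : ℝ) * ν) a (x - l * z) - mehlerSum ν σ z N a l x‖ ≤
          C * ρ ^ N * Real.exp (-rate ν * x ^ 2) := by
  have hr : ∀ {ρ σ l : ℝ}, 0 ≤ ρ → ρ ≤ 1 / 2 → 0 ≤ σ → σ ≤ ρ ^ 2 → l ∈ Icc (0 : ℝ) 1 →
      1 / 2 ≤ 1 - l ^ 2 * σ ∧ 1 - l ^ 2 * σ ≤ 1 := by
    intro ρ σ l h0 h1 h2 h3 hl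
    have hl2 : l ^ 2 ≤ 1 := by nlinarith [hl.1, hl.2]
    have : l ^ 2 * σ ≤ 1 * σ := by gcongr
    constructor
    · nlinarith
    · nlinarith [mul_nonneg (sq_nonneg l) h2]
  induction N using Nat.strong_induction_on with
  | _ N ih =>
  intro a
  match N with
  | 0 =>
    obtain ⟨C, hC, h⟩ := exists_norm_dgauss1_le hν a
    refine ⟨C, hC, fun ρ h0 h1 σ z h2 h3 h4 l hl x => ?_⟩
    simp only [mehlerSum, Finset.range_zero, Finset.sum_empty, sub_zero, pow_zero, mul_one]
    obtain ⟨hr1, hr2⟩ := hr h0 h1 h2 h3 hl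
    apply h _ hr1 hr2
    rw [abs_mul, abs_of_nonneg hl.1]
    nlinarith [hl.1, hl.2, abs_nonneg z]
  | N + 1 =>
    obtain ⟨C₁, hC₁, H₁⟩ := ih (N - 1) (by omega) (a + 2)
    obtain ⟨C₂, hC₂, H₂⟩ := ih N (by omega) (a + 1)
    refine ⟨2 * ‖ν‖ * C₁ + C₂, by positivity, fun ρ h0 h1 σ z h2 h3 h4 l hl x => ?_⟩
    set e : ℝ → ℂ := fun l => dgauss1 ((1 - l ^ 2 * σ : ℝ) * ν) a (x - l * z) -
      mehlerSum ν σ z (N + 1) a l x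
    -- The derivative of the remainder is a combination of remainders of lower order for higher
    -- derivatives; the factors σ ≤ ρ² and |z| ≤ ρ restore the lost powers of ρ.
    set e' : ℝ → ℂ := fun l =>
      -(2 * l * σ * ν) * (dgauss1 ((1 - l ^ 2 * σ : ℝ) * ν) (a + 2) (x - l * z) -
        mehlerSum ν σ z (N - 1) (a + 2) l x) -
      z * (dgauss1 ((1 - l ^ 2 * σ : ℝ) * ν) (a + 1) (x - l * z) -
        mehlerSum ν σ z N (a + 1) l x)
    have hderiv : ∀ l ∈ Icc (0 : ℝ) 1, HasDerivAt e (e' l) l := by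
      intro l hl
      obtain ⟨hr1, hr2⟩ := hr h0 h1 h2 h3 hl
      have hτ : HasDerivAt (fun l : ℝ => ((1 - l ^ 2 * σ : ℝ) : ℂ) * ν) (-(2 * l * σ * ν)) l := by
        have := ((((hasDerivAt_id l).pow 2).mul_const σ).const_sub 1).ofReal_comp.mul_const ν
        refine this.congr_deriv ?_
        simp
      have hy : HasDerivAt (fun l : ℝ => x - l * z) (-z) l := by
        have := ((hasDerivAt_id l).mul_const z).const_sub x
        simpa using this
      have := (hasDerivAt_dgauss1 hτ hy (by
        rw [Complex.re_ofReal_mul]; exact mul_pos (by linarith) hν) a).sub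
        (hasDerivAt_mehlerSum ν σ z N a l x)
      refine this.congr_deriv ?_
      simp only [e']
      push_cast
      ring
    have hbound : ∀ l ∈ Icc (0 : ℝ) 1, ‖e' l‖ ≤
        (2 * ‖ν‖ * C₁ + C₂) * ρ ^ (N + 1) * Real.exp (-rate ν * x ^ 2) := by
      intro l hl
      -- For N = 0 the exponent N - 1 is truncated to 0, and the inequality is ρ² ≤ ρ; otherwise it
      -- is an equality.
      have hp : ρ ^ 2 * ρ ^ (N - 1) ≤ ρ ^ (N + 1) := by
        cases N with
        | zero => simp; nlinarith
        | succ N => rw [← pow_add]; apply le_of_eq; congr 1; simp; ring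
      refine (norm_sub_le _ _).trans ?_
      rw [norm_mul, norm_mul]
      have a1 : ‖(-(2 * l * σ * ν) : ℂ)‖ ≤ 2 * ‖ν‖ * ρ ^ 2 := by
        simp only [norm_neg, norm_mul, Complex.norm_real, Complex.norm_ofNat, Real.norm_eq_abs,
          abs_of_nonneg hl.1, abs_of_nonneg h2]
        calc 2 * l * σ * ‖ν‖ ≤ 2 * 1 * ρ ^ 2 * ‖ν‖ := by gcongr; exact hl.2
          _ = _ := by ring
      have a2 : ‖(z : ℂ)‖ ≤ ρ := by simpa using h4
      calc _ ≤ 2 * ‖ν‖ * ρ ^ 2 * (C₁ * ρ ^ (N - 1) * Real.exp (-rate ν * x ^ 2)) +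
            ρ * (C₂ * ρ ^ N * Real.exp (-rate ν * x ^ 2)) := by
            gcongr
            · exact H₁ ρ h0 h1 σ z h2 h3 h4 l hl x
            · exact H₂ ρ h0 h1 σ z h2 h3 h4 l hl x
        _ = (2 * ‖ν‖ * C₁ * (ρ ^ 2 * ρ ^ (N - 1)) + C₂ * ρ ^ (N + 1)) *
            Real.exp (-rate ν * x ^ 2) := by ring
        _ ≤ (2 * ‖ν‖ * C₁ * ρ ^ (N + 1) + C₂ * ρ ^ (N + 1)) *
            Real.exp (-rate ν * x ^ 2) := by gcongr
        _ = _ := by ring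
    have he0 : e 0 = 0 := by simp [e, mehlerSum_zero_succ]
    have hmv := (convex_Icc (0 : ℝ) 1).norm_image_sub_le_of_norm_hasDerivWithin_le
      (fun l hl => (hderiv l hl).hasDerivWithinAt) hbound
      (left_mem_Icc.2 zero_le_one) hl
    rw [he0, sub_zero, sub_zero] at hmv
    refine hmv.trans ?_
    rw [Real.norm_eq_abs, abs_of_nonneg hl.1]
    have : 0 ≤ (2 * ‖ν‖ * C₁ + C₂) * ρ ^ (N + 1) * Real.exp (-rate ν * x ^ 2) := by positivity
    nlinarith [hl.2]

/-! ### The Taylor expansion of the Gaussian in n dimensions. -/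

/-- The multi-indices of length at most `N`. -/
def lowIdx (n N : ℕ) : Finset (Fin n → ℕ) :=
  (Fintype.piFinset fun _ => Finset.range (N + 1)).filter fun κ => mlen κ ≤ N

theorem le_mlen {n : ℕ} (κ : Fin n → ℕ) (j : Fin n) : κ j ≤ mlen κ :=
  Finset.single_le_sum (f := κ) (fun _ _ => Nat.zero_le _) (Finset.mem_univ j)

theorem mem_lowIdx {n N : ℕ} {κ : Fin n → ℕ} : κ ∈ lowIdx n N ↔ mlen κ ≤ N := by
  simp only [lowIdx, Finset.mem_filter, Fintype.mem_piFinset, Finset.mem_range,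
    and_iff_right_iff_imp]
  intro h j
  have := le_mlen κ j
  omega

theorem sum_lowIdx {n N : ℕ} (F : (Fin n → ℕ) → ℂ) :
    ∑ κ ∈ lowIdx n N, F κ = ∑ k ∈ Finset.range (N + 1), ∑ κ ∈ multiIdx n k, F κ := by
  rw [← Finset.sum_fiberwise_of_maps_to (s := lowIdx n N) (t := Finset.range (N + 1))
    (g := fun κ => mlen κ) (fun κ hκ => Finset.mem_range.2 (by have := mem_lowIdx.1 hκ; omega))]
  refine Finset.sum_congr rfl fun k hk => Finset.sum_congr ?_ fun _ _ => rfl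
  ext κ
  have := Finset.mem_range.1 hk
  simp only [Finset.mem_filter, mem_lowIdx, mem_multiIdx]
  constructor
  · exact fun h => h.2
  · intro h; constructor <;> omega

/-- The partial derivative `∂^κ G_ν`. -/
def dgauss {n : ℕ} (ν : ℂ) (κ : Fin n → ℕ) (ξ : Rn n) : ℂ := ∏ j, dgauss1 ν (κ j) (ξ j)

/-- The coefficient of `∂^κ G_ν` in the expansion of `G_{(1-σ)ν}(· - z)`. -/
def heatCoeff {n : ℕ} (ν : ℂ) (κ : Fin n → ℕ) (σ : ℝ) (z : Rn n) : ℂ :=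
  ∏ j, he (-(ν * σ)) (-(z j : ℂ)) (κ j)

/-- The remainder of the parabolic Taylor expansion of `G_{(1-σ)ν}(ξ - z)`. -/
def remKer {n : ℕ} (ν : ℂ) (N : ℕ) (σ : ℝ) (z ξ : Rn n) : ℂ :=
  gauss (((1 - σ : ℝ) : ℂ) * ν) (ξ - z) - ∑ κ ∈ lowIdx n N, heatCoeff ν κ σ z * dgauss ν κ ξ

/-- The principal power causes no branch problem, since w^(n·a) = (w^a)^n for natural n. -/
theorem gauss_eq_prod {n : ℕ} (ν : ℂ) (ξ : Rn n) : gauss ν ξ = ∏ j, gauss1 ν (ξ j) := by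
  simp only [gauss, gauss1]
  rw [Finset.prod_mul_distrib, Finset.prod_const, Finset.card_univ, Fintype.card_fin,
    ← Complex.cpow_nat_mul, ← Complex.exp_sum, EuclideanSpace.norm_sq_eq]
  congr 2
  · ring
  · push_cast
    rw [← Finset.sum_div, Finset.sum_neg_distrib]
    simp [← Complex.ofReal_pow]

theorem prod_exp_eq {n : ℕ} (c : ℝ) (ξ : Rn n) :
    ∏ j, Real.exp (-c * ξ j ^ 2) = Real.exp (-c * ‖ξ‖ ^ 2) := by
  rw [← Real.exp_sum, EuclideanSpace.norm_sq_eq, ← Finset.mul_sum]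
  simp

/-- In one variable, the substitution A = -1/(4ν), B = -x/(2ν) in `he` collects the factor (-2)^(-κ)
and the power ν^(-(κ-b)), because b + (κ - 2b) = κ - b. This links the derivatives to the Hermite
polynomials of the profiles. -/
theorem dgauss_eq {n : ℕ} (ν : ℂ) (κ : Fin n → ℕ) (ξ : Rn n) :
    dgauss ν κ ξ = ((-2) ^ mlen κ)⁻¹ * (hermitePoly ν κ ξ * gauss ν ξ) := by
  have hset : (Finset.Icc 0 κ).filter (fun β => ∀ j, 2 * β j ≤ κ j) =
      Fintype.piFinset fun j => Finset.range (κ j / 2 + 1) := by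
    ext β
    simp only [Finset.mem_filter, Finset.mem_Icc, Fintype.mem_piFinset, Finset.mem_range]
    constructor
    · intro h j; have := h.2 j; omega
    · intro h
      have h' : ∀ j, 2 * β j ≤ κ j := fun j => by have := h j; omega
      exact ⟨⟨fun j => Nat.zero_le _, fun j => by have := h' j; show β j ≤ κ j; omega⟩, h'⟩
  have h1 : ∀ j, dgauss1 ν (κ j) (ξ j) = ((-2) ^ κ j)⁻¹ *
      (∑ b ∈ Finset.range (κ j / 2 + 1), (-1) ^ b * ((κ j).factorial : ℂ) /
        ((b.factorial : ℂ) * ((κ j - 2 * b).factorial : ℂ)) * (ν ^ (κ j - b))⁻¹ *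
        ((ξ j : ℂ) ^ (κ j - 2 * b))) * gauss1 ν (ξ j) := by
    intro j
    rw [dgauss1, he, Finset.mul_sum, Finset.mul_sum]
    congr 1
    refine Finset.sum_congr rfl fun b hb => ?_
    have hb' : 2 * b ≤ κ j := by have := Finset.mem_range.1 hb; omega
    have e1 : κ j - b = b + (κ j - 2 * b) := by omega
    have e2 : (-2 : ℂ) ^ κ j = ((-2) ^ 2) ^ b * (-2) ^ (κ j - 2 * b) := by
      rw [← pow_mul, ← pow_add]; congr 1; omega
    rw [e1, e2, pow_add, div_pow, div_pow, mul_pow, mul_pow, neg_pow (ξ j : ℂ),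
      neg_pow (2 : ℂ) (κ j - 2 * b)]
    have : ((-1 : ℂ) ^ (κ j - 2 * b))⁻¹ = (-1) ^ (κ j - 2 * b) := by
      rw [← inv_pow]; norm_num
    simp only [mul_inv, div_eq_mul_inv, this]
    norm_num
    ring
  rw [dgauss, gauss_eq_prod, Finset.prod_congr rfl fun j _ => h1 j, Finset.prod_mul_distrib,
    Finset.prod_mul_distrib, Finset.prod_univ_sum, hermitePoly, hset, mul_assoc]
  congr 1
  · rw [Finset.prod_inv_distrib, Finset.prod_pow_eq_pow_sum, mlen]
  · congr 1
    refine Finset.sum_congr rfl fun β _ => ?_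
    simp only [Finset.prod_mul_distrib, Finset.prod_div_distrib, Finset.prod_inv_distrib,
      Finset.prod_pow_eq_pow_sum, mlen, mfact, mpow, Pi.sub_apply, Pi.smul_apply, smul_eq_mul]
    push_cast
    ring

/-- Telescoping: exchange one factor at a time, bounding the others by C E. -/
theorem norm_prod_sub_prod_le {ι : Type*} (s : Finset ι) (F P : ι → ℂ) (E : ι → ℝ)
    (hE : ∀ i, 0 ≤ E i) {C δ : ℝ} (hC : 1 ≤ C) (hδ : 0 ≤ δ) (hF : ∀ i, ‖F i‖ ≤ C * E i)
    (hP : ∀ i, ‖P i‖ ≤ C * E i) (hFP : ∀ i, ‖F i - P i‖ ≤ δ * E i) :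
    ‖∏ i ∈ s, F i - ∏ i ∈ s, P i‖ ≤ s.card * C ^ s.card * δ * ∏ i ∈ s, E i := by
  classical
  induction s using Finset.induction_on with
  | empty => simp
  | insert a s ha ih =>
    rw [Finset.prod_insert ha, Finset.prod_insert ha, Finset.prod_insert ha,
      Finset.card_insert_of_notMem ha]
    have hp : ‖∏ i ∈ s, F i‖ ≤ C ^ s.card * ∏ i ∈ s, E i := by
      rw [norm_prod, ← Finset.prod_const, ← Finset.prod_mul_distrib]
      exact Finset.prod_le_prod (fun _ _ => norm_nonneg _) fun i _ => hF i
    have e : F a * ∏ i ∈ s, F i - P a * ∏ i ∈ s, P i =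
      (F a - P a) * ∏ i ∈ s, F i + P a * (∏ i ∈ s, F i - ∏ i ∈ s, P i) := by ring
    have hE' : 0 ≤ ∏ i ∈ s, E i := Finset.prod_nonneg fun i _ => hE i
    have hEa := hE a
    rw [e]
    refine (norm_add_le _ _).trans ?_
    rw [norm_mul, norm_mul]
    calc _ ≤ δ * E a * (C ^ s.card * ∏ i ∈ s, E i) +
          C * E a * (s.card * C ^ s.card * δ * ∏ i ∈ s, E i) := by
          gcongr
          · exact hFP a
          · exact hP a
      _ ≤ δ * E a * (C * (C ^ s.card * ∏ i ∈ s, E i)) +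
          C * E a * (s.card * C ^ s.card * δ * ∏ i ∈ s, E i) := by
          gcongr δ * E a * ?_ + _
          exact le_mul_of_one_le_left (by positivity) hC
      _ = _ := by push_cast; ring

theorem norm_heatCoeff_le {n : ℕ} (ν : ℂ) (κ : Fin n → ℕ) {σ ρ : ℝ} {z : Rn n} (hρ : 0 ≤ ρ)
    (hσ : 0 ≤ σ) (hσρ : σ ≤ ρ ^ 2) (hz : ‖z‖ ≤ ρ) :
    ‖heatCoeff ν κ σ z‖ ≤ ((mlen κ + 1) * (1 + ‖ν‖) ^ mlen κ) ^ n * ρ ^ mlen κ := by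
  rw [heatCoeff, norm_prod]
  have h : ∀ j, ‖he (-(ν * σ)) (-(z j : ℂ)) (κ j)‖ ≤
      ((mlen κ + 1) * (1 + ‖ν‖) ^ mlen κ) * ρ ^ κ j := by
    intro j
    refine (norm_he_le _ _ (1 + ‖ν‖) ρ (by linarith [norm_nonneg ν]) hρ ?_ ?_ _).trans ?_
    · rw [norm_neg, norm_mul, Complex.norm_real, Real.norm_eq_abs, abs_of_nonneg hσ]
      gcongr
      linarith
    · rw [norm_neg, Complex.norm_real]
      exact (PiLp.norm_apply_le z j).trans hz
    · have := le_mlen κ j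
      gcongr
      linarith [norm_nonneg ν]
  refine (Finset.prod_le_prod (fun _ _ => norm_nonneg _) fun j _ => h j).trans ?_
  rw [Finset.prod_mul_distrib, Finset.prod_const, Finset.card_univ, Fintype.card_fin,
    Finset.prod_pow_eq_pow_sum, mlen]

theorem exists_norm_gauss_le {n : ℕ} {ν : ℂ} (hν : 0 < ν.re) :
    ∃ C : ℝ, 0 ≤ C ∧ ∀ r : ℝ, 1 / 2 ≤ r → r ≤ 1 → ∀ ξ : Rn n,
      ‖gauss (r * ν) ξ‖ ≤ C * Real.exp (-rate ν * ‖ξ‖ ^ 2) := by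
  obtain ⟨C, hC, h⟩ := exists_norm_dgauss1_le hν 0
  refine ⟨C ^ n, by positivity, fun r hr hr1 ξ => ?_⟩
  rw [gauss_eq_prod, norm_prod, ← prod_exp_eq]
  refine (Finset.prod_le_prod (fun _ _ => norm_nonneg _)
    (g := fun j => C * Real.exp (-rate ν * ξ j ^ 2)) fun j _ => ?_).trans ?_
  · have := h r hr hr1 (ξ j) 0 (by simp)
    simpa [dgauss1_zero] using this
  · rw [Finset.prod_mul_distrib]; simp

theorem exists_norm_dgauss_le {n : ℕ} {ν : ℂ} (hν : 0 < ν.re) (κ : Fin n → ℕ) :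
    ∃ C : ℝ, 0 ≤ C ∧ ∀ ξ : Rn n, ‖dgauss ν κ ξ‖ ≤ C * Real.exp (-rate ν * ‖ξ‖ ^ 2) := by
  choose C hC h using fun a => exists_norm_dgauss1_le hν a
  refine ⟨∏ j, C (κ j), Finset.prod_nonneg fun j _ => hC _, fun ξ => ?_⟩
  rw [dgauss, norm_prod, ← prod_exp_eq, ← Finset.prod_mul_distrib]
  refine Finset.prod_le_prod (fun _ _ => norm_nonneg _) fun j _ => ?_
  have := h (κ j) 1 (by norm_num) le_rfl (ξ j) 0 (by simp)
  simpa using this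

/-- The Gaussian is a product, so each factor is replaced by its one-dimensional expansion. The
product of the expansions is the wanted sum plus cross terms of length greater than N, which are
themselves of size ρ^(N+1). -/
theorem exists_norm_remKer_le_of_small {n : ℕ} {ν : ℂ} (hν : 0 < ν.re) (N : ℕ) :
    ∃ C : ℝ, 0 ≤ C ∧ ∀ ρ : ℝ, 0 ≤ ρ → ρ ≤ 1 / 2 → ∀ (σ : ℝ) (z ξ : Rn n), 0 ≤ σ → σ ≤ ρ ^ 2 →
      ‖z‖ ≤ ρ → ‖remKer ν N σ z ξ‖ ≤ C * ρ ^ (N + 1) * Real.exp (-rate ν * ‖ξ‖ ^ 2) := by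
  obtain ⟨C₀, hC₀, h₀⟩ := exists_norm_dgauss1_le hν 0
  obtain ⟨C₁, hC₁, h₁⟩ := exists_mehler_bound hν (N + 1) 0
  choose D hD hdD using fun a => exists_norm_dgauss1_le hν a
  set A : ℕ → ℝ := fun i => (i + 1) * (1 + ‖ν‖) ^ i * D i with hA
  have hA0 : ∀ i, 0 ≤ A i := fun i => by have := hD i; positivity
  set B : ℝ := ∑ i ∈ Finset.range (N + 1), A i
  have hB : 0 ≤ B := Finset.sum_nonneg fun i _ => hA0 i
  have hAB : ∀ i ∈ Finset.range (N + 1), A i ≤ B := fun i hi =>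
    Finset.single_le_sum (fun i _ => hA0 i) hi
  set C : ℝ := 1 + C₀ + B with hCdef
  -- The cross terms: every κ j is at most N, but |κ| exceeds N.
  set T := ((Fintype.piFinset fun _ : Fin n => Finset.range (N + 1)).filter
    fun κ => ¬ mlen κ ≤ N) with hT
  refine ⟨n * C ^ n * C₁ + T.card * B ^ n, by positivity,
    fun ρ h0 h1 σ z ξ h2 h3 h4 => ?_⟩
  have hz : ∀ j, |z j| ≤ ρ := fun j => by
    have := PiLp.norm_apply_le z j; rw [Real.norm_eq_abs] at this; exact this.trans h4
  set F : Fin n → ℂ := fun j => gauss1 ((1 - σ : ℝ) * ν) (ξ j - z j)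
  set t : Fin n → ℕ → ℂ := fun j i => he (-(ν * σ)) (-(z j : ℂ)) i * dgauss1 ν i (ξ j)
  set P : Fin n → ℂ := fun j => ∑ i ∈ Finset.range (N + 1), t j i
  set E : Fin n → ℝ := fun j => Real.exp (-rate ν * ξ j ^ 2)
  have hE : ∀ j, 0 ≤ E j := fun j => (Real.exp_pos _).le
  have ht : ∀ j i, ‖t j i‖ ≤ A i * ρ ^ i * E j := by
    intro j i
    rw [norm_mul]
    have a1 := norm_he_le (-(ν * σ)) (-(z j : ℂ)) (1 + ‖ν‖) ρ (by linarith [norm_nonneg ν]) h0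
      (by
        rw [norm_neg, norm_mul, Complex.norm_real, Real.norm_eq_abs, abs_of_nonneg h2]
        gcongr; linarith)
      (by rw [norm_neg, Complex.norm_real]; exact hz j) i
    have a2 := hdD i 1 (by norm_num) le_rfl (ξ j) 0 (by simp)
    simp only [Complex.ofReal_one, one_mul, sub_zero] at a2
    calc _ ≤ ((i + 1) * (1 + ‖ν‖) ^ i * ρ ^ i) * (D i * E j) := by gcongr
      _ = _ := by simp only [hA]; ring
  have hP : ∀ j, ‖P j‖ ≤ C * E j := by
    intro j
    refine (norm_sum_le _ _).trans ?_
    calc _ ≤ ∑ i ∈ Finset.range (N + 1), A i * E j := by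
          refine Finset.sum_le_sum fun i _ => (ht j i).trans ?_
          have : ρ ^ i ≤ 1 := pow_le_one₀ h0 (by linarith)
          have := mul_le_mul_of_nonneg_left this (hA0 i)
          rw [mul_one] at this
          exact mul_le_mul_of_nonneg_right this (hE j)
      _ = B * E j := by rw [Finset.sum_mul]
      _ ≤ _ := mul_le_mul_of_nonneg_right (by linarith) (hE j)
  have hσ : σ ≤ 1 / 4 := by nlinarith
  have hF : ∀ j, ‖F j‖ ≤ C * E j := by
    intro j
    have := h₀ (1 - σ) (by linarith) (by linarith) (ξ j) (z j) ((hz j).trans (by linarith))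
    rw [dgauss1_zero] at this
    exact this.trans (mul_le_mul_of_nonneg_right (by linarith) (hE j))
  have hFP : ∀ j, ‖F j - P j‖ ≤ C₁ * ρ ^ (N + 1) * E j := by
    intro j
    have := h₁ ρ h0 h1 σ (z j) h2 h3 (hz j) 1 (right_mem_Icc.2 zero_le_one) (ξ j)
    simpa [dgauss1_zero, mehlerSum, F, P, t, E] using this
  have hprod := norm_prod_sub_prod_le Finset.univ F P E hE (by linarith : 1 ≤ C)
    (by positivity : 0 ≤ C₁ * ρ ^ (N + 1)) hF hP hFP
  rw [Finset.card_univ, Fintype.card_fin] at hprod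
  have hexp : ∏ j, P j = ∑ κ ∈ lowIdx n N, heatCoeff ν κ σ z * dgauss ν κ ξ +
      ∑ κ ∈ T, ∏ j, t j (κ j) := by
    simp only [P]
    rw [Finset.prod_univ_sum, ← Finset.sum_filter_add_sum_filter_not _ (fun κ => mlen κ ≤ N)]
    congr 1
    refine Finset.sum_congr rfl fun κ _ => ?_
    rw [heatCoeff, dgauss, ← Finset.prod_mul_distrib]
  have hrest : ‖∑ κ ∈ T, ∏ j, t j (κ j)‖ ≤ T.card * B ^ n * ρ ^ (N + 1) * ∏ j, E j := by
    have hprodE : 0 ≤ ∏ j, E j := Finset.prod_nonneg fun j _ => hE j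
    refine (norm_sum_le _ _).trans ?_
    refine (Finset.sum_le_card_nsmul _ _ (B ^ n * ρ ^ (N + 1) * ∏ j, E j) fun κ hκ => ?_).trans ?_
    · rw [hT, Finset.mem_filter, Fintype.mem_piFinset] at hκ
      rw [norm_prod]
      calc _ ≤ ∏ j, (B * ρ ^ κ j * E j) := by
            refine Finset.prod_le_prod (fun _ _ => norm_nonneg _) fun j _ => (ht j _).trans ?_
            have := hAB _ (hκ.1 j)
            have := hE j
            gcongr
        _ = B ^ n * ρ ^ mlen κ * ∏ j, E j := by
            rw [Finset.prod_mul_distrib, Finset.prod_mul_distrib, Finset.prod_const,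
              Finset.card_univ, Fintype.card_fin, Finset.prod_pow_eq_pow_sum, mlen]
        _ ≤ _ := by
            have : ρ ^ mlen κ ≤ ρ ^ (N + 1) :=
              pow_le_pow_of_le_one h0 (by linarith) (by omega)
            gcongr
    · rw [nsmul_eq_mul]; apply le_of_eq; ring
  have hker : remKer ν N σ z ξ = (∏ j, F j - ∏ j, P j) + ∑ κ ∈ T, ∏ j, t j (κ j) := by
    rw [remKer, gauss_eq_prod, hexp]
    simp only [F, PiLp.sub_apply]
    ring
  rw [hker, ← prod_exp_eq]
  refine (norm_add_le _ _).trans ((add_le_add hprod hrest).trans (le_of_eq ?_))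
  ring

/-- The modulus `r ↦ r^N min(1, r)`. -/
def modulus (N : ℕ) (r : ℝ) : ℝ := r ^ N * min 1 r

/-- Small radii use the Taylor bound ρ^(N+1). For radii at least 1/2 no cancellation is needed: the
Gaussian and each term of its expansion are separately O(ρ^N). The translated Gaussian is then
estimated at ξ - z, hence the second exponential. -/
theorem exists_norm_remKer_le {n : ℕ} {ν : ℂ} (hν : 0 < ν.re) (N : ℕ) :
    ∃ C : ℝ, 0 ≤ C ∧ ∀ (σ : ℝ) (z ξ : Rn n), 0 ≤ σ → σ ≤ 1 / 2 →
      ‖remKer ν N σ z ξ‖ ≤ C * modulus N (max √σ ‖z‖) *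
        (Real.exp (-rate ν * ‖ξ‖ ^ 2) + Real.exp (-rate ν * ‖ξ - z‖ ^ 2)) := by
  obtain ⟨C₁, hC₁, h₁⟩ := exists_norm_remKer_le_of_small (n := n) hν N
  obtain ⟨C₂, hC₂, h₂⟩ := exists_norm_gauss_le (n := n) hν
  choose D hD hdD using fun κ : Fin n → ℕ => exists_norm_dgauss_le hν κ
  set A : (Fin n → ℕ) → ℝ := fun κ => ((mlen κ + 1) * (1 + ‖ν‖) ^ mlen κ) ^ n * D κ with hA
  have hA0 : ∀ κ, 0 ≤ A κ := fun κ => by have := hD κ; positivity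
  set B := ∑ κ ∈ lowIdx n N, A κ
  have hB : 0 ≤ B := Finset.sum_nonneg fun κ _ => hA0 κ
  refine ⟨C₁ + (C₂ + B) * 2 ^ (N + 1), by positivity, fun σ z ξ hσ hσ' => ?_⟩
  set ρ := max √σ ‖z‖
  have hρ0 : 0 ≤ ρ := le_max_of_le_right (norm_nonneg _)
  have hσρ : σ ≤ ρ ^ 2 := by
    rw [← Real.sq_sqrt hσ]; gcongr; exact le_max_left _ _
  have hzρ : ‖z‖ ≤ ρ := le_max_right _ _
  set e₁ := Real.exp (-rate ν * ‖ξ‖ ^ 2)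
  set e₂ := Real.exp (-rate ν * ‖ξ - z‖ ^ 2)
  have he₁ : 0 < e₁ := Real.exp_pos _
  have he₂ : 0 < e₂ := Real.exp_pos _
  rcases le_total ρ (1 / 2) with hρ | hρ
  · have hm : modulus N ρ = ρ ^ (N + 1) := by
      rw [modulus, min_eq_right (by linarith), pow_succ]
    rw [hm]
    refine (h₁ ρ hρ0 hρ σ z ξ hσ hσρ hzρ).trans ?_
    have h3 : 0 ≤ (C₂ + B) * 2 ^ (N + 1) := by positivity
    calc C₁ * ρ ^ (N + 1) * e₁ ≤ (C₁ + (C₂ + B) * 2 ^ (N + 1)) * ρ ^ (N + 1) * (e₁ + e₂) := by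
          gcongr <;> linarith
      _ = _ := by ring
  -- Here min(1, ρ) ≥ 1/2, and every lower power of ρ is at most (2ρ)^N; together these cost
  -- 2^(N+1).
  · have hm : ρ ^ N / 2 ≤ modulus N ρ := by
      rw [modulus, div_eq_mul_inv]
      gcongr
      exact le_min (by norm_num) (by linarith)
    have h2ρ : 1 ≤ 2 * ρ := by linarith
    have hpow : ∀ k ≤ N, ρ ^ k ≤ 2 ^ N * ρ ^ N := by
      intro k hk
      rw [← mul_pow]
      calc ρ ^ k ≤ (2 * ρ) ^ k := by gcongr; linarith
        _ ≤ _ := pow_le_pow_right₀ h2ρ hk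
    have hm' : 2 ^ N * ρ ^ N ≤ 2 ^ (N + 1) * modulus N ρ := by
      rw [pow_succ]; nlinarith [pow_pos (two_pos : (0 : ℝ) < 2) N]
    have g1 : ‖gauss (((1 - σ : ℝ) : ℂ) * ν) (ξ - z)‖ ≤ C₂ * (2 ^ N * ρ ^ N) * e₂ := by
      refine (h₂ (1 - σ) (by linarith) (by linarith) (ξ - z)).trans ?_
      have := hpow 0 (Nat.zero_le _)
      rw [pow_zero] at this
      gcongr
      exact le_mul_of_one_le_right hC₂ this
    have g2 : ‖∑ κ ∈ lowIdx n N, heatCoeff ν κ σ z * dgauss ν κ ξ‖ ≤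
        B * (2 ^ N * ρ ^ N) * e₁ := by
      refine (norm_sum_le _ _).trans ?_
      rw [Finset.sum_mul, Finset.sum_mul]
      refine Finset.sum_le_sum fun κ hκ => ?_
      rw [norm_mul]
      have b1 := norm_heatCoeff_le ν κ hρ0 hσ hσρ hzρ
      have b2 := hdD κ ξ
      have b3 := hpow _ (mem_lowIdx.1 hκ)
      have := hD κ
      calc _ ≤ (((mlen κ + 1) * (1 + ‖ν‖) ^ mlen κ) ^ n * (2 ^ N * ρ ^ N)) * (D κ * e₁) := by
            gcongr
            exact b1.trans (by gcongr)
        _ = _ := by simp only [hA]; ring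
    rw [remKer]
    refine (norm_sub_le _ _).trans ?_
    have hmn : 0 ≤ modulus N ρ := le_trans (by positivity) hm
    calc _ ≤ C₂ * (2 ^ N * ρ ^ N) * e₂ + B * (2 ^ N * ρ ^ N) * e₁ := add_le_add g1 g2
      _ ≤ C₂ * (2 ^ N * ρ ^ N) * (e₁ + e₂) + B * (2 ^ N * ρ ^ N) * (e₁ + e₂) := by
          gcongr <;> linarith
      _ = (C₂ + B) * (2 ^ N * ρ ^ N) * (e₁ + e₂) := by ring
      _ ≤ (C₂ + B) * (2 ^ (N + 1) * modulus N ρ) * (e₁ + e₂) := by gcongr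
      _ = ((C₂ + B) * 2 ^ (N + 1)) * modulus N ρ * (e₁ + e₂) := by ring
      _ ≤ _ := by gcongr; linarith

/-! ### Scaling of the Gaussian and real Gaussian majorants. -/

theorem ofReal_mul_cpow {r : ℝ} (hr : 0 < r) (z w : ℂ) (hz : z ≠ 0) :
    ((r : ℂ) * z) ^ w = (r : ℂ) ^ w * z ^ w := by
  have hr' : (r : ℂ) ≠ 0 := by exact_mod_cast hr.ne'
  rw [Complex.cpow_def_of_ne_zero (mul_ne_zero hr' hz), Complex.cpow_def_of_ne_zero hr',
    Complex.cpow_def_of_ne_zero hz, Complex.log_ofReal_mul hr hz, ← Complex.exp_add,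
    Complex.ofReal_log hr.le]
  ring_nf

theorem rpow_neg_half_sq {t : ℝ} (ht : 0 < t) : (t ^ (-(1 : ℝ) / 2)) ^ 2 = t⁻¹ := by
  rw [← Real.rpow_natCast, ← Real.rpow_mul ht.le, ← Real.rpow_neg_one]
  norm_num

theorem rpow_neg_half_pow {t : ℝ} (ht : 0 < t) (k : ℕ) :
    (t ^ (-(1 : ℝ) / 2)) ^ k = t ^ (-(k : ℝ) / 2) := by
  rw [← Real.rpow_natCast, ← Real.rpow_mul ht.le]
  congr 1; ring

theorem gauss_scale {n : ℕ} {t : ℝ} (ht : 0 < t) {ν : ℂ} (hν : ν ≠ 0) (x : Rn n) :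
    gauss ((t : ℂ) * ν) x =
      ((t ^ (-(n : ℝ) / 2) : ℝ) : ℂ) * gauss ν (t ^ (-(1 : ℝ) / 2) • x) := by
  have hpi : (Real.pi : ℂ) ≠ 0 := by exact_mod_cast Real.pi_ne_zero
  have ht' : (t : ℂ) ≠ 0 := by exact_mod_cast ht.ne'
  have e1 : 4 * (Real.pi : ℂ) * ((t : ℂ) * ν) = (t : ℂ) * (4 * (Real.pi : ℂ) * ν) := by ring
  rw [gauss, gauss, e1, ofReal_mul_cpow ht _ _ (by simp [hpi, hν]), Complex.ofReal_cpow ht.le,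
    norm_smul, mul_pow, Real.norm_eq_abs, sq_abs, rpow_neg_half_sq ht]
  push_cast
  rw [mul_assoc]
  congr 3
  field_simp

theorem semigroup_apply {n : ℕ} (ν : ℂ) {t : ℝ} (ht : 0 < t) (φ : Rn n → ℂ) (x : Rn n) :
    semigroup ν t φ x = ∫ y, gauss ((t : ℂ) * ν) (x - y) * φ y := by
  rw [semigroup, if_pos ht, convolution_eq_swap]
  simp

/-- The Gaussian majorant at time `t`. -/
def heatMaj {n : ℕ} (c t : ℝ) (x : Rn n) : ℝ :=
  t ^ (-(n : ℝ) / 2) * Real.exp (-c * ‖t ^ (-(1 : ℝ) / 2) • x‖ ^ 2)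

theorem heatMaj_nonneg {n : ℕ} {c t : ℝ} (ht : 0 < t) (x : Rn n) : 0 ≤ heatMaj c t x := by
  unfold heatMaj; positivity

theorem measurable_heatMaj {n : ℕ} (c t : ℝ) :
    Measurable (heatMaj c t : Rn n → ℝ) := by
  unfold heatMaj; fun_prop

theorem heatMaj_le {n : ℕ} {c t : ℝ} (hc : 0 ≤ c) (ht : 0 < t) (x : Rn n) :
    heatMaj c t x ≤ t ^ (-(n : ℝ) / 2) := by
  unfold heatMaj
  apply mul_le_of_le_one_right (by positivity)
  apply Real.exp_le_one_iff.2
  nlinarith [sq_nonneg ‖t ^ (-(1 : ℝ) / 2) • x‖]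

theorem lintegral_heatMaj {n : ℕ} {c t : ℝ} (hc : 0 < c) (ht : 0 < t) :
    ∫⁻ x : Rn n, ENNReal.ofReal (heatMaj c t x) =
      ENNReal.ofReal ((Real.pi / c) ^ ((n : ℝ) / 2)) := by
  have hb : 0 < c * t⁻¹ := by positivity
  have he : ∀ x : Rn n, heatMaj c t x =
      t ^ (-(n : ℝ) / 2) * Real.exp (-(c * t⁻¹) * ‖x‖ ^ 2) := by
    intro x
    rw [heatMaj, norm_smul, mul_pow, Real.norm_eq_abs, sq_abs, rpow_neg_half_sq ht]
    congr 2; ring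
  have hI : Integrable (fun x : Rn n => Real.exp (-(c * t⁻¹) * ‖x‖ ^ 2)) := by
    apply Integrable.of_integral_ne_zero
    rw [GaussianFourier.integral_rexp_neg_mul_sq_norm hb]
    positivity
  rw [← ofReal_integral_eq_lintegral_ofReal]
  · congr 1
    rw [funext he, integral_const_mul, GaussianFourier.integral_rexp_neg_mul_sq_norm hb,
      finrank_euclideanSpace_fin]
    have : Real.pi / (c * t⁻¹) = t * (Real.pi / c) := by field_simp
    rw [this, Real.mul_rpow ht.le (by positivity), ← mul_assoc, ← Real.rpow_add ht]
    rw [show -(n : ℝ) / 2 + n / 2 = 0 by ring]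
    simp
  · rw [funext he]
    exact hI.const_mul _
  · exact Eventually.of_forall fun x => heatMaj_nonneg ht x

theorem exists_norm_gauss_le_heatMaj {n : ℕ} {ν : ℂ} (hν : 0 < ν.re) :
    ∃ C : ℝ, 0 ≤ C ∧ ∀ t : ℝ, 0 < t → ∀ x : Rn n,
      ‖gauss ((t : ℂ) * ν) x‖ ≤ C * heatMaj (rate ν) t x := by
  have hν0 : ν ≠ 0 := fun h => by simp [h] at hν
  obtain ⟨C, hC, h⟩ := exists_norm_gauss_le (n := n) hν
  refine ⟨C, hC, fun t ht x => ?_⟩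
  have := h 1 (by norm_num) le_rfl (t ^ (-(1 : ℝ) / 2) • x)
  rw [Complex.ofReal_one, one_mul] at this
  rw [gauss_scale ht hν0, norm_mul, Complex.norm_real, Real.norm_eq_abs,
    abs_of_nonneg (by positivity), heatMaj]
  calc _ ≤ t ^ (-(n : ℝ) / 2) *
        (C * Real.exp (-rate ν * ‖t ^ (-(1 : ℝ) / 2) • x‖ ^ 2)) := by gcongr
    _ = _ := by ring

/-- In the variable x/√t, half of the exponential absorbs the polynomial weight; the scaling leaves
t^(j/2). -/
theorem exists_heatMaj_moment {c : ℝ} (hc : 0 < c) (n j : ℕ) :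
    ∃ C : ℝ, 0 ≤ C ∧ ∀ t : ℝ, 0 < t →
      ∫⁻ x : Rn n, ENNReal.ofReal (‖x‖ ^ j * heatMaj c t x) ≤
        ENNReal.ofReal (C * t ^ ((j : ℝ) / 2)) := by
  obtain ⟨C, hC, h⟩ := one_add_abs_pow_le (c := c / 2) (by positivity) j
  refine ⟨C * (Real.pi / (c / 2)) ^ ((n : ℝ) / 2), by positivity, fun t ht => ?_⟩
  have hpt : ∀ x : Rn n, ‖x‖ ^ j * heatMaj c t x ≤
      C * t ^ ((j : ℝ) / 2) * heatMaj (c / 2) t x := by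
    intro x
    set r := ‖t ^ (-(1 : ℝ) / 2) • x‖ with hr
    have hx : ‖x‖ = t ^ ((1 : ℝ) / 2) * r := by
      rw [hr, norm_smul, Real.norm_eq_abs, abs_of_nonneg (by positivity), ← mul_assoc,
        ← Real.rpow_add ht]
      norm_num
    have hr0 : 0 ≤ r := norm_nonneg _
    have h1 := h r
    rw [abs_of_nonneg hr0] at h1
    have h2 : r ^ j ≤ C * Real.exp (c / 2 * r ^ 2) :=
      le_trans (by gcongr; linarith) h1
    have h3 : (t ^ ((1 : ℝ) / 2)) ^ j = t ^ ((j : ℝ) / 2) := by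
      rw [← Real.rpow_natCast, ← Real.rpow_mul ht.le]; congr 1; ring
    rw [hx, mul_pow, h3, heatMaj, heatMaj, ← hr]
    calc _ = t ^ ((j : ℝ) / 2) * t ^ (-(n : ℝ) / 2) * Real.exp (-c * r ^ 2) * r ^ j := by ring
      _ ≤ t ^ ((j : ℝ) / 2) * t ^ (-(n : ℝ) / 2) * Real.exp (-c * r ^ 2) *
          (C * Real.exp (c / 2 * r ^ 2)) := by gcongr
      _ = C * t ^ ((j : ℝ) / 2) * (t ^ (-(n : ℝ) / 2) *
          (Real.exp (-c * r ^ 2) * Real.exp (c / 2 * r ^ 2))) := by ring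
      _ = _ := by rw [← Real.exp_add]; congr 3; ring
  calc _ ≤ ∫⁻ x : Rn n, ENNReal.ofReal (C * t ^ ((j : ℝ) / 2)) *
        ENNReal.ofReal (heatMaj (c / 2) t x) := by
        refine lintegral_mono fun x => ?_
        rw [← ENNReal.ofReal_mul (by positivity)]
        exact ENNReal.ofReal_le_ofReal (hpt x)
    _ = _ := by
        rw [lintegral_const_mul _ (measurable_heatMaj _ _).ennreal_ofReal,
          lintegral_heatMaj (by positivity) ht, ← ENNReal.ofReal_mul (by positivity)]
        congr 1; ring

/-! ### Unweighted and weighted bounds for the semigroup. -/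

section Convolution

variable {n : ℕ}

theorem lintegral_lintegral_conv {H b : Rn n → ℝ≥0∞} (hH : Measurable H)
    (hb : AEMeasurable b) :
    ∫⁻ x, ∫⁻ y, b y * H (x - y) = (∫⁻ x, H x) * ∫⁻ y, b y := by
  rw [lintegral_lintegral_swap]
  · have : ∀ y, ∫⁻ x, b y * H (x - y) = b y * ∫⁻ x, H x := by
      intro y
      have hm : Measurable fun x => H (x - y) := hH.comp (measurable_id.sub_const y)
      rw [lintegral_const_mul _ hm, lintegral_sub_right_eq_self]
    simp only [this]
    rw [lintegral_mul_const'' _ hb, mul_comm]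
  · apply AEMeasurable.mul
    · exact hb.comp_quasiMeasurePreserving Measure.quasiMeasurePreserving_snd
    · exact (hH.comp (measurable_fst.sub measurable_snd)).aemeasurable

theorem lintegral_conv_le_of_le {H b : Rn n → ℝ≥0∞} {A : ℝ≥0∞} (hH : ∀ x, H x ≤ A) (x : Rn n)
    (hb : AEMeasurable b) :
    ∫⁻ y, b y * H (x - y) ≤ A * ∫⁻ y, b y := by
  rw [mul_comm, ← lintegral_mul_const'' _ hb]
  exact lintegral_mono fun y => mul_le_mul_right (hH _) _

end Convolution

variable {n : ℕ}

theorem continuous_gauss (ν : ℂ) : Continuous (gauss ν : Rn n → ℂ) := by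
  unfold gauss; fun_prop

theorem continuous_he (A : ℂ) (i : ℕ) : Continuous fun B => he A B i := by
  unfold he; fun_prop

theorem continuous_dgauss1 (ν : ℂ) (a : ℕ) : Continuous (dgauss1 ν a) := by
  have h := continuous_he (-1 / (4 * ν)) a
  unfold dgauss1 gauss1
  have : Continuous fun x : ℝ => he (-1 / (4 * ν)) (-(x : ℂ) / (2 * ν)) a :=
    h.comp (by fun_prop)
  fun_prop

theorem continuous_dgauss (ν : ℂ) (κ : Fin n → ℕ) : Continuous (dgauss ν κ) := by
  unfold dgauss
  exact continuous_finsetProd _ fun j _ => (continuous_dgauss1 ν _).comp (by fun_prop)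

theorem continuous_heatCoeff (ν : ℂ) (κ : Fin n → ℕ) (s : ℝ) :
    Continuous (heatCoeff ν κ s : Rn n → ℂ) := by
  unfold heatCoeff
  exact continuous_finsetProd _ fun j _ => (continuous_he _ _).comp (by fun_prop)

theorem exists_enorm_semigroup_le {ν : ℂ} (hν : 0 < ν.re) :
    ∃ C : ℝ, 0 ≤ C ∧ ∀ t : ℝ, 0 < t → ∀ (φ : Rn n → ℂ) (x : Rn n),
      ‖semigroup ν t φ x‖ₑ ≤
        ENNReal.ofReal C * ∫⁻ y, ‖φ y‖ₑ * ENNReal.ofReal (heatMaj (rate ν) t (x - y)) := by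
  obtain ⟨C, hC, h⟩ := exists_norm_gauss_le_heatMaj (n := n) hν
  refine ⟨C, hC, fun t ht φ x => ?_⟩
  rw [semigroup_apply ν ht]
  refine (enorm_integral_le_lintegral_enorm _).trans ?_
  rw [← lintegral_const_mul' _ _ ENNReal.ofReal_ne_top]
  refine lintegral_mono fun y => ?_
  simp only [enorm_mul]
  have h1 : ‖gauss ((t : ℂ) * ν) (x - y)‖ₑ ≤
      ENNReal.ofReal C * ENNReal.ofReal (heatMaj (rate ν) t (x - y)) := by
    rw [← ENNReal.ofReal_mul hC, ← ofReal_norm]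
    exact ENNReal.ofReal_le_ofReal (h t ht _)
  calc _ ≤ ENNReal.ofReal C * ENNReal.ofReal (heatMaj (rate ν) t (x - y)) * ‖φ y‖ₑ := by gcongr
    _ = _ := by ring

/-- Young's inequality, with a majorant of the kernel whose integral does not depend on t. -/
theorem exists_semigroup_bounds {ν : ℂ} (hν : 0 < ν.re) :
    ∃ C : ℝ, 0 ≤ C ∧ ∀ t : ℝ, 0 < t → ∀ φ : Rn n → ℂ, AEStronglyMeasurable φ volume →
      eLpNorm (semigroup ν t φ) 1 volume ≤ ENNReal.ofReal C * eLpNorm φ 1 volume ∧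
      eLpNorm (semigroup ν t φ) ∞ volume ≤ ENNReal.ofReal C * eLpNorm φ ∞ volume := by
  obtain ⟨C, hC, h⟩ := exists_enorm_semigroup_le (n := n) hν
  have hc := rate_pos hν
  refine ⟨C * (Real.pi / rate ν) ^ ((n : ℝ) / 2), by positivity, fun t ht φ hφ => ⟨?_, ?_⟩⟩
  · rw [eLpNorm_one_eq_lintegral_enorm, eLpNorm_one_eq_lintegral_enorm]
    refine (lintegral_mono fun x => h t ht φ x).trans ?_
    rw [lintegral_const_mul' _ _ ENNReal.ofReal_ne_top,
      lintegral_lintegral_conv (measurable_heatMaj _ _).ennreal_ofReal hφ.enorm,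
      lintegral_heatMaj hc ht, ENNReal.ofReal_mul hC, mul_assoc]
  · rw [eLpNorm_exponent_top, eLpNorm_exponent_top]
    refine eLpNormEssSup_le_of_ae_enorm_bound (Eventually.of_forall fun x => (h t ht φ x).trans ?_)
    rw [ENNReal.ofReal_mul hC, mul_assoc]
    gcongr
    calc _ ≤ ∫⁻ y, eLpNormEssSup φ volume * ENNReal.ofReal (heatMaj (rate ν) t (x - y)) := by
          refine lintegral_mono_ae ?_
          filter_upwards [enorm_ae_le_eLpNormEssSup φ volume] with y hy
          gcongr
      _ = _ := by
          rw [lintegral_const_mul, lintegral_sub_left_eq_self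
            (fun y => ENNReal.ofReal (heatMaj (rate ν) t y)), lintegral_heatMaj hc ht, mul_comm]
          exact ((measurable_heatMaj (rate ν) t).comp (measurable_const.sub measurable_id)).ennreal_ofReal

/-- Truncating the weight preserves its quasi-triangle inequality, with a constant that does not
depend on R. Truncated weights give finite quantities, as Gronwall's argument requires, and R can be
removed at the end. -/
theorem min_pow_le (j : ℕ) {a b d R : ℝ} (ha : 0 ≤ a) (hb : 0 ≤ b) (hd : 0 ≤ d) (hR : 0 ≤ R)
    (h : d ≤ a + b) : (min d R) ^ j ≤ 2 ^ j * (a ^ j + (min b R) ^ j) := by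
  have h1 : min d R ≤ 2 * max a (min b R) := by
    rcases le_total b R with hbR | hbR
    · rw [min_eq_left hbR]
      have := le_max_left a b
      have := le_max_right a b
      exact (min_le_left _ _).trans (by linarith)
    · rw [min_eq_right hbR]
      have := le_max_right a R
      exact (min_le_right _ _).trans (by linarith)
  have h2 : (max a (min b R)) ^ j ≤ a ^ j + (min b R) ^ j := by
    have : 0 ≤ min b R := le_min hb hR
    rcases max_choice a (min b R) with h | h <;> rw [h] <;>
      [linarith [pow_nonneg this j]; linarith [pow_nonneg ha j]]
  calc (min d R) ^ j ≤ (2 * max a (min b R)) ^ j := pow_le_pow_left₀ (le_min hd hR) h1 j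
    _ = 2 ^ j * (max a (min b R)) ^ j := mul_pow _ _ _
    _ ≤ _ := by gcongr

/-- The truncated weight `min(|x|, R)^j`. -/
def truncWeight (j : ℕ) (R : ℝ) (x : Rn n) : ℝ≥0∞ := ENNReal.ofReal ((min ‖x‖ R) ^ j)

theorem measurable_truncWeight (j : ℕ) (R : ℝ) :
    Measurable (truncWeight j R : Rn n → ℝ≥0∞) := by
  unfold truncWeight; fun_prop

/-- The weight at x is split between x - y and y. The first part falls on the kernel and costs
t^(j/2); the second stays on φ. The constant is uniform in R. -/
theorem exists_semigroup_weighted {ν : ℂ} (hν : 0 < ν.re) (j : ℕ) :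
    ∃ C : ℝ, 0 ≤ C ∧ ∀ t : ℝ, 0 < t → ∀ R : ℝ, 0 ≤ R → ∀ φ : Rn n → ℂ,
      AEStronglyMeasurable φ volume →
      ∫⁻ x, truncWeight j R x * ‖semigroup ν t φ x‖ₑ ≤
        ENNReal.ofReal C * (ENNReal.ofReal (t ^ ((j : ℝ) / 2)) * (∫⁻ x, ‖φ x‖ₑ) +
          ∫⁻ x, truncWeight j R x * ‖φ x‖ₑ) := by
  obtain ⟨C, hC, h⟩ := exists_enorm_semigroup_le (n := n) hν
  have hc := rate_pos hν
  obtain ⟨D, hD, hm⟩ := exists_heatMaj_moment hc n j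
  set D' := (Real.pi / rate ν) ^ ((n : ℝ) / 2)
  have hD' : 0 ≤ D' := by positivity
  refine ⟨C * 2 ^ j * (D + D'), by positivity, fun t ht R hR φ hφ => ?_⟩
  set H : Rn n → ℝ≥0∞ := fun x => ENNReal.ofReal (heatMaj (rate ν) t x)
  set H' : Rn n → ℝ≥0∞ := fun x => ENNReal.ofReal (‖x‖ ^ j * heatMaj (rate ν) t x)
  have hH : Measurable H := (measurable_heatMaj _ _).ennreal_ofReal
  have hH' : Measurable H' :=
    ((measurable_norm.pow_const j).mul (measurable_heatMaj _ _)).ennreal_ofReal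
  have hpt : ∀ x, truncWeight j R x * ‖semigroup ν t φ x‖ₑ ≤ ENNReal.ofReal (C * 2 ^ j) *
      ((∫⁻ y, ‖φ y‖ₑ * H' (x - y)) + ∫⁻ y, (truncWeight j R y * ‖φ y‖ₑ) * H (x - y)) := by
    intro x
    calc _ ≤ truncWeight j R x * (ENNReal.ofReal C * ∫⁻ y, ‖φ y‖ₑ * H (x - y)) := by
          gcongr; exact h t ht φ x
      _ = ENNReal.ofReal C * ∫⁻ y, truncWeight j R x * (‖φ y‖ₑ * H (x - y)) := by
          rw [lintegral_const_mul' (truncWeight j R x) _ ENNReal.ofReal_ne_top]; ring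
      _ ≤ ENNReal.ofReal C * ∫⁻ y, ENNReal.ofReal (2 ^ j) * (‖φ y‖ₑ * H' (x - y) +
            (truncWeight j R y * ‖φ y‖ₑ) * H (x - y)) := by
          refine mul_le_mul_right (lintegral_mono fun y => ?_) _
          have h1 : truncWeight j R x ≤ ENNReal.ofReal (2 ^ j) *
              (ENNReal.ofReal (‖x - y‖ ^ j) + truncWeight j R y) := by
            have := min_pow_le j (norm_nonneg (x - y)) (norm_nonneg y) (norm_nonneg x) hR
              (by simpa using norm_add_le (x - y) y)
            unfold truncWeight
            rw [← ENNReal.ofReal_add (by positivity)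
              (pow_nonneg (le_min (norm_nonneg _) hR) _), ← ENNReal.ofReal_mul (by positivity)]
            exact ENNReal.ofReal_le_ofReal this
          calc _ ≤ ENNReal.ofReal (2 ^ j) *
              (ENNReal.ofReal (‖x - y‖ ^ j) + truncWeight j R y) * (‖φ y‖ₑ * H (x - y)) := by
                gcongr
            _ = _ := by
                have : H' (x - y) = ENNReal.ofReal (‖x - y‖ ^ j) * H (x - y) :=
                  ENNReal.ofReal_mul (by positivity)
                rw [this]; ring
      _ = _ := by
          rw [lintegral_const_mul' _ _ ENNReal.ofReal_ne_top, ← mul_assoc,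
            ← ENNReal.ofReal_mul hC, lintegral_add_left']
          exact hφ.enorm.mul (hH'.comp (measurable_const.sub measurable_id)).aemeasurable
  refine (lintegral_mono hpt).trans ?_
  rw [lintegral_const_mul' _ _ ENNReal.ofReal_ne_top]
  have hwφ : AEMeasurable (fun y => truncWeight j R y * ‖φ y‖ₑ) :=
    (measurable_truncWeight j R).aemeasurable.mul hφ.enorm
  rw [lintegral_add_left', lintegral_lintegral_conv hH' hφ.enorm,
    lintegral_lintegral_conv hH hwφ, lintegral_heatMaj hc ht,
    ENNReal.ofReal_mul (p := C * 2 ^ j) (q := D + D') (by positivity), mul_assoc]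
  · gcongr
    calc _ ≤ ENNReal.ofReal (D * t ^ ((j : ℝ) / 2)) * (∫⁻ x, ‖φ x‖ₑ) +
          ENNReal.ofReal D' * ∫⁻ x, truncWeight j R x * ‖φ x‖ₑ := by gcongr; exact hm t ht
      _ ≤ ENNReal.ofReal (D + D') * (ENNReal.ofReal (t ^ ((j : ℝ) / 2)) * (∫⁻ x, ‖φ x‖ₑ) +
          ∫⁻ x, truncWeight j R x * ‖φ x‖ₑ) := by
          rw [ENNReal.ofReal_mul hD, ENNReal.ofReal_add hD hD', mul_add, mul_assoc]
          gcongr <;> simp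
  · have : AEMeasurable (Function.uncurry fun x y : Rn n => ‖φ y‖ₑ * H' (x - y))
        (volume.prod volume) := by
      have h1 : AEMeasurable (fun p : Rn n × Rn n => ‖φ p.2‖ₑ) (volume.prod volume) :=
        hφ.enorm.comp_quasiMeasurePreserving Measure.quasiMeasurePreserving_snd
      exact h1.mul (hH'.comp (measurable_fst.sub measurable_snd)).aemeasurable
    exact this.lintegral_prod_right'

/-! ### The error of the expansion of the semigroup. -/

/-- The coefficient `∫ q_κ(s, y) φ(y) dy`. -/
def momentAt (ν : ℂ) (κ : Fin n → ℕ) (s : ℝ) (φ : Rn n → ℂ) : ℂ :=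
  ∫ y, heatCoeff ν κ s y * φ y

/-- The rescaled derivative `t^(-|κ|/2) δ_t ∂^κ G_ν`. -/
def profTerm (ν : ℂ) (κ : Fin n → ℕ) (t : ℝ) (x : Rn n) : ℂ :=
  ((t ^ (-(mlen κ : ℝ) / 2) : ℝ) : ℂ) * dilation t (dgauss ν κ) x

/-- The error in the expansion of `e^{(t-s)νΔ} φ` at time `t`. -/
def expErr (ν : ℂ) (N : ℕ) (t s : ℝ) (φ : Rn n → ℂ) (x : Rn n) : ℂ :=
  semigroup ν (t - s) φ x - ∑ κ ∈ lowIdx n N, momentAt ν κ s φ * profTerm ν κ t x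

/-- The weight `r^N min(1, t^(-1/2) r)`. -/
def tmod (N : ℕ) (t r : ℝ) : ℝ := r ^ N * min 1 (t ^ (-(1 : ℝ) / 2) * r)

theorem tmod_nonneg {N : ℕ} {t r : ℝ} (ht : 0 < t) (hr : 0 ≤ r) : 0 ≤ tmod N t r := by
  unfold tmod
  have : 0 ≤ t ^ (-(1 : ℝ) / 2) * r := by positivity
  exact mul_nonneg (by positivity) (le_min zero_le_one this)

theorem measurable_tmod (N : ℕ) (t : ℝ) : Measurable (tmod N t) := by
  unfold tmod; fun_prop

/-- The weighted mass controlling the expansion error. -/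
def errMass (N : ℕ) (t s : ℝ) (φ : Rn n → ℂ) : ℝ≥0∞ :=
  ENNReal.ofReal (tmod N t √s) * (∫⁻ y, ‖φ y‖ₑ) + ∫⁻ y, ENNReal.ofReal (tmod N t ‖y‖) * ‖φ y‖ₑ

theorem heatCoeff_scale (ν : ℂ) (κ : Fin n → ℕ) {t : ℝ} (ht : 0 < t) (s : ℝ) (y : Rn n) :
    heatCoeff ν κ (s / t) (t ^ (-(1 : ℝ) / 2) • y) =
      ((t ^ (-(mlen κ : ℝ) / 2) : ℝ) : ℂ) * heatCoeff ν κ s y := by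
  have h2 : ((t ^ (-(1 : ℝ) / 2) : ℝ) : ℂ) ^ 2 = (t : ℂ)⁻¹ := by
    rw [← Complex.ofReal_pow, rpow_neg_half_sq ht]; push_cast; rfl
  rw [heatCoeff, heatCoeff, ← rpow_neg_half_pow ht, mlen, ← Finset.prod_pow_eq_pow_sum]
  push_cast
  rw [← Finset.prod_mul_distrib]
  refine Finset.prod_congr rfl fun j _ => ?_
  rw [← he_homog, h2]
  congr 1
  · ring
  · simp

theorem integrable_mul_of_moment {N : ℕ} {φ g : Rn n → ℂ} (hφ : Integrable φ)
    (hφN : ∫⁻ y, ENNReal.ofReal (‖y‖ ^ N) * ‖φ y‖ₑ ≠ ∞) (hg : AEStronglyMeasurable g volume)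
    {C : ℝ} (hC : 0 ≤ C) (hgC : ∀ y, ‖g y‖ ≤ C * (1 + ‖y‖ ^ N)) :
    Integrable (fun y => g y * φ y) := by
  refine ⟨hg.mul hφ.1, ?_⟩
  rw [HasFiniteIntegral]
  have h1 : ∀ y, ‖g y * φ y‖ₑ ≤ ENNReal.ofReal C * (‖φ y‖ₑ + ENNReal.ofReal (‖y‖ ^ N) * ‖φ y‖ₑ) := by
    intro y
    rw [enorm_mul]
    have : ‖g y‖ₑ ≤ ENNReal.ofReal C * (1 + ENNReal.ofReal (‖y‖ ^ N)) := by
      rw [← ofReal_norm, ← ENNReal.ofReal_one, ← ENNReal.ofReal_add zero_le_one (by positivity),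
        ← ENNReal.ofReal_mul hC]
      exact ENNReal.ofReal_le_ofReal (hgC y)
    calc _ ≤ ENNReal.ofReal C * (1 + ENNReal.ofReal (‖y‖ ^ N)) * ‖φ y‖ₑ := by gcongr
      _ = _ := by ring
  refine (lintegral_mono h1).trans_lt ?_
  rw [lintegral_const_mul' _ _ ENNReal.ofReal_ne_top, lintegral_add_left' hφ.1.enorm]
  exact ENNReal.mul_lt_top ENNReal.ofReal_lt_top
    (ENNReal.add_lt_top.2 ⟨hφ.2, lt_top_iff_ne_top.2 hφN⟩)

theorem pow_le_one_add_pow {r : ℝ} (hr : 0 ≤ r) {k N : ℕ} (h : k ≤ N) : r ^ k ≤ 1 + r ^ N := by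
  rcases le_total r 1 with h1 | h1
  · have := pow_le_one₀ hr h1 (n := k)
    have := pow_nonneg hr N
    linarith
  · have := pow_le_pow_right₀ h1 h
    linarith

theorem max_pow_le {a b : ℝ} (ha : 0 ≤ a) (hb : 0 ≤ b) (k : ℕ) : max a b ^ k ≤ a ^ k + b ^ k := by
  rcases max_choice a b with h | h <;> rw [h] <;>
    [linarith [pow_nonneg hb k]; linarith [pow_nonneg ha k]]

theorem integrable_heatCoeff_mul (ν : ℂ) {N : ℕ} {κ : Fin n → ℕ} (hκ : mlen κ ≤ N) {s : ℝ}
    (hs : 0 ≤ s) {φ : Rn n → ℂ} (hφ : Integrable φ)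
    (hφN : ∫⁻ y, ENNReal.ofReal (‖y‖ ^ N) * ‖φ y‖ₑ ≠ ∞) :
    Integrable (fun y => heatCoeff ν κ s y * φ y) := by
  refine integrable_mul_of_moment hφ hφN (continuous_heatCoeff ν κ s).aestronglyMeasurable
    (C := ((mlen κ + 1) * (1 + ‖ν‖) ^ mlen κ) ^ n * (√s ^ mlen κ + 1)) (by positivity) fun y => ?_
  have h1 := norm_heatCoeff_le ν κ (ρ := max √s ‖y‖) (le_max_of_le_right (norm_nonneg _)) hs
    (by
      calc s = √s ^ 2 := (Real.sq_sqrt hs).symm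
        _ ≤ _ := by gcongr; exact le_max_left _ _) (le_max_right √s ‖y‖)
  refine h1.trans ?_
  rw [mul_assoc]
  gcongr
  refine (max_pow_le (Real.sqrt_nonneg s) (norm_nonneg y) _).trans ?_
  have h2 := pow_le_one_add_pow (norm_nonneg y) hκ
  have h3 : 0 ≤ √s ^ mlen κ := by positivity
  have h4 : 0 ≤ ‖y‖ ^ N := by positivity
  nlinarith

/-- Rescaling by √t turns G_{(t-s)ν}(x-y) into the Gaussian at time 1 - s/t, and the homogeneity of
the coefficients makes the expansion terms match. The error is thus an integral of `remKer` with σ =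
s/t and z = y/√t. -/
theorem expErr_eq_integral {ν : ℂ} (hν : 0 < ν.re) {N : ℕ} {t s : ℝ} (hs : 0 ≤ s) (hst : s < t)
    {φ : Rn n → ℂ} (hφ : Integrable φ)
    (hφN : ∫⁻ y, ENNReal.ofReal (‖y‖ ^ N) * ‖φ y‖ₑ ≠ ∞) (x : Rn n) :
    expErr ν N t s φ x = ∫ y, ((t ^ (-(n : ℝ) / 2) : ℝ) : ℂ) *
      remKer ν N (s / t) (t ^ (-(1 : ℝ) / 2) • y) (t ^ (-(1 : ℝ) / 2) • x) * φ y := by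
  have hν0 : ν ≠ 0 := fun h => by simp [h] at hν
  have ht : 0 < t := by linarith
  have hts : 0 < t - s := by linarith
  have hg : ∀ y, gauss (((t - s : ℝ) : ℂ) * ν) (x - y) = ((t ^ (-(n : ℝ) / 2) : ℝ) : ℂ) *
      gauss (((1 - s / t : ℝ) : ℂ) * ν) (t ^ (-(1 : ℝ) / 2) • x - t ^ (-(1 : ℝ) / 2) • y) := by
    intro y
    have e : ((t - s : ℝ) : ℂ) * ν = (t : ℂ) * (((1 - s / t : ℝ) : ℂ) * ν) := by
      have : (t : ℂ) ≠ 0 := by exact_mod_cast ht.ne'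
      push_cast; field_simp
    have h1 : 0 < 1 - s / t := by rw [sub_pos, div_lt_one ht]; exact hst
    rw [e, gauss_scale ht (mul_ne_zero (by exact_mod_cast h1.ne') hν0), smul_sub]
  have hI1 : Integrable (fun y => gauss (((t - s : ℝ) : ℂ) * ν) (x - y) * φ y) := by
    obtain ⟨C, hC, h⟩ := exists_norm_gauss_le_heatMaj (n := n) hν
    refine hφ.bdd_mul (c := C * (t - s) ^ (-(n : ℝ) / 2))
      ((continuous_gauss _).comp (by fun_prop)).aestronglyMeasurable
      (Eventually.of_forall fun y => ?_)
    refine (h _ hts _).trans ?_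
    gcongr
    exact heatMaj_le (rate_pos hν).le hts _
  have hI2 : ∀ κ ∈ lowIdx n N, Integrable (fun y => heatCoeff ν κ s y * φ y) := fun κ hκ =>
    integrable_heatCoeff_mul ν (mem_lowIdx.1 hκ) hs hφ hφN
  rw [expErr, semigroup_apply ν hts]
  simp only [momentAt]
  simp_rw [← integral_mul_const]
  rw [← integral_finsetSum _ fun κ hκ => (hI2 κ hκ).mul_const _, ← integral_sub hI1
    (integrable_finsetSum _ fun κ hκ => (hI2 κ hκ).mul_const _)]
  refine integral_congr_ae (Eventually.of_forall fun y => ?_)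
  simp only [remKer]
  rw [hg y, mul_sub, sub_mul, Finset.mul_sum, Finset.sum_mul]
  congr 1
  refine Finset.sum_congr rfl fun κ _ => ?_
  rw [heatCoeff_scale ν κ ht, profTerm, dilation]
  ring

theorem modulus_max_le (N : ℕ) {a b : ℝ} (ha : 0 ≤ a) (hb : 0 ≤ b) :
    modulus N (max a b) ≤ modulus N a + modulus N b := by
  have h : ∀ r : ℝ, 0 ≤ r → 0 ≤ modulus N r := fun r hr =>
    mul_nonneg (by positivity) (le_min zero_le_one hr)
  rcases max_choice a b with hm | hm <;> rw [hm] <;> [linarith [h b hb]; linarith [h a ha]]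

theorem modulus_scale (N : ℕ) {t : ℝ} (ht : 0 < t) (r : ℝ) :
    modulus N (t ^ (-(1 : ℝ) / 2) * r) = t ^ (-(N : ℝ) / 2) * tmod N t r := by
  rw [modulus, tmod, mul_pow, rpow_neg_half_pow ht]; ring

/-- The condition s ≤ t/2 gives σ ≤ 1/2 in the kernel bound. The weight max(√(s/t), |y|/√t)
separates into the two parts of `errMass`. -/
theorem exists_expErr_bounds {ν : ℂ} (hν : 0 < ν.re) (N : ℕ) :
    ∃ C : ℝ, 0 ≤ C ∧ ∀ t s : ℝ, 0 < t → 0 ≤ s → s ≤ t / 2 → ∀ φ : Rn n → ℂ, Integrable φ →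
      ∫⁻ y, ENNReal.ofReal (‖y‖ ^ N) * ‖φ y‖ₑ ≠ ∞ →
      eLpNorm (expErr ν N t s φ) 1 volume ≤
        ENNReal.ofReal (C * t ^ (-(N : ℝ) / 2)) * errMass N t s φ ∧
      eLpNorm (expErr ν N t s φ) ∞ volume ≤
        ENNReal.ofReal (C * t ^ (-(N : ℝ) / 2) * t ^ (-(n : ℝ) / 2)) * errMass N t s φ := by
  obtain ⟨C, hC, h⟩ := exists_norm_remKer_le (n := n) hν N
  have hc := rate_pos hν
  set D := (Real.pi / rate ν) ^ ((n : ℝ) / 2)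
  have hD : 0 ≤ D := by positivity
  refine ⟨2 * C * (1 + D), by positivity, fun t s ht hs hst φ hφ hφN => ?_⟩
  set H : Rn n → ℝ≥0∞ := fun x => ENNReal.ofReal (heatMaj (rate ν) t x)
  have hH : Measurable H := (measurable_heatMaj _ _).ennreal_ofReal
  set b : Rn n → ℝ≥0∞ := fun y =>
    ENNReal.ofReal (C * t ^ (-(N : ℝ) / 2)) *
      (ENNReal.ofReal (tmod N t √s) * ‖φ y‖ₑ + ENNReal.ofReal (tmod N t ‖y‖) * ‖φ y‖ₑ)
  have hb1 : AEMeasurable (fun y => ENNReal.ofReal (tmod N t √s) * ‖φ y‖ₑ) :=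
    hφ.1.enorm.const_mul _
  have hb : AEMeasurable b := by
    refine (hb1.add (AEMeasurable.mul ?_ hφ.1.enorm)).const_mul _
    exact ((measurable_tmod N t).comp measurable_norm).ennreal_ofReal.aemeasurable
  have hbint : ∫⁻ y, b y = ENNReal.ofReal (C * t ^ (-(N : ℝ) / 2)) * errMass N t s φ := by
    simp only [b]
    rw [lintegral_const_mul' _ _ ENNReal.ofReal_ne_top, lintegral_add_left' hb1,
      lintegral_const_mul' _ _ ENNReal.ofReal_ne_top, errMass]
  -- The unshifted Gaussian factors out of the y-integral; the shifted one gives a convolution.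
  have hpt : ∀ x, ‖expErr ν N t s φ x‖ₑ ≤ H x * (∫⁻ y, b y) + ∫⁻ y, b y * H (x - y) := by
    intro x
    rw [expErr_eq_integral hν hs (by linarith) hφ hφN]
    refine (enorm_integral_le_lintegral_enorm _).trans ?_
    rw [← lintegral_const_mul'' _ hb, ← lintegral_add_left' (hb.const_mul _)]
    refine lintegral_mono fun y => ?_
    rw [enorm_mul]
    have hb' : b y = ENNReal.ofReal (C * t ^ (-(N : ℝ) / 2) * (tmod N t √s + tmod N t ‖y‖)) *
        ‖φ y‖ₑ := by
      rw [ENNReal.ofReal_mul (by positivity), ENNReal.ofReal_add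
        (tmod_nonneg ht (Real.sqrt_nonneg _)) (tmod_nonneg ht (norm_nonneg _))]
      simp only [b]; ring
    have htm : 0 ≤ tmod N t √s + tmod N t ‖y‖ :=
      add_nonneg (tmod_nonneg ht (Real.sqrt_nonneg _)) (tmod_nonneg ht (norm_nonneg _))
    have hk : ‖((t ^ (-(n : ℝ) / 2) : ℝ) : ℂ) *
        remKer ν N (s / t) (t ^ (-(1 : ℝ) / 2) • y) (t ^ (-(1 : ℝ) / 2) • x)‖ₑ ≤
        ENNReal.ofReal (C * t ^ (-(N : ℝ) / 2) * (tmod N t √s + tmod N t ‖y‖)) *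
          (H x + H (x - y)) := by
      rw [← ENNReal.ofReal_add (heatMaj_nonneg ht _) (heatMaj_nonneg ht _),
        ← ENNReal.ofReal_mul (by positivity), ← ofReal_norm]
      apply ENNReal.ofReal_le_ofReal
      rw [norm_mul, Complex.norm_real, Real.norm_eq_abs, abs_of_nonneg (by positivity)]
      have h1 := h (s / t) (t ^ (-(1 : ℝ) / 2) • y) (t ^ (-(1 : ℝ) / 2) • x) (by positivity)
        (by rw [div_le_iff₀ ht]; linarith)
      have e1 : √(s / t) = t ^ (-(1 : ℝ) / 2) * √s := by
        rw [Real.sqrt_div' _ ht.le, Real.sqrt_eq_rpow t, div_eq_inv_mul, ← Real.rpow_neg ht.le]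
        norm_num
      have e2 : ‖t ^ (-(1 : ℝ) / 2) • y‖ = t ^ (-(1 : ℝ) / 2) * ‖y‖ := by
        rw [norm_smul, Real.norm_eq_abs, abs_of_nonneg (by positivity)]
      have h2 : modulus N (max √(s / t) ‖t ^ (-(1 : ℝ) / 2) • y‖) ≤
          t ^ (-(N : ℝ) / 2) * (tmod N t √s + tmod N t ‖y‖) := by
        refine (modulus_max_le N (Real.sqrt_nonneg _) (norm_nonneg _)).trans ?_
        rw [e1, e2, modulus_scale N ht, modulus_scale N ht, mul_add]
      rw [← smul_sub] at h1
      unfold heatMaj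
      calc _ ≤ t ^ (-(n : ℝ) / 2) * (C * (t ^ (-(N : ℝ) / 2) * (tmod N t √s + tmod N t ‖y‖)) *
            (Real.exp (-rate ν * ‖t ^ (-(1 : ℝ) / 2) • x‖ ^ 2) +
              Real.exp (-rate ν * ‖t ^ (-(1 : ℝ) / 2) • (x - y)‖ ^ 2))) := by
            gcongr
            exact h1.trans (by gcongr)
        _ = _ := by ring
    calc _ ≤ ENNReal.ofReal (C * t ^ (-(N : ℝ) / 2) * (tmod N t √s + tmod N t ‖y‖)) *
          (H x + H (x - y)) * ‖φ y‖ₑ := by gcongr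
      _ = _ := by rw [hb']; ring
  constructor
  · rw [eLpNorm_one_eq_lintegral_enorm]
    refine (lintegral_mono hpt).trans ?_
    rw [lintegral_add_left (hH.mul_const _), lintegral_mul_const _ hH,
      lintegral_lintegral_conv hH hb, lintegral_heatMaj hc ht, hbint, ← mul_assoc,
      ← ENNReal.ofReal_mul hD, ← add_mul, ← ENNReal.ofReal_add (by positivity) (by positivity)]
    gcongr
    have : 0 ≤ C * t ^ (-(N : ℝ) / 2) := by positivity
    nlinarith
  · rw [eLpNorm_exponent_top]
    refine eLpNormEssSup_le_of_ae_enorm_bound (Eventually.of_forall fun x => (hpt x).trans ?_)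
    have hHle : ∀ x, H x ≤ ENNReal.ofReal (t ^ (-(n : ℝ) / 2)) := fun x =>
      ENNReal.ofReal_le_ofReal (heatMaj_le hc.le ht x)
    have h2 := lintegral_conv_le_of_le hHle x hb
    calc _ ≤ ENNReal.ofReal (t ^ (-(n : ℝ) / 2)) * (∫⁻ y, b y) +
          ENNReal.ofReal (t ^ (-(n : ℝ) / 2)) * ∫⁻ y, b y := by gcongr; exact hHle x
      _ = ENNReal.ofReal (2 * (t ^ (-(n : ℝ) / 2) * (C * t ^ (-(N : ℝ) / 2)))) *
          errMass N t s φ := by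
          rw [hbint, ← two_mul, ← mul_assoc (ENNReal.ofReal (t ^ (-(n : ℝ) / 2))),
            ← ENNReal.ofReal_mul (by positivity), ENNReal.ofReal_mul two_pos.le,
            ENNReal.ofReal_ofNat, mul_assoc]
      _ ≤ _ := by
          refine mul_le_mul_left (ENNReal.ofReal_le_ofReal ?_) _
          have : 0 ≤ C * t ^ (-(N : ℝ) / 2) * t ^ (-(n : ℝ) / 2) := by positivity
          nlinarith

/-! ### Weighted norms and pairings of Bochner integrals. -/

/-- The weighted `L¹` norm. -/
def wnorm (k : Rn n → ℝ≥0∞) (φ : Rn n → ℂ) : ℝ≥0∞ := ∫⁻ y, k y * ‖φ y‖ₑ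

theorem wnorm_congr {k : Rn n → ℝ≥0∞} {φ ψ : Rn n → ℂ} (h : φ =ᵐ[volume] ψ) :
    wnorm k φ = wnorm k ψ := by
  refine lintegral_congr_ae ?_
  filter_upwards [h] with y hy
  rw [hy]

theorem wnorm_mono {k l : Rn n → ℝ≥0∞} (h : ∀ y, k y ≤ l y) (φ : Rn n → ℂ) :
    wnorm k φ ≤ wnorm l φ :=
  lintegral_mono fun y => mul_le_mul_left (h y) _

/-- Multiplication by a bounded function on `L¹`. -/
def mulL1 {b : Rn n → ℂ} (hb : MemLp b ∞ volume) : L1 n →L[ℂ] L1 n :=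
  (ContinuousLinearMap.mul ℂ ℂ).holderL volume ∞ 1 1 (hb.toLp b)

theorem coeFn_mulL1 {b : Rn n → ℂ} (hb : MemLp b ∞ volume) (φ : L1 n) :
    mulL1 hb φ =ᵐ[volume] fun y => b y * φ y := by
  have h := (ContinuousLinearMap.mul ℂ ℂ).coeFn_holder (r := 1) (hb.toLp b) φ
  filter_upwards [h, hb.coeFn_toLp] with y h1 h2
  rw [← h2]
  exact h1

theorem enorm_L1 (φ : L1 n) : ‖φ‖ₑ = ∫⁻ y, ‖φ y‖ₑ := by
  rw [Lp.enorm_def, eLpNorm_one_eq_lintegral_enorm]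

theorem enorm_mulL1 {b : Rn n → ℂ} (hb : MemLp b ∞ volume) (φ : L1 n) :
    ‖mulL1 hb φ‖ₑ = wnorm (fun y => ‖b y‖ₑ) φ := by
  rw [enorm_L1]
  refine lintegral_congr_ae ?_
  filter_upwards [coeFn_mulL1 hb φ] with y hy
  rw [hy, enorm_mul]

theorem memLp_top_truncate {k : Rn n → ℝ≥0∞} (hk : Measurable k) (N : ℕ) :
    MemLp (fun y => ((min (k y) N).toReal : ℂ)) ∞ volume := by
  refine memLp_top_of_bound (C := N) ?_ (Eventually.of_forall fun y => ?_)
  · exact (Complex.measurable_ofReal.comp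
      (hk.min measurable_const).ennreal_toReal).aestronglyMeasurable
  · rw [Complex.norm_real, Real.norm_eq_abs, abs_of_nonneg ENNReal.toReal_nonneg]
    have := ENNReal.toReal_mono (ENNReal.natCast_ne_top N) (min_le_right (k y) N)
    simpa using this

theorem wnorm_truncate {k : Rn n → ℝ≥0∞} (hk : Measurable k) (N : ℕ) (φ : L1 n) :
    wnorm (fun y => min (k y) N) φ = ‖mulL1 (memLp_top_truncate hk N) φ‖ₑ := by
  rw [enorm_mulL1]
  congr 1
  funext y
  have hne : min (k y) (N : ℝ≥0∞) ≠ ∞ := ne_top_of_le_ne_top (ENNReal.natCast_ne_top N)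
    (min_le_right _ _)
  rw [← ofReal_norm, Complex.norm_real, Real.norm_eq_abs, abs_of_nonneg ENNReal.toReal_nonneg,
    ENNReal.ofReal_toReal hne]

/-- A truncated weight acts as a bounded operator on L¹, which commutes with Bochner integrals;
monotone convergence recovers an unbounded weight. Measurability and Minkowski's inequality follow
from this. -/
theorem wnorm_eq_iSup {k : Rn n → ℝ≥0∞} (hk : Measurable k) (φ : L1 n) :
    wnorm k φ = ⨆ N : ℕ, wnorm (fun y => min (k y) N) φ := by
  have hφ : Measurable fun y => ‖φ y‖ₑ := (Lp.stronglyMeasurable φ).measurable.enorm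
  unfold wnorm
  rw [← lintegral_iSup]
  · refine lintegral_congr fun y => ?_
    rw [← ENNReal.iSup_mul]
    congr 1
    have := inf_iSup_eq (k y) (fun N : ℕ => (N : ℝ≥0∞))
    rw [ENNReal.iSup_natCast, inf_top_eq] at this
    exact this
  · intro N
    exact (hk.min measurable_const).mul hφ
  · intro N M h y
    dsimp only
    gcongr

section Integral

variable {S : Type*} [MeasurableSpace S] {μ : Measure S}

theorem aemeasurable_wnorm {k : Rn n → ℝ≥0∞} (hk : Measurable k) {Φ : S → L1 n}
    (hΦ : AEStronglyMeasurable Φ μ) : AEMeasurable (fun s => wnorm k (Φ s)) μ := by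
  simp only [wnorm_eq_iSup hk, wnorm_truncate hk]
  exact AEMeasurable.iSup fun N =>
    ((mulL1 (memLp_top_truncate hk N)).continuous.comp_aestronglyMeasurable hΦ).enorm

/-- Minkowski's inequality in weighted `L¹`. -/
theorem wnorm_integral_le {k : Rn n → ℝ≥0∞} (hk : Measurable k) {Φ : S → L1 n}
    (hΦ : Integrable Φ μ) :
    wnorm k (∫ s, Φ s ∂μ : L1 n) ≤ ∫⁻ s, wnorm k (Φ s) ∂μ := by
  rw [wnorm_eq_iSup hk]
  refine iSup_le fun N => ?_
  rw [wnorm_truncate hk, ← ContinuousLinearMap.integral_comp_comm _ hΦ]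
  refine (enorm_integral_le_lintegral_enorm _).trans (lintegral_mono fun s => ?_)
  rw [← wnorm_truncate hk]
  exact wnorm_mono (fun y => min_le_left _ _) _

/-- Minkowski's inequality in `L^∞`. -/
theorem eLpNorm_top_integral_le {Φ : S → L1 n} (hΦ : Integrable Φ μ) :
    eLpNorm (∫ s, Φ s ∂μ : L1 n) ∞ volume ≤ ∫⁻ s, eLpNorm (Φ s) ∞ volume ∂μ := by
  rw [eLpNorm_exponent_top]
  refine eLpNormEssSup_le_of_ae_enorm_bound ?_
  set g : L1 n := ∫ s, Φ s ∂μ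
  have hg : Measurable fun y => ‖g y‖ₑ := (Lp.stronglyMeasurable g).measurable.enorm
  -- An essential supremum is tested on sets of finite measure; on each, the indicator is a weight
  -- and the weighted L¹ inequality applies.
  refine ae_le_of_forall_setLIntegral_le_of_sigmaFinite hg
    (g := fun _ => ∫⁻ s, eLpNorm (Φ s) ∞ volume ∂μ) fun A hA hAfin => ?_
  have hw : ∀ φ : L1 n, wnorm (A.indicator 1) φ = ∫⁻ y in A, ‖φ y‖ₑ := by
    intro φ
    rw [wnorm, ← lintegral_indicator hA]
    refine lintegral_congr fun y => ?_
    by_cases hy : y ∈ A <;> simp [hy]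
  rw [← hw, setLIntegral_const]
  refine (wnorm_integral_le (measurable_one.indicator hA) hΦ).trans ?_
  rw [← lintegral_mul_const' _ _ hAfin.ne]
  refine lintegral_mono fun s => ?_
  rw [hw, ← setLIntegral_const]
  refine lintegral_mono_ae ?_
  rw [eLpNorm_exponent_top]
  exact ae_restrict_of_ae (enorm_ae_le_eLpNormEssSup (Φ s) volume)

theorem eLpNorm_one_integral_le (Φ : S → L1 n) :
    eLpNorm (∫ s, Φ s ∂μ : L1 n) 1 volume ≤ ∫⁻ s, eLpNorm (Φ s) 1 volume ∂μ := by
  simp only [← Lp.enorm_def]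
  exact enorm_integral_le_lintegral_enorm _

theorem integrable_mul_of_wnorm {b : Rn n → ℂ} (hb : Measurable b) (φ : L1 n)
    (h : wnorm (fun y => ‖b y‖ₑ) φ ≠ ∞) : Integrable (fun y => b y * φ y) := by
  refine ⟨hb.aestronglyMeasurable.mul (Lp.aestronglyMeasurable φ), ?_⟩
  rw [HasFiniteIntegral]
  simp only [enorm_mul]
  exact lt_top_iff_ne_top.2 h

/-- Pairing with an unbounded b is not continuous on L¹, so b is cut off where |b| > N. Dominated
convergence, in y and in the parameter, removes the cutoff; it is needed for the moments of the ψ_k.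
-/
theorem integrable_pairing {b : Rn n → ℂ} (hb : Measurable b) {Φ : S → L1 n}
    (hΦ : Integrable Φ μ) (h : ∫⁻ s, wnorm (fun y => ‖b y‖ₑ) (Φ s) ∂μ ≠ ∞) :
    Integrable (fun s => ∫ y, b y * Φ s y) μ ∧
      ∫ y, b y * (∫ s, Φ s ∂μ : L1 n) y = ∫ s, (∫ y, b y * Φ s y) ∂μ := by
  have hk : Measurable fun y => ‖b y‖ₑ := hb.enorm
  have hwm := aemeasurable_wnorm hk hΦ.1
  set g : L1 n := ∫ s, Φ s ∂μ with hg
  have hgw : wnorm (fun y => ‖b y‖ₑ) g ≠ ∞ :=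
    ne_top_of_le_ne_top h (wnorm_integral_le hk hΦ)
  set bN : ℕ → Rn n → ℂ := fun N => {y | ‖b y‖ ≤ N}.indicator b with hbN
  have hset : ∀ N : ℕ, MeasurableSet {y | ‖b y‖ ≤ (N : ℝ)} := fun N =>
    measurableSet_le hb.norm measurable_const
  have hle : ∀ N y, ‖bN N y‖ ≤ ‖b y‖ := fun N y => norm_indicator_le_norm_self _ _
  have hmem : ∀ N, MemLp (bN N) ∞ volume := fun N => by
    refine memLp_top_of_bound (C := N) (hb.indicator (hset N)).aestronglyMeasurable
      (Eventually.of_forall fun y => ?_)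
    by_cases hy : ‖b y‖ ≤ (N : ℝ)
    · rw [hbN]; simp only; rw [indicator_of_mem (by exact hy)]; exact hy
    · rw [hbN]; simp only; rw [indicator_of_notMem (by exact hy)]; simp
  have hlim : ∀ y, Tendsto (fun N => bN N y) atTop (𝓝 (b y)) := by
    intro y
    obtain ⟨N₀, hN₀⟩ := exists_nat_ge ‖b y‖
    refine tendsto_const_nhds.congr' ?_
    filter_upwards [eventually_ge_atTop N₀] with N hN
    have : ‖b y‖ ≤ (N : ℝ) := hN₀.trans (by exact_mod_cast hN)
    rw [hbN]; simp only; rw [indicator_of_mem (by exact this)]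
  have hdct : ∀ φ : L1 n, wnorm (fun y => ‖b y‖ₑ) φ ≠ ∞ →
      Tendsto (fun N => ∫ y, bN N y * φ y) atTop (𝓝 (∫ y, b y * φ y)) := by
    intro φ hφ
    refine tendsto_integral_of_dominated_convergence (fun y => ‖b y * φ y‖)
      (fun N => (hb.indicator (hset N)).aestronglyMeasurable.mul (Lp.aestronglyMeasurable φ))
      (integrable_mul_of_wnorm hb φ hφ).norm
      (fun N => Eventually.of_forall fun y => ?_)
      (Eventually.of_forall fun y => (hlim y).mul_const _)
    rw [norm_mul, norm_mul]
    gcongr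
    exact hle N y
  have hfun : ∀ N (φ : L1 n), ∫ y, bN N y * φ y = L1.integralCLM (mulL1 (hmem N) φ) := by
    intro N φ
    rw [← L1.integral_eq, L1.integral_eq_integral]
    exact integral_congr_ae (coeFn_mulL1 (hmem N) φ).symm
  have hmeasN : ∀ N, AEStronglyMeasurable (fun s => ∫ y, bN N y * Φ s y) μ := by
    intro N
    simp only [hfun]
    exact (L1.integralCLM.continuous.comp (mulL1 (hmem N)).continuous).comp_aestronglyMeasurable
      hΦ.1
  have hfin : ∀ᵐ s ∂μ, wnorm (fun y => ‖b y‖ₑ) (Φ s) < ∞ := ae_lt_top' hwm h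
  have hconv : ∀ᵐ s ∂μ, Tendsto (fun N => ∫ y, bN N y * Φ s y) atTop
      (𝓝 (∫ y, b y * Φ s y)) := by
    filter_upwards [hfin] with s hs using hdct _ hs.ne
  have hbound : ∀ N, ∀ᵐ s ∂μ, ‖∫ y, bN N y * Φ s y‖ ≤
      (wnorm (fun y => ‖b y‖ₑ) (Φ s)).toReal := by
    intro N
    filter_upwards [hfin] with s hs
    have h1 : ‖∫ y, bN N y * Φ s y‖ₑ ≤ wnorm (fun y => ‖b y‖ₑ) (Φ s) := by
      refine (enorm_integral_le_lintegral_enorm _).trans (lintegral_mono fun y => ?_)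
      rw [enorm_mul]
      gcongr
      exact enorm_le_iff_norm_le.2 (hle N y)
    rw [← toReal_enorm]
    exact ENNReal.toReal_mono hs.ne h1
  have hwint : Integrable (fun s => (wnorm (fun y => ‖b y‖ₑ) (Φ s)).toReal) μ :=
    integrable_toReal_of_lintegral_ne_top hwm h
  have hlimint := tendsto_integral_of_dominated_convergence _ hmeasN hwint hbound hconv
  constructor
  · refine hwint.mono' (aestronglyMeasurable_of_tendsto_ae atTop hmeasN hconv) ?_
    filter_upwards [hconv, ae_all_iff.2 hbound] with s h1 h2
    exact le_of_tendsto h1.norm (Eventually.of_forall h2)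
  · refine tendsto_nhds_unique (hdct g hgw) ?_
    -- With b cut off, the pairing is a continuous linear functional and passes through the
    -- integral.
    have e : ∀ N, ∫ y, bN N y * g y = ∫ s, (∫ y, bN N y * Φ s y) ∂μ := by
      intro N
      simp only [hfun]
      have h1 := ((L1.integralCLM (E := ℂ) (μ := (volume : Measure (Rn n)))).comp
        ((mulL1 (hmem N)).restrictScalars ℝ)).integral_comp_comm hΦ
      exact h1.symm
    simp only [e]
    exact hlimint

end Integral

/-- A Gronwall inequality with an integrable kernel, for bounded functions. -/
theorem gronwall_lintegral {C θ : ℝ} (hC : 0 < C) (hθ : 1 < θ) :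
    ∃ D : ℝ, 0 ≤ D ∧ ∀ (T : ℝ) (w : ℝ → ℝ≥0∞) (A B : ℝ≥0∞), B ≠ ∞ →
      (∀ t, 0 < t → t ≤ T → w t ≤ B) →
      (∀ t, 0 < t → t ≤ T →
        w t ≤ A + ∫⁻ s in Ioo 0 t, ENNReal.ofReal (C * (1 + s) ^ (-θ)) * w s) →
      ∀ t, 0 < t → t ≤ T → w t ≤ ENNReal.ofReal D * A := by
  -- The primitive of (1+s)^(-θ) vanishing at 0; it is bounded by 1/(θ-1), which makes D independent
  -- of T.
  set P : ℝ → ℝ := fun s => (1 - (1 + s) ^ (1 - θ)) / (θ - 1) with hP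
  have hθ1 : 0 < θ - 1 := by linarith
  have hP0 : ∀ s, 0 ≤ s → 0 ≤ P s := fun s hs => by
    apply div_nonneg _ hθ1.le
    have := Real.rpow_le_one_of_one_le_of_nonpos (by linarith : 1 ≤ 1 + s)
      (by linarith : 1 - θ ≤ 0)
    linarith
  have hP1 : ∀ s, 0 ≤ s → P s ≤ 1 / (θ - 1) := fun s hs => by
    apply div_le_div_of_nonneg_right _ hθ1.le
    have : 0 ≤ (1 + s) ^ (1 - θ) := by positivity
    linarith
  have hPd : ∀ s, 0 ≤ s → HasDerivAt P ((1 + s) ^ (-θ)) s := by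
    intro s hs
    have h1 : HasDerivAt (fun s : ℝ => (1 + s) ^ (1 - θ)) ((1 - θ) * (1 + s) ^ (1 - θ - 1) * 1) s := by
      have hb : HasDerivAt (fun s : ℝ => 1 + s) 1 s := (hasDerivAt_id s).const_add 1
      exact (Real.hasDerivAt_rpow_const (Or.inl (by positivity))).comp s hb
    refine ((h1.const_sub 1).div_const (θ - 1)).congr_deriv ?_
    rw [show 1 - θ - 1 = -θ by ring]
    field_simp
    ring
  -- The factor 2 in the exponent gives E' = 2C(1+s)^(-θ) E, so the kernel integrated against E is
  -- at most E/2. For the supremum S of w/E this yields S ≤ A + S/2.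
  set E : ℝ → ℝ := fun s => Real.exp (2 * C * P s) with hE
  have hEd : ∀ s, 0 ≤ s → HasDerivAt E (2 * (C * (1 + s) ^ (-θ) * E s)) s := by
    intro s hs
    refine (((hPd s hs).const_mul (2 * C)).exp).congr_deriv ?_
    simp only [hE]; ring
  have hEpos : ∀ s, 0 < E s := fun s => Real.exp_pos _
  have hE1 : ∀ s, 0 ≤ s → 1 ≤ E s := fun s hs =>
    Real.one_le_exp (mul_nonneg (by positivity) (hP0 s hs))
  have hint : ∀ t, 0 < t → ∫⁻ s in Ioo 0 t, ENNReal.ofReal (C * (1 + s) ^ (-θ) * E s) ≤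
      ENNReal.ofReal (E t / 2) := by
    intro t ht
    have hcont : ContinuousOn (fun s => C * (1 + s) ^ (-θ) * E s) (Icc 0 t) := by
      intro s hs
      have h1 : ContinuousAt (fun s : ℝ => (1 + s) ^ (-θ)) s :=
        ContinuousAt.rpow_const (by fun_prop) (Or.inl (by linarith [hs.1]))
      exact ((continuousAt_const.mul h1).mul (hEd s hs.1).continuousAt).continuousWithinAt
    have hii : IntervalIntegrable (fun s => 2 * (C * (1 + s) ^ (-θ) * E s)) volume 0 t := by
      apply ContinuousOn.intervalIntegrable
      rw [uIcc_of_le ht.le]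
      exact continuousOn_const.mul hcont
    have h1 := intervalIntegral.integral_eq_sub_of_hasDerivAt (a := 0) (b := t)
      (f := E) (fun s hs => hEd s (by rw [uIcc_of_le ht.le] at hs; exact hs.1)) hii
    rw [intervalIntegral.integral_const_mul, intervalIntegral.integral_of_le ht.le,
      integral_Ioc_eq_integral_Ioo] at h1
    rw [← ofReal_integral_eq_lintegral_ofReal]
    · apply ENNReal.ofReal_le_ofReal
      have := hEpos 0
      linarith
    · exact (hcont.integrableOn_Icc).mono_set Ioo_subset_Icc_self
    · refine (ae_restrict_iff' measurableSet_Ioo).2 (Eventually.of_forall fun s hs => ?_)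
      have := hEpos s
      have : 0 ≤ 1 + s := by linarith [hs.1]
      simp only [Pi.zero_apply]
      positivity
  refine ⟨2 * Real.exp (2 * C * (1 / (θ - 1))), by positivity, ?_⟩
  intro T w A B hB hwB hw
  set S : ℝ≥0∞ := ⨆ t ∈ Ioc (0 : ℝ) T, ENNReal.ofReal (E t)⁻¹ * w t with hS
  have hle : ∀ t, 0 < t → t ≤ T → ENNReal.ofReal (E t)⁻¹ * w t ≤ S := fun t h0 h1 =>
    le_iSup₂ (f := fun t (_ : t ∈ Ioc (0 : ℝ) T) => ENNReal.ofReal (E t)⁻¹ * w t) t ⟨h0, h1⟩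
  have hcancel : ∀ t, ENNReal.ofReal (E t) * ENNReal.ofReal (E t)⁻¹ = 1 := fun t => by
    rw [← ENNReal.ofReal_mul (hEpos t).le, mul_inv_cancel₀ (hEpos t).ne', ENNReal.ofReal_one]
  have hwS : ∀ t, 0 < t → t ≤ T → w t ≤ ENNReal.ofReal (E t) * S := fun t h0 h1 => by
    calc w t = ENNReal.ofReal (E t) * (ENNReal.ofReal (E t)⁻¹ * w t) := by
          rw [← mul_assoc, hcancel, one_mul]
      _ ≤ _ := by gcongr; exact hle t h0 h1
  have hinv : ∀ t, 0 < t → ENNReal.ofReal (E t)⁻¹ ≤ 1 := fun t ht => by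
    rw [← ENNReal.ofReal_one]
    exact ENNReal.ofReal_le_ofReal (inv_le_one_of_one_le₀ (hE1 t ht.le))
  have hSB : S ≤ B := iSup₂_le fun t ht => by
    calc _ ≤ 1 * B := by gcongr; exacts [hinv t ht.1, hwB t ht.1 ht.2]
      _ = B := one_mul B
  -- The a priori bound B serves only here, to allow S/2 to be subtracted; it does not enter D.
  have hSfin : S ≠ ∞ := ne_top_of_le_ne_top hB hSB
  have hSA : S ≤ A + S / 2 := by
    refine iSup₂_le fun t ht => ?_
    have h1 : ∫⁻ s in Ioo 0 t, ENNReal.ofReal (C * (1 + s) ^ (-θ)) * w s ≤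
        ENNReal.ofReal (E t / 2) * S := by
      calc _ ≤ ∫⁻ s in Ioo 0 t, ENNReal.ofReal (C * (1 + s) ^ (-θ) * E s) * S := by
            refine setLIntegral_mono' measurableSet_Ioo fun s hs => ?_
            have h0 : 0 ≤ 1 + s := by linarith [hs.1]
            rw [ENNReal.ofReal_mul (p := C * (1 + s) ^ (-θ)) (q := E s) (by positivity), mul_assoc]
            gcongr
            exact hwS s hs.1 (hs.2.le.trans ht.2)
        _ = (∫⁻ s in Ioo 0 t, ENNReal.ofReal (C * (1 + s) ^ (-θ) * E s)) * S :=
            lintegral_mul_const' _ _ hSfin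
        _ ≤ _ := by gcongr; exact hint t ht.1
    calc _ ≤ ENNReal.ofReal (E t)⁻¹ * (A + ENNReal.ofReal (E t / 2) * S) := by
          gcongr; exact (hw t ht.1 ht.2).trans (by gcongr)
      _ = ENNReal.ofReal (E t)⁻¹ * A +
          (ENNReal.ofReal (E t)⁻¹ * ENNReal.ofReal (E t / 2)) * S := by ring
      _ ≤ 1 * A + S / 2 := by
          gcongr
          · exact hinv t ht.1
          · rw [← ENNReal.ofReal_mul (inv_nonneg.2 (hEpos t).le)]
            have : (E t)⁻¹ * (E t / 2) = 1 / 2 := by have := (hEpos t).ne'; field_simp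
            rw [this, ENNReal.ofReal_div_of_pos two_pos, ENNReal.ofReal_one, ENNReal.ofReal_ofNat,
              ENNReal.div_eq_inv_mul (a := S), one_div]
      _ = _ := by rw [one_mul]
  have hS2 : S ≤ 2 * A := by
    have h2 : S / 2 + S / 2 ≤ A + S / 2 := by rwa [ENNReal.add_halves]
    have h3 : S / 2 ≤ A := (ENNReal.add_le_add_iff_right
      (ENNReal.div_ne_top hSfin two_ne_zero)).1 h2
    calc S = S / 2 + S / 2 := (ENNReal.add_halves S).symm
      _ ≤ A + A := add_le_add h3 h3
      _ = 2 * A := (two_mul A).symm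
  intro t h0 h1
  calc w t ≤ ENNReal.ofReal (E t) * S := hwS t h0 h1
    _ ≤ ENNReal.ofReal (Real.exp (2 * C * (1 / (θ - 1)))) * (2 * A) := by
        gcongr
        exact Real.exp_le_exp.2 (mul_le_mul_of_nonneg_left (hP1 t h0.le) (by positivity))
    _ = _ := by
        rw [ENNReal.ofReal_mul two_pos.le, ENNReal.ofReal_ofNat]; ring

/-! ### The nonlinearity along a decaying solution. -/

section Nonlinearity

variable {p K : ℝ} {f : ℂ → ℂ}

theorem norm_nonlinearity_le (hp : 1 < p) (hf0 : f 0 = 0)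
    (hf : ∀ ξ η : ℂ, ‖f ξ - f η‖ ≤ K * (‖ξ‖ ^ (p - 1) + ‖η‖ ^ (p - 1)) * ‖ξ - η‖) (ξ : ℂ) :
    ‖f ξ‖ ≤ K * ‖ξ‖ ^ (p - 1) * ‖ξ‖ := by
  have := hf ξ 0
  simpa [hf0, Real.zero_rpow (by linarith : p - 1 ≠ 0)] using this

theorem continuous_nonlinearity (hp : 1 < p)
    (hf : ∀ ξ η : ℂ, ‖f ξ - f η‖ ≤ K * (‖ξ‖ ^ (p - 1) + ‖η‖ ^ (p - 1)) * ‖ξ - η‖) :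
    Continuous f := by
  rw [continuous_iff_continuousAt]
  intro η
  rw [ContinuousAt, tendsto_iff_norm_sub_tendsto_zero]
  have hpow : Continuous fun ξ : ℂ => ‖ξ‖ ^ (p - 1) :=
    continuous_norm.rpow_const fun _ => Or.inr (by linarith)
  have h : Tendsto (fun ξ : ℂ => K * (‖ξ‖ ^ (p - 1) + ‖η‖ ^ (p - 1)) * ‖ξ - η‖) (𝓝 η) (𝓝 0) := by
    have : Continuous fun ξ : ℂ => K * (‖ξ‖ ^ (p - 1) + ‖η‖ ^ (p - 1)) * ‖ξ - η‖ := by fun_prop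
    simpa using this.tendsto η
  exact squeeze_zero (fun _ => norm_nonneg _) (fun ξ => hf ξ η) h

end Nonlinearity

theorem memLp_one_L1 (φ : L1 n) : MemLp φ 1 (volume : Measure (Rn n)) := Lp.memLp φ

theorem coeFn_toL1 {g : Rn n → ℂ} (hg : MemLp g 1 volume) : toL1 g =ᵐ[volume] g := by
  rw [toL1, dif_pos hg]
  exact hg.coeFn_toLp

/-- A function of time in `L¹ ∩ L^∞` with the decay of the free solution. -/
structure FreeDecay (u : ℝ → L1 n) (A : ℝ) : Prop where
  nonneg : 0 ≤ A
  cont : ContinuousOn u (Ici 0)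
  one : ∀ s, 0 < s → ∫⁻ y, ‖u s y‖ₑ ≤ ENNReal.ofReal A
  top : ∀ s, 0 < s → ∀ᵐ y, ‖u s y‖ ≤ A * (1 + s) ^ (-(n : ℝ) / 2)

/-- The uniform L^∞ bound is used for s ≤ 1 and the free decay for s ≥ 1, which gives one bound in 1
+ s without a singularity at 0. -/
theorem exists_freeDecay {u : ℝ → L1 n} (hu : MemX u) (hd : HasFreeDecay u) :
    ∃ A, FreeDecay u A := by
  obtain ⟨hcont, ⟨C₁, hC₁⟩, v, huv, -, C₂, hC₂⟩ := hu
  rw [HasFreeDecay] at hd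
  set D := (⨆ q ∈ Ici (1 : ℝ≥0∞), ⨆ t ∈ Ioi (0 : ℝ),
    ENNReal.ofReal (t ^ decayExp n q) * eLpNorm (u t) q volume) with hD
  have hD' : ∀ t, 0 < t → ENNReal.ofReal (t ^ ((n : ℝ) / 2)) * eLpNorm (u t) ∞ volume ≤ D := by
    intro t ht
    have h1 : ENNReal.ofReal (t ^ decayExp n ∞) * eLpNorm (u t) ∞ volume ≤ D :=
      le_trans (le_iSup₂ (f := fun t (_ : t ∈ Ioi (0 : ℝ)) =>
        ENNReal.ofReal (t ^ decayExp n ∞) * eLpNorm (u t) ∞ volume) t ht)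
        (le_iSup₂ (f := fun q (_ : q ∈ Ici (1 : ℝ≥0∞)) => ⨆ t ∈ Ioi (0 : ℝ),
          ENNReal.ofReal (t ^ decayExp n q) * eLpNorm (u t) q volume) ∞ (by simp))
    simpa [decayExp] using h1
  set C₃ := D.toReal
  -- The factor 2^(n/2) comes from 1 + s ≤ 2 for s ≤ 1 and 1 + s ≤ 2s for s ≥ 1.
  set A := |C₁| + 2 ^ ((n : ℝ) / 2) * (|C₂| + C₃) with hA
  have hC₃ : 0 ≤ C₃ := ENNReal.toReal_nonneg
  have h2n : (1 : ℝ) ≤ 2 ^ ((n : ℝ) / 2) := Real.one_le_rpow (by norm_num) (by positivity)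
  have hpos : 0 ≤ 2 ^ ((n : ℝ) / 2) * (|C₂| + C₃) := by positivity
  refine ⟨A, by positivity, hcont, fun s hs => ?_, fun s hs => ?_⟩
  · rw [← enorm_L1, ← ofReal_norm]
    apply ENNReal.ofReal_le_ofReal
    have := hC₁ s hs.le
    have := le_abs_self C₁
    linarith
  · rcases le_total s 1 with h1 | h1
    · have hv : ∀ᵐ y, ‖v s y‖ ≤ ‖v s‖ := by
        have := enorm_ae_le_eLpNormEssSup (v s) (volume : Measure (Rn n))
        filter_upwards [this] with y hy
        rw [Lp.norm_def, eLpNorm_exponent_top, ← toReal_enorm]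
        refine ENNReal.toReal_mono ?_ hy
        rw [← eLpNorm_exponent_top]
        exact Lp.eLpNorm_ne_top (v s)
      have e : (u s : Rn n → ℂ) = v s := by rw [huv s hs]
      rw [e]
      filter_upwards [hv] with y hy
      have h2 := hC₂ s hs
      have h3 : 2 ^ (-(n : ℝ) / 2) ≤ (1 + s) ^ (-(n : ℝ) / 2) := by
        apply Real.rpow_le_rpow_of_nonpos (by linarith) (by linarith)
        rw [neg_div, neg_nonpos]; positivity
      calc ‖v s y‖ ≤ |C₂| := hy.trans (h2.trans (le_abs_self _))
        _ = 2 ^ ((n : ℝ) / 2) * |C₂| * 2 ^ (-(n : ℝ) / 2) := by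
            rw [mul_right_comm, ← Real.rpow_add two_pos]; simp [neg_div]
        _ ≤ A * 2 ^ (-(n : ℝ) / 2) := by
            gcongr
            have : 0 ≤ 2 ^ ((n : ℝ) / 2) * C₃ := by positivity
            have := abs_nonneg C₁
            rw [hA]; linarith
        _ ≤ _ := by gcongr
    · have hE := hD' s hs
      have hbd : eLpNorm (u s) ∞ volume ≤ ENNReal.ofReal (s ^ (-(n : ℝ) / 2) * C₃) := by
        rw [ENNReal.ofReal_mul (by positivity), ENNReal.ofReal_toReal hd.ne]
        calc _ = ENNReal.ofReal (s ^ (-(n : ℝ) / 2)) *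
              (ENNReal.ofReal (s ^ ((n : ℝ) / 2)) * eLpNorm (u s) ∞ volume) := by
              rw [← mul_assoc, ← ENNReal.ofReal_mul (by positivity), ← Real.rpow_add hs]
              simp [neg_div]
          _ ≤ _ := by gcongr
      have := enorm_ae_le_eLpNormEssSup (u s) (volume : Measure (Rn n))
      filter_upwards [this] with y hy
      rw [← eLpNorm_exponent_top] at hy
      have h2 := hy.trans hbd
      rw [← ofReal_norm, ENNReal.ofReal_le_ofReal_iff (by positivity)] at h2
      refine h2.trans ?_
      have h3 : s ^ (-(n : ℝ) / 2) ≤ 2 ^ ((n : ℝ) / 2) * (1 + s) ^ (-(n : ℝ) / 2) := by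
        have e1 : s ^ (-(n : ℝ) / 2) = 2 ^ ((n : ℝ) / 2) * (2 * s) ^ (-(n : ℝ) / 2) := by
          rw [Real.mul_rpow two_pos.le hs.le, ← mul_assoc, ← Real.rpow_add two_pos]
          simp [neg_div]
        rw [e1]
        refine mul_le_mul_of_nonneg_left ?_ (by positivity)
        apply Real.rpow_le_rpow_of_nonpos (by linarith) (by linarith)
        rw [neg_div, neg_nonpos]; positivity
      calc _ ≤ 2 ^ ((n : ℝ) / 2) * (1 + s) ^ (-(n : ℝ) / 2) * C₃ := by gcongr
        _ = 2 ^ ((n : ℝ) / 2) * C₃ * (1 + s) ^ (-(n : ℝ) / 2) := by ring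
        _ ≤ _ := by
            gcongr
            have : 0 ≤ 2 ^ ((n : ℝ) / 2) * |C₂| := by positivity
            have := abs_nonneg C₁
            rw [hA]; linarith

theorem wnorm_add_le {k : Rn n → ℝ≥0∞} (hk : Measurable k) (φ ψ : L1 n) :
    wnorm k (φ + ψ : L1 n) ≤ wnorm k φ + wnorm k ψ := by
  rw [wnorm_congr (Lp.coeFn_add φ ψ), wnorm, wnorm, wnorm,
    ← lintegral_add_left (f := fun y => k y * ‖φ y‖ₑ)
      (hk.mul (Lp.stronglyMeasurable φ).measurable.enorm)]
  refine lintegral_mono fun y => ?_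
  rw [← mul_add]
  gcongr
  exact enorm_add_le _ _

/-- The hypotheses on the nonlinearity. -/
structure PowerNonlinearity (p K : ℝ) (f : ℂ → ℂ) : Prop where
  one_lt : 1 < p
  pos : 0 < K
  zero : f 0 = 0
  diff : ∀ ξ η : ℂ, ‖f ξ - f η‖ ≤ K * (‖ξ‖ ^ (p - 1) + ‖η‖ ^ (p - 1)) * ‖ξ - η‖

section Source

variable {p K A : ℝ} {f : ℂ → ℂ} {u : ℝ → L1 n}

theorem FreeDecay.rpow_le (hu : FreeDecay u A) (hf : PowerNonlinearity p K f) {s : ℝ}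
    (hs : 0 < s) :
    ∀ᵐ y, ‖u s y‖ ^ (p - 1) ≤ A ^ (p - 1) * (1 + s) ^ (-((n : ℝ) / 2 * (p - 1))) := by
  filter_upwards [hu.top s hs] with y hy
  have hp := hf.one_lt
  have hA := hu.nonneg
  calc _ ≤ (A * (1 + s) ^ (-(n : ℝ) / 2)) ^ (p - 1) :=
        Real.rpow_le_rpow (norm_nonneg _) hy (by linarith)
    _ = _ := by
        rw [Real.mul_rpow hA (by positivity), ← Real.rpow_mul (by positivity)]
        congr 2; ring

theorem FreeDecay.norm_comp_le (hu : FreeDecay u A) (hf : PowerNonlinearity p K f) {s : ℝ}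
    (hs : 0 < s) :
    ∀ᵐ y, ‖f (u s y)‖ ≤
      K * A ^ (p - 1) * (1 + s) ^ (-((n : ℝ) / 2 * (p - 1))) * ‖u s y‖ := by
  filter_upwards [hu.rpow_le hf hs] with y hy
  have hK := hf.pos
  refine (norm_nonlinearity_le hf.one_lt hf.zero hf.diff _).trans ?_
  calc _ ≤ K * (A ^ (p - 1) * (1 + s) ^ (-((n : ℝ) / 2 * (p - 1)))) * ‖u s y‖ := by gcongr
    _ = _ := by ring

theorem FreeDecay.memLp_comp (hu : FreeDecay u A) (hf : PowerNonlinearity p K f) {s : ℝ}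
    (hs : 0 < s) : MemLp (fun y => f (u s y)) 1 volume := by
  refine (memLp_one_L1 (u s)).of_le_mul
    ((continuous_nonlinearity hf.one_lt hf.diff).comp_aestronglyMeasurable
      (Lp.aestronglyMeasurable (u s))) (hu.norm_comp_le hf hs)

theorem FreeDecay.coeFn_nonlin (hu : FreeDecay u A) (hf : PowerNonlinearity p K f) {s : ℝ}
    (hs : 0 < s) : nonlin f u s =ᵐ[volume] fun y => f (u s y) :=
  coeFn_toL1 (hu.memLp_comp hf hs)

theorem FreeDecay.wnorm_nonlin_le (hu : FreeDecay u A) (hf : PowerNonlinearity p K f) {s : ℝ}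
    (hs : 0 < s) (k : Rn n → ℝ≥0∞) :
    wnorm k (nonlin f u s) ≤
      ENNReal.ofReal (K * A ^ (p - 1) * (1 + s) ^ (-((n : ℝ) / 2 * (p - 1)))) *
        wnorm k (u s) := by
  have hA := hu.nonneg
  have hK := hf.pos
  rw [wnorm_congr (hu.coeFn_nonlin hf hs), wnorm, wnorm,
    ← lintegral_const_mul' _ _ ENNReal.ofReal_ne_top]
  refine lintegral_mono_ae ?_
  filter_upwards [hu.norm_comp_le hf hs] with y hy
  have h1 : ‖f (u s y)‖ₑ ≤
      ENNReal.ofReal (K * A ^ (p - 1) * (1 + s) ^ (-((n : ℝ) / 2 * (p - 1)))) * ‖u s y‖ₑ := by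
    rw [← ofReal_norm, ← ofReal_norm, ← ENNReal.ofReal_mul (by positivity)]
    exact ENNReal.ofReal_le_ofReal hy
  calc _ ≤ k y * (ENNReal.ofReal (K * A ^ (p - 1) * (1 + s) ^ (-((n : ℝ) / 2 * (p - 1)))) *
        ‖u s y‖ₑ) := by gcongr
    _ = _ := by ring

theorem FreeDecay.lintegral_nonlin_le (hu : FreeDecay u A) (hf : PowerNonlinearity p K f)
    {s : ℝ} (hs : 0 < s) :
    ∫⁻ y, ‖nonlin f u s y‖ₑ ≤
      ENNReal.ofReal (K * A ^ (p - 1) * A * (1 + s) ^ (-((n : ℝ) / 2 * (p - 1)))) := by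
  have hA := hu.nonneg
  have hK := hf.pos
  have h := hu.wnorm_nonlin_le hf hs 1
  simp only [wnorm, Pi.one_apply, one_mul] at h
  refine h.trans ((mul_le_mul_right (hu.one s hs) _).trans (le_of_eq ?_))
  rw [← ENNReal.ofReal_mul (by positivity)]
  congr 1; ring

theorem FreeDecay.eLpNorm_top_nonlin_le (hu : FreeDecay u A) (hf : PowerNonlinearity p K f)
    {s : ℝ} (hs : 0 < s) :
    eLpNorm (nonlin f u s) ∞ volume ≤
      ENNReal.ofReal (K * A ^ (p - 1) * A *
        (1 + s) ^ (-((n : ℝ) / 2 * (p - 1)) + -(n : ℝ) / 2)) := by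
  have hA := hu.nonneg
  have hK := hf.pos
  rw [eLpNorm_exponent_top]
  refine eLpNormEssSup_le_of_ae_enorm_bound ?_
  filter_upwards [hu.norm_comp_le hf hs, hu.coeFn_nonlin hf hs, hu.top s hs] with y h1 h2 h3
  rw [h2, ← ofReal_norm]
  apply ENNReal.ofReal_le_ofReal
  refine h1.trans ?_
  rw [Real.rpow_add (by linarith)]
  calc _ ≤ K * A ^ (p - 1) * (1 + s) ^ (-((n : ℝ) / 2 * (p - 1))) *
        (A * (1 + s) ^ (-(n : ℝ) / 2)) := by gcongr
    _ = _ := by ring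

/-- On functions bounded by A, the nonlinearity is Lipschitz in L¹, so the L¹ continuity of u
suffices. This supplies the strong measurability of the source. -/
theorem FreeDecay.continuousOn_nonlin (hu : FreeDecay u A) (hf : PowerNonlinearity p K f) :
    ContinuousOn (nonlin f u) (Ioi 0) := by
  have hA := hu.nonneg
  have hK := hf.pos
  have hp := hf.one_lt
  have hlip : ∀ s ∈ Ioi (0 : ℝ), ∀ r ∈ Ioi (0 : ℝ),
      ‖nonlin f u s - nonlin f u r‖ ≤ K * (2 * A ^ (p - 1)) * ‖u s - u r‖ := by
    intro s hs r hr
    have h1 : ∀ s, 0 < s → ∀ᵐ y, ‖u s y‖ ^ (p - 1) ≤ A ^ (p - 1) := by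
      intro s hs
      filter_upwards [hu.rpow_le hf hs] with y hy
      refine hy.trans (mul_le_of_le_one_right (by positivity) ?_)
      apply Real.rpow_le_one_of_one_le_of_nonpos (by linarith)
      have : 0 ≤ (n : ℝ) / 2 * (p - 1) := mul_nonneg (by positivity) (by linarith)
      linarith
    refine Lp.norm_le_mul_norm_of_ae_le_mul ?_
    filter_upwards [Lp.coeFn_sub (nonlin f u s) (nonlin f u r), Lp.coeFn_sub (u s) (u r),
      hu.coeFn_nonlin hf hs, hu.coeFn_nonlin hf hr, h1 s hs, h1 r hr] with y e1 e2 e3 e4 b1 b2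
    rw [e1, e2, Pi.sub_apply, Pi.sub_apply, e3, e4]
    refine (hf.diff _ _).trans ?_
    gcongr
    linarith
  intro s hs
  have hc : ContinuousWithinAt u (Ioi 0) s :=
    (hu.cont s (mem_Ioi.1 hs).le).mono Ioi_subset_Ici_self
  rw [ContinuousWithinAt, tendsto_iff_norm_sub_tendsto_zero] at hc ⊢
  refine squeeze_zero' (Eventually.of_forall fun _ => norm_nonneg _) ?_
    (by simpa using hc.const_mul (K * (2 * A ^ (p - 1))))
  filter_upwards [self_mem_nhdsWithin] with r hr using hlip r hr s hs

theorem FreeDecay.aestronglyMeasurable_nonlin (hu : FreeDecay u A)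
    (hf : PowerNonlinearity p K f) :
    AEStronglyMeasurable (nonlin f u) (volume.restrict (Ioi 0)) :=
  (hu.continuousOn_nonlin hf).aestronglyMeasurable measurableSet_Ioi

end Source

/-! ### Propagation of moments by the equation. -/

theorem lintegral_rpow_lt_top {θ : ℝ} (hθ : 1 < θ) :
    ∫⁻ s in Ioi (0 : ℝ), ENNReal.ofReal ((1 + s) ^ (-θ)) < ∞ := by
  have h : IntegrableOn (fun s : ℝ => (1 + s) ^ (-θ)) (Ioi 0) := by
    have := integrableOn_add_rpow_Ioi_of_lt (a := -θ) (c := 0) (m := 1) (by linarith) (by norm_num)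
    simpa [add_comm] using this
  exact h.lintegral_lt_top

/-- The mild formulation of the equation for positive times. -/
def IsMild (ν : ℂ) (f : ℂ → ℂ) (u₀ : Rn n → ℂ) (u : ℝ → L1 n) : Prop :=
  ∀ t : ℝ, 0 < t → IntervalIntegrable (duhamel ν f u t) volume 0 t ∧
    u t = toL1 (semigroup ν t u₀) + ∫ s in (0 : ℝ)..t, duhamel ν f u t s

theorem coeFn_duhamel {ν : ℂ} (hν : 0 < ν.re) (f : ℂ → ℂ) (u : ℝ → L1 n) (t s : ℝ) :
    duhamel ν f u t s =ᵐ[volume] semigroup ν (t - s) (nonlin f u s) :=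
  coeFn_toL1 (memLp_semigroup hν _ (memLp_one_L1 _))

theorem wnorm_eq_iSup_truncWeight (M : ℕ) (φ : L1 n) :
    wnorm (fun y => ENNReal.ofReal (‖y‖ ^ M)) φ ≤ ⨆ N : ℕ, wnorm (truncWeight M N) φ := by
  have hφ : Measurable fun y => ‖φ y‖ₑ := (Lp.stronglyMeasurable φ).measurable.enorm
  unfold wnorm
  rw [← lintegral_iSup]
  · refine lintegral_mono fun y => ?_
    obtain ⟨N, hN⟩ := exists_nat_ge ‖y‖
    refine le_trans (le_of_eq ?_) (le_iSup (fun N : ℕ => truncWeight M N y * ‖φ y‖ₑ) N)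
    rw [truncWeight, min_eq_left hN]
  · exact fun N => (measurable_truncWeight M N).mul hφ
  · intro N L h y
    dsimp only [truncWeight]
    have : (N : ℝ) ≤ L := by exact_mod_cast h
    gcongr

/-- Propagation of the weighted integrability of the initial data. -/
theorem exists_wnorm_le {ν : ℂ} (hν : 0 < ν.re) {p K A : ℝ} {f : ℂ → ℂ} {u₀ : Rn n → ℂ}
    {u : ℝ → L1 n} (hf : PowerNonlinearity p K f) (hu : FreeDecay u A) (hmild : IsMild ν f u₀ u)
    (hθ : 1 < (n : ℝ) / 2 * (p - 1)) (M : ℕ) (hu₀ : Integrable u₀)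
    (hu₀M : ∫⁻ y, ENNReal.ofReal (‖y‖ ^ M) * ‖u₀ y‖ₑ ≠ ∞) :
    ∃ C : ℝ, 0 ≤ C ∧ ∀ t : ℝ, 0 < t →
      wnorm (fun y => ENNReal.ofReal (‖y‖ ^ M)) (u t) ≤
        ENNReal.ofReal (C * (1 + t) ^ ((M : ℝ) / 2)) := by
  have hA := hu.nonneg
  have hK := hf.pos
  set θ := (n : ℝ) / 2 * (p - 1)
  set B := K * A ^ (p - 1)
  have hB : 0 ≤ B := by positivity
  obtain ⟨C₁, hC₁, hS⟩ := exists_semigroup_weighted (n := n) hν M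
  -- The summand 1 only makes the kernel constant positive.
  obtain ⟨D, hD, hG⟩ := gronwall_lintegral (C := C₁ * B + 1) (by positivity) hθ
  set I := ∫⁻ s in Ioi (0 : ℝ), ENNReal.ofReal ((1 + s) ^ (-θ)) with hI
  have hIfin : I ≠ ∞ := (lintegral_rpow_lt_top hθ).ne
  set U := ∫⁻ y, ‖u₀ y‖ₑ
  have hU : U ≠ ∞ := hu₀.2.ne
  set UM := ∫⁻ y, ENNReal.ofReal (‖y‖ ^ M) * ‖u₀ y‖ₑ
  set Q : ℝ≥0∞ := ENNReal.ofReal C₁ * (U + UM + ENNReal.ofReal (B * A) * I) with hQ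
  have hQfin : Q ≠ ∞ := by
    refine ENNReal.mul_ne_top ENNReal.ofReal_ne_top (ENNReal.add_ne_top.2
      ⟨ENNReal.add_ne_top.2 ⟨hU, hu₀M⟩, ENNReal.mul_ne_top ENNReal.ofReal_ne_top hIfin⟩)
  refine ⟨D * Q.toReal, by positivity, fun T hT => ?_⟩
  refine (wnorm_eq_iSup_truncWeight M (u T)).trans (iSup_le fun N => ?_)
  rw [mul_assoc, ENNReal.ofReal_mul hD, ENNReal.ofReal_mul ENNReal.toReal_nonneg,
    ENNReal.ofReal_toReal hQfin]
  -- From here on T and the truncation level N are fixed; D and Q do not depend on either, so the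
  -- supremum over N can be taken.
  set k : Rn n → ℝ≥0∞ := truncWeight M N
  have hk : Measurable k := measurable_truncWeight M N
  have hkle : ∀ y, k y ≤ ENNReal.ofReal ((N : ℝ) ^ M) := fun y =>
    ENNReal.ofReal_le_ofReal (pow_le_pow_left₀ (le_min (norm_nonneg _) (Nat.cast_nonneg _))
      (min_le_right _ _) _)
  -- The a priori bound is N^M A, from the truncation and the L¹ bound.
  refine hG T (fun t => wnorm k (u t)) _ (ENNReal.ofReal ((N : ℝ) ^ M) * ENNReal.ofReal A)
    (ENNReal.mul_ne_top ENNReal.ofReal_ne_top ENNReal.ofReal_ne_top) ?_ ?_ T hT le_rfl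
  · intro t ht _
    refine (wnorm_mono hkle _).trans ?_
    rw [wnorm, lintegral_const_mul' _ _ ENNReal.ofReal_ne_top]
    gcongr
    exact hu.one t ht
  intro t ht htT
  obtain ⟨hint, heq⟩ := hmild t ht
  have hpow : t ^ ((M : ℝ) / 2) ≤ (1 + T) ^ ((M : ℝ) / 2) :=
    Real.rpow_le_rpow ht.le (by linarith) (by positivity)
  -- The growth factor is frozen at its value at T, since the free term in Gronwall's inequality
  -- must be constant.
  set P := ENNReal.ofReal ((1 + T) ^ ((M : ℝ) / 2))
  have hP1 : 1 ≤ P := by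
    rw [← ENNReal.ofReal_one]
    exact ENNReal.ofReal_le_ofReal (Real.one_le_rpow (by linarith) (by positivity))
  have h1 : wnorm k (toL1 (semigroup ν t u₀)) ≤ ENNReal.ofReal C₁ * (P * (U + UM)) := by
    rw [wnorm_congr (coeFn_toL1 (memLp_semigroup hν t (memLp_one_iff_integrable.2 hu₀)))]
    refine (hS t ht N (Nat.cast_nonneg _) u₀ hu₀.1).trans ?_
    rw [mul_add P]
    refine mul_le_mul_right (add_le_add
      (mul_le_mul_left (ENNReal.ofReal_le_ofReal hpow) _) ?_) _
    calc _ ≤ UM := by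
          refine lintegral_mono fun y => ?_
          gcongr
          exact ENNReal.ofReal_le_ofReal (pow_le_pow_left₀
            (le_min (norm_nonneg _) (Nat.cast_nonneg _)) (min_le_left _ _) _)
      _ ≤ P * UM := le_mul_of_one_le_left zero_le hP1
  have h2 : wnorm k (∫ s in (0 : ℝ)..t, duhamel ν f u t s : L1 n) ≤
      ENNReal.ofReal C₁ * (P * (ENNReal.ofReal (B * A) * I)) +
        ∫⁻ s in Ioo 0 t, ENNReal.ofReal ((C₁ * B + 1) * (1 + s) ^ (-θ)) * wnorm k (u s) := by
    rw [intervalIntegral.integral_of_le ht.le]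
    refine (wnorm_integral_le hk
      ((intervalIntegrable_iff_integrableOn_Ioc_of_le ht.le).1 hint)).trans ?_
    rw [setLIntegral_congr Ioo_ae_eq_Ioc.symm]
    calc _ ≤ ∫⁻ s in Ioo 0 t, (ENNReal.ofReal C₁ * (P * ENNReal.ofReal (B * A))) *
            ENNReal.ofReal ((1 + s) ^ (-θ)) +
            ENNReal.ofReal ((C₁ * B + 1) * (1 + s) ^ (-θ)) * wnorm k (u s) := by
          refine setLIntegral_mono' measurableSet_Ioo fun s hs => ?_
          have hs1 : 0 ≤ 1 + s := by linarith [hs.1]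
          rw [wnorm_congr (coeFn_duhamel hν f u t s)]
          refine (hS (t - s) (by linarith [hs.2]) N (Nat.cast_nonneg _) _
            (Lp.aestronglyMeasurable _)).trans ?_
          rw [mul_add]
          gcongr ?_ + ?_
          · have a1 : ENNReal.ofReal ((t - s) ^ ((M : ℝ) / 2)) ≤ P :=
              ENNReal.ofReal_le_ofReal (Real.rpow_le_rpow (by linarith [hs.2])
                (by linarith [hs.1]) (by positivity))
            have a2 := hu.lintegral_nonlin_le hf hs.1
            calc _ ≤ ENNReal.ofReal C₁ * (P *
                  ENNReal.ofReal (B * A * (1 + s) ^ (-θ))) := by gcongr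
              _ = _ := by
                rw [ENNReal.ofReal_mul (p := B * A) (by positivity)]; ring
          · have a3 := hu.wnorm_nonlin_le hf hs.1 k
            calc _ ≤ ENNReal.ofReal C₁ * (ENNReal.ofReal (B * (1 + s) ^ (-θ)) *
                  wnorm k (u s)) := by gcongr; exact a3
              _ = ENNReal.ofReal (C₁ * (B * (1 + s) ^ (-θ))) * wnorm k (u s) := by
                rw [ENNReal.ofReal_mul hC₁]; ring
              _ ≤ _ := by
                refine mul_le_mul_left (ENNReal.ofReal_le_ofReal ?_) _
                have : 0 ≤ (1 + s) ^ (-θ) := by positivity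
                nlinarith
      _ ≤ _ := by
          have hm : Measurable fun s : ℝ => ENNReal.ofReal ((1 + s) ^ (-θ)) := by fun_prop
          rw [lintegral_add_left (hm.const_mul _), lintegral_const_mul _ hm]
          refine add_le_add ?_ le_rfl
          calc _ ≤ (ENNReal.ofReal C₁ * (P * ENNReal.ofReal (B * A))) * I :=
                mul_le_mul_right (lintegral_mono_set Ioo_subset_Ioi_self) _
            _ = _ := by ring
  rw [heq]
  refine (wnorm_add_le hk _ _).trans ((add_le_add h1 h2).trans ?_)
  rw [← add_assoc]
  refine add_le_add (le_of_eq ?_) le_rfl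
  rw [hQ]; ring

/-! ### Multi-index algebra of the profiles. -/

theorem mlen_add (α β : Fin n → ℕ) : mlen (α + β) = mlen α + mlen β := by
  simp [mlen, Finset.sum_add_distrib]

theorem mlen_two_smul (γ : Fin n → ℕ) : mlen (2 • γ) = 2 * mlen γ := by
  simp [mlen, Finset.mul_sum]

/-- The multi-indices `γ` with `2γ ≤ κ`. -/
def halfBox (κ : Fin n → ℕ) : Finset (Fin n → ℕ) :=
  Fintype.piFinset fun j => Finset.range (κ j / 2 + 1)

theorem mem_halfBox {κ γ : Fin n → ℕ} : γ ∈ halfBox κ ↔ ∀ j, 2 * γ j ≤ κ j := by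
  simp only [halfBox, Fintype.mem_piFinset, Finset.mem_range]
  refine forall_congr' fun j => ?_
  omega

theorem sub_add_of_mem_halfBox {κ γ : Fin n → ℕ} (h : γ ∈ halfBox κ) : κ - 2 • γ + 2 • γ = κ := by
  funext j
  have := mem_halfBox.1 h j
  simp only [Pi.add_apply, Pi.sub_apply, Pi.smul_apply, smul_eq_mul]
  omega

theorem mlen_of_mem_halfBox {κ γ : Fin n → ℕ} (h : γ ∈ halfBox κ) :
    mlen (κ - 2 • γ) + 2 * mlen γ = mlen κ := by
  rw [← mlen_two_smul, ← mlen_add, sub_add_of_mem_halfBox h]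

/-- The signs (-1)^(κ j - 2γ j) multiply to (-1)^|κ|, independently of γ. Each s^|γ| comes with
y^(κ-2γ), which is how the moments of ψ_{|γ|} arise. -/
theorem heatCoeff_eq_sum (ν : ℂ) (κ : Fin n → ℕ) (s : ℝ) (y : Rn n) :
    heatCoeff ν κ s y = (-1) ^ mlen κ * ∑ γ ∈ halfBox κ,
      (-ν) ^ mlen γ / (mfact γ : ℂ) * (s : ℂ) ^ mlen γ *
        (1 / (mfact (κ - 2 • γ) : ℂ) * (mpow y (κ - 2 • γ) : ℂ)) := by
  rw [heatCoeff]
  simp only [he]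
  rw [Finset.prod_univ_sum, Finset.mul_sum]
  refine Finset.sum_congr rfl fun γ hγ => ?_
  have h1 : (-1 : ℂ) ^ mlen κ = ∏ j, (-1 : ℂ) ^ (κ j - 2 * γ j) := by
    rw [Finset.prod_pow_eq_pow_sum, ← mlen_of_mem_halfBox hγ, pow_add, pow_mul]
    simp [mlen]
  rw [h1]
  simp only [mlen, mfact, mpow, Pi.sub_apply, Pi.smul_apply, smul_eq_mul,
    ← Finset.prod_pow_eq_pow_sum]
  push_cast
  rw [← Finset.prod_div_distrib, ← Finset.prod_mul_distrib, one_div, ← Finset.prod_inv_distrib,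
    ← Finset.prod_mul_distrib, ← Finset.prod_mul_distrib, ← Finset.prod_mul_distrib]
  refine Finset.prod_congr rfl fun j _ => ?_
  rw [neg_pow (y j : ℂ), ← neg_mul, mul_pow]
  ring

/-- The first component is determined by the second, and the constraint on the length of the second
is automatic when |κ| ≤ N. -/
theorem sum_filter_eq_sum_halfBox {N : ℕ} {κ : Fin n → ℕ} (hκ : mlen κ ≤ N)
    (F : (Fin n → ℕ) → (Fin n → ℕ) → ℂ) :
    ∑ b ∈ (Finset.Icc 0 κ ×ˢ Finset.Icc 0 κ).filter
        (fun b : (Fin n → ℕ) × (Fin n → ℕ) => b.1 + 2 • b.2 = κ ∧ 2 * mlen b.2 ≤ N),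
      F b.1 b.2 = ∑ γ ∈ halfBox κ, F (κ - 2 • γ) γ := by
  refine Finset.sum_nbij' (fun b => b.2) (fun γ => (κ - 2 • γ, γ)) ?_ ?_ ?_ ?_ ?_
  · intro b hb
    obtain ⟨-, h, -⟩ := Finset.mem_filter.1 hb
    refine mem_halfBox.2 fun j => ?_
    have := congrFun h j
    simp only [Pi.add_apply, Pi.smul_apply, smul_eq_mul] at this
    omega
  · intro γ hγ
    have h1 := mem_halfBox.1 hγ
    have h2 := mlen_of_mem_halfBox hγ
    refine Finset.mem_filter.2 ⟨Finset.mem_product.2 ⟨Finset.mem_Icc.2 ⟨?_, ?_⟩,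
      Finset.mem_Icc.2 ⟨?_, ?_⟩⟩, sub_add_of_mem_halfBox hγ, by dsimp only; omega⟩
    · exact fun j => Nat.zero_le _
    · exact fun j => Nat.sub_le _ _
    · exact fun j => Nat.zero_le _
    · exact fun j => by have := h1 j; show γ j ≤ κ j; omega
  · rintro ⟨β, γ⟩ hb
    obtain ⟨-, h, -⟩ := Finset.mem_filter.1 hb
    dsimp only at h ⊢
    rw [← h, add_tsub_cancel_right]
  · intro γ _; rfl
  · rintro ⟨β, γ⟩ hb
    obtain ⟨-, h, -⟩ := Finset.mem_filter.1 hb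
    dsimp only at h ⊢
    rw [← h, add_tsub_cancel_right]

/-- The coefficient `M_κ(u₀) + ∑_{2γ ≤ κ} ((-ν)^|γ| / γ!) M_{κ-2γ}(ψ_{|γ|})`. -/
def fullCoeff (ν : ℂ) (f : ℂ → ℂ) (u₀ : Rn n → ℂ) (u : ℝ → L1 n) (κ : Fin n → ℕ) : ℂ :=
  moment κ u₀ + ∑ γ ∈ halfBox κ,
    ((-ν) ^ mlen γ / (mfact γ : ℂ)) * moment (κ - 2 • γ) (psi f u (mlen γ))

theorem profileCoeff_eq (ν : ℂ) (f : ℂ → ℂ) (u₀ : Rn n → ℂ) (u : ℝ → L1 n) {N : ℕ}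
    {κ : Fin n → ℕ} (hκ : mlen κ ≤ N) : profileCoeff ν f u₀ u N κ = fullCoeff ν f u₀ u κ := by
  rw [profileCoeff, fullCoeff, sum_filter_eq_sum_halfBox hκ
    (fun β γ => ((-ν) ^ mlen γ / (mfact γ : ℂ)) * moment β (psi f u (mlen γ)))]

/-- The powers of 2 combine through (-2)^|α| 2^k = (-1)^k (-2)^(|α|+k), which turns Hermite
functions into derivatives of the Gaussian. -/
theorem Lam_eq (ν : ℂ) (α : Fin n → ℕ) (N : ℕ) {t : ℝ} (ht : 0 < t) (φ : Rn n → ℂ)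
    (x : Rn n) : Lam ν α N t φ x =
      ∑ β ∈ lowIdx n N, (-1) ^ mlen β * moment β φ * profTerm ν (α + β) t x := by
  rw [sum_lowIdx, Lam, Finset.mul_sum]
  refine Finset.sum_congr rfl fun k _ => ?_
  rw [← mul_assoc, Finset.mul_sum]
  refine Finset.sum_congr rfl fun β hβ => ?_
  have hk := mem_multiIdx.1 hβ
  have h2 : t ^ (-(mlen (α + β) : ℝ) / 2) = t ^ (-(mlen α : ℝ) / 2) * t ^ (-(k : ℝ) / 2) := by
    rw [← Real.rpow_add ht, mlen_add, hk]; congr 1; push_cast; ring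
  have h3 : (-2 : ℂ) ^ mlen (α + β) = (-2) ^ mlen α * ((-1) ^ k * 2 ^ k) := by
    rw [mlen_add, pow_add, hk, ← mul_pow]; norm_num
  have h4 : ((-1 : ℂ) ^ k) * ((-1 : ℂ) ^ k)⁻¹ = 1 := mul_inv_cancel₀ (by simp)
  rw [profTerm, dilation, dilation, dgauss_eq, h2, h3, hk]
  simp only [mul_inv]
  push_cast
  linear_combination (-((-2 : ℂ) ^ mlen α)⁻¹ * ((t ^ (-(mlen α : ℝ) / 2) : ℝ) : ℂ) * (2 ^ k)⁻¹ *
    ((t ^ (-(k : ℝ) / 2) : ℝ) : ℂ) * moment β φ * ((t ^ (-(n : ℝ) / 2) : ℝ) : ℂ) *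
    (hermitePoly ν (α + β) (t ^ (-(1 : ℝ) / 2) • x) * gauss ν (t ^ (-(1 : ℝ) / 2) • x))) * h4

/-- The profile as a combination of rescaled derivatives of the Gaussian. -/
theorem profile_eq (ν : ℂ) (f : ℂ → ℂ) (u₀ : Rn n → ℂ) (u : ℝ → L1 n) (N : ℕ) {t : ℝ}
    (ht : 0 < t) (x : Rn n) : profile ν f u₀ u N t x =
      ∑ κ ∈ lowIdx n N, (-1) ^ mlen κ * fullCoeff ν f u₀ u κ * profTerm ν κ t x := by
  rw [profile, ← sum_lowIdx (fun γ =>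
    ((-ν) ^ mlen γ / (mfact γ : ℂ)) * Lam ν (2 • γ) (N - 2 * mlen γ) t (psi f u (mlen γ)) x)]
  simp only [Lam_eq ν _ _ ht, zero_add, fullCoeff, mul_add, add_mul, Finset.sum_add_distrib]
  congr 1
  simp only [Finset.mul_sum, Finset.sum_mul]
  rw [Finset.sum_sigma', Finset.sum_sigma']
  -- The change of index (γ, β) ↦ (β + 2γ, γ) maps |β| ≤ N - 2|γ| to |κ| ≤ N and 2γ ≤ κ; it
  -- preserves the sign, since |κ| and |β| have the same parity.
  refine Finset.sum_nbij' (fun b => ⟨b.2 + 2 • b.1, b.1⟩) (fun b => ⟨b.2, b.1 - 2 • b.2⟩)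
    ?_ ?_ ?_ ?_ ?_
  · rintro ⟨γ, β⟩ h
    rw [Finset.mem_sigma, mem_lowIdx, mem_lowIdx] at h
    rw [Finset.mem_sigma, mem_lowIdx, mem_halfBox]
    dsimp only at h ⊢
    rw [mlen_add, mlen_two_smul]
    refine ⟨by omega, fun j => ?_⟩
    simp
  · rintro ⟨κ, γ⟩ h
    rw [Finset.mem_sigma, mem_lowIdx] at h
    rw [Finset.mem_sigma, mem_lowIdx, mem_lowIdx]
    dsimp only at h ⊢
    have := mlen_of_mem_halfBox h.2
    omega
  · rintro ⟨γ, β⟩ _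
    simp
  · rintro ⟨κ, γ⟩ h
    rw [Finset.mem_sigma] at h
    dsimp only at h ⊢
    rw [sub_add_of_mem_halfBox h.2]
  · rintro ⟨γ, β⟩ _
    dsimp only
    have h1 : (-1 : ℂ) ^ mlen (β + 2 • γ) = (-1) ^ mlen β := by
      rw [mlen_add, mlen_two_smul, pow_add, pow_mul]; simp
    rw [h1, add_tsub_cancel_right, add_comm (2 • γ) β]
    ring

/-- The top order part of the profile at time `1`. -/
def topProfile (ν : ℂ) (f : ℂ → ℂ) (u₀ : Rn n → ℂ) (u : ℝ → L1 n) (N : ℕ) (x : Rn n) : ℂ :=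
  ∑ κ ∈ multiIdx n N, (-1) ^ mlen κ * fullCoeff ν f u₀ u κ * dgauss ν κ x

/-- The coefficients `fullCoeff` do not depend on the order of the profile, so all terms of length
at most m cancel. What remains is self-similar. -/
theorem profile_succ_sub (ν : ℂ) (f : ℂ → ℂ) (u₀ : Rn n → ℂ) (u : ℝ → L1 n) (m : ℕ) {t : ℝ}
    (ht : 0 < t) (x : Rn n) :
    profile ν f u₀ u (m + 1) t x - profile ν f u₀ u m t x =
      ((t ^ (-((m : ℝ) + 1) / 2) : ℝ) : ℂ) * dilation t (topProfile ν f u₀ u (m + 1)) x := by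
  rw [profile_eq ν f u₀ u _ ht, profile_eq ν f u₀ u _ ht, sum_lowIdx, sum_lowIdx,
    Finset.sum_range_succ _ (m + 1), add_sub_cancel_left, dilation, topProfile, Finset.mul_sum,
    Finset.mul_sum]
  refine Finset.sum_congr rfl fun κ hκ => ?_
  rw [profTerm, dilation, mem_multiIdx.1 hκ]
  push_cast
  ring

theorem profile_succ_sub_one (ν : ℂ) (f : ℂ → ℂ) (u₀ : Rn n → ℂ) (u : ℝ → L1 n) (m : ℕ)
    (x : Rn n) :
    profile ν f u₀ u (m + 1) 1 x - profile ν f u₀ u m 1 x = topProfile ν f u₀ u (m + 1) x := by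
  rw [profile_succ_sub ν f u₀ u m one_pos, dilation]
  simp

theorem continuous_topProfile (ν : ℂ) (f : ℂ → ℂ) (u₀ : Rn n → ℂ) (u : ℝ → L1 n) (N : ℕ) :
    Continuous (topProfile ν f u₀ u N) := by
  unfold topProfile
  exact continuous_finsetSum _ fun κ _ => continuous_const.mul (continuous_dgauss ν κ)

/-! ### Linear independence of the derivatives of the Gaussian. -/

theorem eq_zero_of_sum_mpow_eq_zero {S : Finset (Fin n → ℕ)} {c : (Fin n → ℕ) → ℝ}
    (h : ∀ x : Fin n → ℝ, ∑ κ ∈ S, c κ * ∏ j, x j ^ κ j = 0) {κ : Fin n → ℕ} (hκ : κ ∈ S) :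
    c κ = 0 := by
  classical
  set P : MvPolynomial (Fin n) ℝ :=
    ∑ κ ∈ S, MvPolynomial.monomial (Finsupp.equivFunOnFinite.symm κ) (c κ) with hP
  have hP0 : P = 0 := by
    apply MvPolynomial.funext
    intro x
    rw [map_zero, ← h x, hP, map_sum]
    refine Finset.sum_congr rfl fun κ _ => ?_
    rw [MvPolynomial.eval_monomial, Finsupp.prod_fintype _ _ (by simp)]
    simp
  have hc := congrArg (MvPolynomial.coeff (Finsupp.equivFunOnFinite.symm κ)) hP0
  rw [hP, MvPolynomial.coeff_sum, MvPolynomial.coeff_zero] at hc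
  simpa [MvPolynomial.coeff_monomial, hκ] using hc

/-- The derivatives of order `N` of the Gaussian are linearly independent. -/
theorem eq_zero_of_sum_dgauss_eq_zero {ν : ℂ} (hν : ν ≠ 0) {N : ℕ} {c : (Fin n → ℕ) → ℂ}
    (h : ∀ x : Rn n, ∑ κ ∈ multiIdx n N, c κ * dgauss ν κ x = 0) {κ : Fin n → ℕ}
    (hκ : mlen κ = N) : c κ = 0 := by
  set A : ℂ := -1 / (4 * ν)
  set B : ℂ := -1 / (2 * ν)
  have hB : B ≠ 0 := by simp [B, hν]
  have hpi : (Real.pi : ℂ) ≠ 0 := by exact_mod_cast Real.pi_ne_zero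
  -- Evaluate at x/ε, divide by the Gaussian and multiply by ε^N: by homogeneity the lower-order
  -- parts of the Hermite polynomials acquire powers of ε².
  have h1 : ∀ x : Fin n → ℝ, ∀ ε : ℝ, ε ≠ 0 →
      ∑ κ ∈ multiIdx n N, c κ *
        ∏ j, (((κ j).factorial : ℂ) * he ((ε : ℂ) ^ 2 * A) (B * x j) (κ j)) = 0 := by
    intro x ε hε
    have hε' : (ε : ℂ) ≠ 0 := by exact_mod_cast hε
    have h2 := h (WithLp.toLp 2 fun j => x j / ε)
    have hg : (gauss ν (WithLp.toLp 2 fun j => x j / ε : Rn n)) ≠ 0 := by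
      rw [gauss]
      refine mul_ne_zero ?_ (Complex.exp_ne_zero _)
      rw [Complex.cpow_def_of_ne_zero (by simp [hν, hpi])]
      exact Complex.exp_ne_zero _
    have h3 : ∀ κ ∈ multiIdx n N, c κ *
        ∏ j, (((κ j).factorial : ℂ) * he ((ε : ℂ) ^ 2 * A) (B * x j) (κ j)) =
        (ε : ℂ) ^ N * (gauss ν (WithLp.toLp 2 fun j => x j / ε : Rn n))⁻¹ *
          (c κ * dgauss ν κ (WithLp.toLp 2 fun j => x j / ε)) := by
      intro κ hκ
      have e : ∀ j, he ((ε : ℂ) ^ 2 * A) (B * x j) (κ j) =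
          (ε : ℂ) ^ κ j * he A (-((x j / ε : ℝ) : ℂ) / (2 * ν)) (κ j) := by
        intro j
        rw [← he_homog]
        congr 1
        simp only [B]
        push_cast
        field_simp
      have hgp : (∏ j, gauss1 ν (x j / ε)) =
        gauss ν (WithLp.toLp 2 fun j => x j / ε : Rn n) := by rw [gauss_eq_prod]
      simp only [e, dgauss, dgauss1, Finset.prod_mul_distrib, hgp, Finset.prod_pow_eq_pow_sum]
      rw [← mlen, mem_multiIdx.1 hκ]
      simp only [A]
      field_simp
    rw [Finset.sum_congr rfl h3, ← Finset.mul_sum, h2, mul_zero]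
  -- As ε → 0 only the leading monomials survive, multiplied by B^N ≠ 0.
  have h2 : ∀ x : Fin n → ℝ, ∑ κ ∈ multiIdx n N, c κ * ∏ j, (x j : ℂ) ^ κ j = 0 := by
    intro x
    have hheA : ∀ (B : ℂ) (i : ℕ), Continuous fun A => he A B i := by
      intro B i; unfold he; fun_prop
    have hcont : Continuous fun ε : ℝ => ∑ κ ∈ multiIdx n N, c κ *
        ∏ j, (((κ j).factorial : ℂ) * he ((ε : ℂ) ^ 2 * A) (B * x j) (κ j)) := by
      refine continuous_finsetSum _ fun κ _ => continuous_const.mul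
        (continuous_finsetProd _ fun j _ => continuous_const.mul ((hheA _ _).comp ?_))
      fun_prop
    have h0 : ∑ κ ∈ multiIdx n N, c κ *
        ∏ j, (((κ j).factorial : ℂ) * he (((0 : ℝ) : ℂ) ^ 2 * A) (B * x j) (κ j)) = 0 := by
      have hc0 := (hcont.tendsto 0).mono_left (nhdsWithin_le_nhds (s := {0}ᶜ))
      refine tendsto_nhds_unique hc0 (tendsto_const_nhds.congr' ?_)
      filter_upwards [self_mem_nhdsWithin] with ε hε using (h1 x ε hε).symm
    have e : ∀ κ ∈ multiIdx n N, c κ *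
        ∏ j, (((κ j).factorial : ℂ) * he (((0 : ℝ) : ℂ) ^ 2 * A) (B * x j) (κ j)) =
        B ^ N * (c κ * ∏ j, (x j : ℂ) ^ κ j) := by
      intro κ hκ
      have e1 : ∀ (X : ℂ) (i : ℕ), (i.factorial : ℂ) * he 0 X i = X ^ i := by
        intro X i
        have : (i.factorial : ℂ) ≠ 0 := by exact_mod_cast i.factorial_ne_zero
        rw [he, Finset.sum_eq_single 0]
        · simp; field_simp
        · intro b _ hb; simp [hb]
        · simp
      have e2 : (((0 : ℝ) : ℂ) ^ 2 * A) = 0 := by simp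
      simp only [e2, e1, mul_pow, Finset.prod_mul_distrib, Finset.prod_pow_eq_pow_sum]
      rw [← mlen, mem_multiIdx.1 hκ]
      ring
    rw [Finset.sum_congr rfl e, ← Finset.mul_sum] at h0
    exact (mul_eq_zero.1 h0).resolve_left (pow_ne_zero _ hB)
  have hre : ∀ (a : ℂ) (x : Fin n → ℝ) (κ : Fin n → ℕ),
      a * ∏ j, (x j : ℂ) ^ κ j = ((∏ j, x j ^ κ j : ℝ) : ℂ) * a := by
    intro a x κ; push_cast; ring
  have hmem := mem_multiIdx.2 hκ
  apply Complex.ext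
  · refine eq_zero_of_sum_mpow_eq_zero (c := fun κ => (c κ).re) (fun x => ?_) hmem
    have := congrArg Complex.re (h2 x)
    simp only [hre, Complex.re_sum, Complex.re_ofReal_mul, Complex.zero_re] at this
    simpa only [mul_comm] using this
  · refine eq_zero_of_sum_mpow_eq_zero (c := fun κ => (c κ).im) (fun x => ?_) hmem
    have := congrArg Complex.im (h2 x)
    simp only [hre, Complex.im_sum, Complex.im_ofReal_mul, Complex.zero_im] at this
    simpa only [mul_comm] using this

theorem topProfile_ne_zero_iff {ν : ℂ} (hν : ν ≠ 0) (f : ℂ → ℂ) (u₀ : Rn n → ℂ)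
    (u : ℝ → L1 n) (N : ℕ) : (∃ x, topProfile ν f u₀ u N x ≠ 0) ↔
      ∃ κ : Fin n → ℕ, mlen κ = N ∧ fullCoeff ν f u₀ u κ ≠ 0 := by
  constructor
  · contrapose!
    intro h x
    refine Finset.sum_eq_zero fun κ hκ => ?_
    rw [h κ (mem_multiIdx.1 hκ)]; simp
  · contrapose!
    intro h κ hκ
    have := eq_zero_of_sum_dgauss_eq_zero hν
      (c := fun κ => (-1) ^ mlen κ * fullCoeff ν f u₀ u κ) h hκ
    simpa using this

/-! ### Moments of the source and coefficients of the profile. -/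

/-- Mild solutions with free decay and initial data with `M` moments. -/
structure DecayingSolution (ν : ℂ) (p K A : ℝ) (M : ℕ) (f : ℂ → ℂ) (u₀ : Rn n → ℂ)
    (u : ℝ → L1 n) : Prop where
  re_pos : 0 < ν.re
  nl : PowerNonlinearity p K f
  decay : FreeDecay u A
  mild : IsMild ν f u₀ u
  exponent : (M : ℝ) / 2 + 1 < (n : ℝ) / 2 * (p - 1)
  integrable : Integrable u₀
  moments : ∫⁻ y, ENNReal.ofReal (‖y‖ ^ M) * ‖u₀ y‖ₑ ≠ ∞

/-- The parabolic weighted mass. -/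
def mass (M : ℕ) (s : ℝ) (φ : Rn n → ℂ) : ℝ≥0∞ :=
  ENNReal.ofReal (1 + √s ^ M) * (∫⁻ y, ‖φ y‖ₑ) + ∫⁻ y, ENNReal.ofReal (‖y‖ ^ M) * ‖φ y‖ₑ

theorem sqrt_pow_eq {s : ℝ} (hs : 0 ≤ s) (M : ℕ) : √s ^ M = s ^ ((M : ℝ) / 2) := by
  rw [Real.sqrt_eq_rpow, ← Real.rpow_natCast, ← Real.rpow_mul hs]
  congr 1; ring

theorem abs_mpow_le (y : Rn n) (β : Fin n → ℕ) : |mpow y β| ≤ ‖y‖ ^ mlen β := by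
  rw [mpow, Finset.abs_prod, mlen, ← Finset.prod_pow_eq_pow_sum]
  refine Finset.prod_le_prod (fun _ _ => abs_nonneg _) fun j _ => ?_
  rw [abs_pow]
  gcongr
  exact PiLp.norm_apply_le y j

theorem continuous_mpow (β : Fin n → ℕ) : Continuous fun y : Rn n => (mpow y β : ℂ) := by
  unfold mpow
  refine Complex.continuous_ofReal.comp (continuous_finsetProd _ fun j _ => ?_)
  fun_prop

theorem integrable_mpow_mul {M : ℕ} {β : Fin n → ℕ} (hβ : mlen β ≤ M) {φ : Rn n → ℂ}
    (hφ : Integrable φ) (hφM : ∫⁻ y, ENNReal.ofReal (‖y‖ ^ M) * ‖φ y‖ₑ ≠ ∞) :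
    Integrable fun y => (mpow y β : ℂ) * φ y := by
  refine integrable_mul_of_moment hφ hφM (continuous_mpow β).aestronglyMeasurable zero_le_one
    fun y => ?_
  rw [Complex.norm_real, one_mul, Real.norm_eq_abs]
  exact (abs_mpow_le y β).trans (pow_le_one_add_pow (norm_nonneg y) hβ)

theorem momentAt_eq (ν : ℂ) {M : ℕ} {κ : Fin n → ℕ} (hκ : mlen κ ≤ M) (s : ℝ) {φ : Rn n → ℂ}
    (hφ : Integrable φ) (hφM : ∫⁻ y, ENNReal.ofReal (‖y‖ ^ M) * ‖φ y‖ₑ ≠ ∞) :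
    momentAt ν κ s φ = (-1) ^ mlen κ * ∑ γ ∈ halfBox κ, (-ν) ^ mlen γ / (mfact γ : ℂ) *
      ((s : ℂ) ^ mlen γ * moment (κ - 2 • γ) φ) := by
  have hI : ∀ γ ∈ halfBox κ, Integrable fun y => (mpow y (κ - 2 • γ) : ℂ) * φ y := fun γ hγ => by
    refine integrable_mpow_mul ?_ hφ hφM
    have := mlen_of_mem_halfBox hγ
    omega
  simp only [momentAt, moment]
  have e : ∀ y, heatCoeff ν κ s y * φ y = ∑ γ ∈ halfBox κ,
      ((-1) ^ mlen κ * ((-ν) ^ mlen γ / (mfact γ : ℂ) * ((s : ℂ) ^ mlen γ *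
        (1 / (mfact (κ - 2 • γ) : ℂ))))) * ((mpow y (κ - 2 • γ) : ℂ) * φ y) := by
    intro y
    rw [heatCoeff_eq_sum, Finset.mul_sum, Finset.sum_mul]
    exact Finset.sum_congr rfl fun γ _ => by ring
  simp only [e]
  rw [integral_finsetSum _ fun γ hγ => (hI γ hγ).const_mul _, Finset.mul_sum]
  refine Finset.sum_congr rfl fun γ _ => ?_
  rw [integral_const_mul]
  ring

theorem momentAt_zero (ν : ℂ) {M : ℕ} {κ : Fin n → ℕ} (hκ : mlen κ ≤ M) {φ : Rn n → ℂ}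
    (hφ : Integrable φ) (hφM : ∫⁻ y, ENNReal.ofReal (‖y‖ ^ M) * ‖φ y‖ₑ ≠ ∞) :
    momentAt ν κ 0 φ = (-1) ^ mlen κ * moment κ φ := by
  rw [momentAt_eq ν hκ 0 hφ hφM, Finset.sum_eq_single 0]
  · have e : κ - 2 • (0 : Fin n → ℕ) = κ := by funext j; simp
    rw [e]
    simp [mlen, mfact]
  · intro γ _ hγ
    have : mlen γ ≠ 0 := by
      intro h
      apply hγ
      funext j
      have := le_mlen γ j
      simp only [Pi.zero_apply]
      omega
    simp [this]
  · intro h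
    exact absurd (mem_halfBox.2 fun j => by simp) h

/-- With w = max(√s, r) the left side is at most w^(b+2k), of parabolic degree at most M. Hence
`mass` dominates all the moments needed. -/
theorem sqrt_pow_mul_pow_le {s r : ℝ} (hs : 0 ≤ s) (hr : 0 ≤ r) {k b M : ℕ}
    (h : b + 2 * k ≤ M) : s ^ k * r ^ b ≤ (1 + √s ^ M) + r ^ M := by
  have h1 : s ^ k = √s ^ (2 * k) := by rw [pow_mul, Real.sq_sqrt hs]
  have hq := Real.sqrt_nonneg s
  set q := √s
  set w := max q r
  have hw : 0 ≤ w := le_max_of_le_left hq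
  rw [h1]
  calc q ^ (2 * k) * r ^ b ≤ w ^ (2 * k) * w ^ b := by
        gcongr
        · exact le_max_left _ _
        · exact le_max_right _ _
    _ = w ^ (2 * k + b) := (pow_add _ _ _).symm
    _ ≤ 1 + w ^ M := pow_le_one_add_pow hw (by omega)
    _ ≤ 1 + (q ^ M + r ^ M) := by gcongr; exact max_pow_le hq hr M
    _ = _ := by ring

namespace DecayingSolution

variable {ν : ℂ} {p K A : ℝ} {M : ℕ} {f : ℂ → ℂ} {u₀ : Rn n → ℂ} {u : ℝ → L1 n}

/-- The source decays like (1+s)^(-n(p-1)/2) and the weights cost (1+s)^(M/2). By `exponent` the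
resulting rate exceeds 1, so the mass is integrable in time. -/
theorem exists_mass_le (h : DecayingSolution ν p K A M f u₀ u) :
    ∃ C : ℝ, 0 ≤ C ∧ ∀ s : ℝ, 0 < s → mass M s (nonlin f u s) ≤
      ENNReal.ofReal (C * (1 + s) ^ (-((n : ℝ) / 2 * (p - 1) - (M : ℝ) / 2))) := by
  have hA := h.decay.nonneg
  have hK := h.nl.pos
  have hexp := h.exponent
  have hM0 : (0 : ℝ) ≤ (M : ℝ) / 2 := by positivity
  obtain ⟨C, hC, hw⟩ := exists_wnorm_le h.re_pos h.nl h.decay h.mild (by linarith) M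
    h.integrable h.moments
  set θ := (n : ℝ) / 2 * (p - 1)
  set B := K * A ^ (p - 1)
  have hB : 0 ≤ B := by positivity
  refine ⟨2 * (B * A) + B * C, by positivity, fun s hs => ?_⟩
  have hs1 : 0 < 1 + s := by linarith
  have e : (1 + s) ^ (-(θ - (M : ℝ) / 2)) = (1 + s) ^ ((M : ℝ) / 2) * (1 + s) ^ (-θ) := by
    rw [← Real.rpow_add hs1]; congr 1; ring
  have h1 : 1 + √s ^ M ≤ 2 * (1 + s) ^ ((M : ℝ) / 2) := by
    rw [sqrt_pow_eq hs.le]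
    have a1 : (1 : ℝ) ≤ (1 + s) ^ ((M : ℝ) / 2) := Real.one_le_rpow (by linarith) hM0
    have a2 : s ^ ((M : ℝ) / 2) ≤ (1 + s) ^ ((M : ℝ) / 2) :=
      Real.rpow_le_rpow hs.le (by linarith) hM0
    linarith
  have h2 := h.decay.lintegral_nonlin_le h.nl hs
  have h3 := h.decay.wnorm_nonlin_le h.nl hs (fun y => ENNReal.ofReal (‖y‖ ^ M))
  have h4 := hw s hs
  rw [add_mul, ENNReal.ofReal_add (by positivity) (by positivity), mass]
  refine add_le_add ?_ ?_
  · calc _ ≤ ENNReal.ofReal (2 * (1 + s) ^ ((M : ℝ) / 2)) *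
          ENNReal.ofReal (B * A * (1 + s) ^ (-θ)) := by gcongr
      _ = _ := by
          rw [← ENNReal.ofReal_mul (by positivity), e]; congr 1; ring
  · refine h3.trans ?_
    calc _ ≤ ENNReal.ofReal (B * (1 + s) ^ (-θ)) *
          ENNReal.ofReal (C * (1 + s) ^ ((M : ℝ) / 2)) := by gcongr
      _ = _ := by
          rw [← ENNReal.ofReal_mul (by positivity), e]; congr 1; ring

theorem lintegral_mass_ne_top (h : DecayingSolution ν p K A M f u₀ u) :
    ∫⁻ s in Ioi (0 : ℝ), mass M s (nonlin f u s) ≠ ∞ := by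
  obtain ⟨C, hC, hle⟩ := h.exists_mass_le
  have hexp := h.exponent
  refine ne_top_of_le_ne_top ?_ (setLIntegral_mono' measurableSet_Ioi fun s hs => hle s hs)
  have hfin := lintegral_rpow_lt_top (θ := (n : ℝ) / 2 * (p - 1) - (M : ℝ) / 2) (by linarith)
  simp only [ENNReal.ofReal_mul hC]
  rw [lintegral_const_mul' _ _ ENNReal.ofReal_ne_top]
  exact ENNReal.mul_ne_top ENNReal.ofReal_ne_top hfin.ne

theorem integrable_nonlin (_h : DecayingSolution ν p K A M f u₀ u) (s : ℝ) :
    Integrable (nonlin f u s) := memLp_one_iff_integrable.1 (memLp_one_L1 _)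

theorem moments_nonlin (h : DecayingSolution ν p K A M f u₀ u) {s : ℝ} (hs : 0 < s) :
    ∫⁻ y, ENNReal.ofReal (‖y‖ ^ M) * ‖nonlin f u s y‖ₑ ≠ ∞ := by
  obtain ⟨C, hC, hle⟩ := h.exists_mass_le
  refine ne_top_of_le_ne_top ENNReal.ofReal_ne_top (le_trans ?_ (hle s hs))
  exact le_add_self

theorem wnorm_smul_nonlin_le (_h : DecayingSolution ν p K A M f u₀ u) {β : Fin n → ℕ} {k : ℕ}
    (hβ : mlen β + 2 * k ≤ M) {s : ℝ} (hs : 0 < s) :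
    wnorm (fun y => ‖(mpow y β : ℂ)‖ₑ) (s ^ k • nonlin f u s : L1 n) ≤
      mass M s (nonlin f u s) := by
  have hφ : AEMeasurable (fun y => ‖nonlin f u s y‖ₑ) := (Lp.aestronglyMeasurable _).enorm
  rw [wnorm_congr (Lp.coeFn_smul (s ^ k) (nonlin f u s)), mass,
    ← lintegral_const_mul' _ _ ENNReal.ofReal_ne_top,
    ← lintegral_add_left' (hφ.const_mul _)]
  refine lintegral_mono fun y => ?_
  rw [← add_mul, ← ENNReal.ofReal_add (by positivity) (by positivity), Pi.smul_apply, enorm_smul,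
    ← mul_assoc]
  refine mul_le_mul_left ?_ _
  dsimp only
  rw [← ofReal_norm, ← ofReal_norm, ← ENNReal.ofReal_mul (norm_nonneg _)]
  apply ENNReal.ofReal_le_ofReal
  rw [Complex.norm_real, Real.norm_eq_abs, norm_pow, Real.norm_eq_abs, abs_of_pos hs, mul_comm]
  refine le_trans ?_ (sqrt_pow_mul_pow_le hs.le (norm_nonneg y) hβ)
  gcongr
  exact abs_mpow_le y β

theorem integrableOn_smul_nonlin (h : DecayingSolution ν p K A M f u₀ u) {k : ℕ}
    (hk : 2 * k ≤ M) : IntegrableOn (fun s : ℝ => s ^ k • nonlin f u s) (Ioi 0) := by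
  refine ⟨?_, ?_⟩
  · exact (continuous_pow k).aestronglyMeasurable.smul
      (h.decay.aestronglyMeasurable_nonlin h.nl)
  · refine (setLIntegral_mono' measurableSet_Ioi fun s hs => ?_).trans_lt
      (lt_top_iff_ne_top.2 h.lintegral_mass_ne_top)
    have h1 := h.wnorm_smul_nonlin_le (β := 0) (k := k) (by simpa [mlen] using hk) hs
    rw [enorm_L1]
    simpa [wnorm, mpow] using h1

theorem lintegral_wnorm_ne_top (h : DecayingSolution ν p K A M f u₀ u) {β : Fin n → ℕ} {k : ℕ}
    (hβ : mlen β + 2 * k ≤ M) :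
    ∫⁻ s in Ioi (0 : ℝ),
      wnorm (fun y => ‖(mpow y β : ℂ)‖ₑ) (s ^ k • nonlin f u s : L1 n) ≠ ∞ :=
  ne_top_of_le_ne_top h.lintegral_mass_ne_top
    (setLIntegral_mono' measurableSet_Ioi fun _ hs => h.wnorm_smul_nonlin_le hβ hs)

theorem integrable_mpow_mul_psi (h : DecayingSolution ν p K A M f u₀ u) {β : Fin n → ℕ} {k : ℕ}
    (hβ : mlen β + 2 * k ≤ M) : Integrable fun y => (mpow y β : ℂ) * psi f u k y := by
  refine integrable_mul_of_wnorm (continuous_mpow β).measurable _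
    (ne_top_of_le_ne_top (h.lintegral_wnorm_ne_top hβ) ?_)
  exact wnorm_integral_le (continuous_mpow β).measurable.enorm
    (h.integrableOn_smul_nonlin (by omega))

theorem moment_psi (h : DecayingSolution ν p K A M f u₀ u) {β : Fin n → ℕ} {k : ℕ}
    (hβ : mlen β + 2 * k ≤ M) :
    IntegrableOn (fun s : ℝ => (s : ℂ) ^ k * moment β (nonlin f u s)) (Ioi 0) ∧
      moment β (psi f u k) = ∫ s in Ioi (0 : ℝ), (s : ℂ) ^ k * moment β (nonlin f u s) := by
  obtain ⟨h1, h2⟩ := integrable_pairing (continuous_mpow β).measurable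
    (h.integrableOn_smul_nonlin (k := k) (by omega)) (h.lintegral_wnorm_ne_top hβ)
  have e : ∀ s : ℝ, (1 / (mfact β : ℂ)) *
      (∫ y, (mpow y β : ℂ) * (s ^ k • nonlin f u s : L1 n) y) =
      (s : ℂ) ^ k * moment β (nonlin f u s) := by
    intro s
    have : ∫ y, (mpow y β : ℂ) * (s ^ k • nonlin f u s : L1 n) y =
        (s : ℂ) ^ k * ∫ y, (mpow y β : ℂ) * nonlin f u s y := by
      rw [← integral_const_mul]
      refine integral_congr_ae ?_
      filter_upwards [Lp.coeFn_smul (s ^ k) (nonlin f u s)] with y hy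
      rw [hy, Pi.smul_apply, Complex.real_smul]
      push_cast
      ring
    rw [this, moment]
    ring
  constructor
  · refine (h1.const_mul (1 / (mfact β : ℂ))).congr (Eventually.of_forall fun s => e s)
  · rw [moment, psi, h2, ← integral_const_mul]
    exact integral_congr_ae (Eventually.of_forall fun s => e s)

/-- The coefficients of the profile in terms of the moments of the source. -/
theorem fullCoeff_eq (h : DecayingSolution ν p K A M f u₀ u) {κ : Fin n → ℕ}
    (hκ : mlen κ ≤ M) :
    IntegrableOn (fun s : ℝ => momentAt ν κ s (nonlin f u s)) (Ioi 0) ∧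
      (-1) ^ mlen κ * fullCoeff ν f u₀ u κ =
        momentAt ν κ 0 u₀ + ∫ s in Ioi (0 : ℝ), momentAt ν κ s (nonlin f u s) := by
  have e : ∀ s ∈ Ioi (0 : ℝ), momentAt ν κ s (nonlin f u s) =
      (-1) ^ mlen κ * ∑ γ ∈ halfBox κ, (-ν) ^ mlen γ / (mfact γ : ℂ) *
        ((s : ℂ) ^ mlen γ * moment (κ - 2 • γ) (nonlin f u s)) := fun s hs =>
    momentAt_eq ν hκ s (h.integrable_nonlin s) (h.moments_nonlin hs)
  have hm : ∀ γ ∈ halfBox κ, mlen (κ - 2 • γ) + 2 * mlen γ ≤ M := fun γ hγ => by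
    rw [mlen_of_mem_halfBox hγ]; exact hκ
  have hI : ∀ γ ∈ halfBox κ, IntegrableOn (fun s : ℝ => (-ν) ^ mlen γ / (mfact γ : ℂ) *
      ((s : ℂ) ^ mlen γ * moment (κ - 2 • γ) (nonlin f u s))) (Ioi 0) := fun γ hγ =>
    (h.moment_psi (hm γ hγ)).1.const_mul _
  constructor
  · refine IntegrableOn.congr_fun ?_ (fun s hs => (e s hs).symm) measurableSet_Ioi
    exact (integrable_finsetSum _ hI).const_mul _
  · rw [setIntegral_congr_fun measurableSet_Ioi e, integral_const_mul,
      integral_finsetSum _ hI, momentAt_zero ν hκ h.integrable h.moments, fullCoeff, mul_add]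
    congr 2
    refine Finset.sum_congr rfl fun γ hγ => ?_
    rw [integral_const_mul, (h.moment_psi (hm γ hγ)).2]

end DecayingSolution

/-! ### Norms of the rescaled terms and of the Duhamel integrand. -/

theorem decayExp_one : decayExp n 1 = 0 := by simp [decayExp]

theorem decayExp_top : decayExp n ∞ = (n : ℝ) / 2 := by simp [decayExp]

theorem continuous_dilation (t : ℝ) {g : Rn n → ℂ} (hg : Continuous g) :
    Continuous (dilation t g) :=
  continuous_const.mul (hg.comp (continuous_const_smul _))

/-- Change of variables. For q = ∞ the exponent `(1 / q).toReal` of the Jacobian is 0, so one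
formula covers every q. -/
theorem eLpNorm_dilation {t : ℝ} (ht : 0 < t) {g : Rn n → ℂ} (hg : Continuous g)
    (q : ℝ≥0∞) : eLpNorm (dilation t g) q volume =
      ENNReal.ofReal (t ^ (-decayExp n q)) * eLpNorm g q volume := by
  set r := t ^ (-(1 : ℝ) / 2) with hr
  have hr0 : 0 < r := Real.rpow_pos_of_pos ht _
  have hJ : |(r ^ Module.finrank ℝ (Rn n))⁻¹| = t ^ ((n : ℝ) / 2) := by
    rw [finrank_euclideanSpace_fin, abs_of_pos (by positivity), hr, rpow_neg_half_pow ht,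
      ← Real.rpow_neg ht.le]
    congr 1; ring
  have hmap := Measure.map_addHaar_smul (volume : Measure (Rn n)) hr0.ne'
  rw [hJ] at hmap
  have h1 : eLpNorm (fun x => g (r • x)) q volume =
      ENNReal.ofReal (t ^ ((n : ℝ) / 2)) ^ (1 / q).toReal * eLpNorm g q volume := by
    have := eLpNorm_map_measure (p := q) (g := g) (f := fun x : Rn n => r • x) (μ := volume)
      hg.aestronglyMeasurable (continuous_const_smul r).aemeasurable
    rw [hmap, eLpNorm_smul_measure_of_ne_zero (by
      rw [Ne, ENNReal.ofReal_eq_zero, not_le]; positivity)] at this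
    rw [← smul_eq_mul]
    exact this.symm
  have h2 : dilation t g = ((t ^ (-(n : ℝ) / 2) : ℝ) : ℂ) • fun x => g (r • x) := rfl
  rw [h2, eLpNorm_const_smul, h1, ← mul_assoc, ← ofReal_norm, Complex.norm_real,
    Real.norm_eq_abs, abs_of_pos (by positivity), ENNReal.ofReal_rpow_of_pos (by positivity),
    ← ENNReal.ofReal_mul (by positivity), ← Real.rpow_mul ht.le, ← Real.rpow_add ht]
  congr 3
  rw [decayExp, one_div]; ring

theorem memLp_dgauss {ν : ℂ} (hν : 0 < ν.re) (κ : Fin n → ℕ) {q : ℝ≥0∞} :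
    q = 1 ∨ q = ∞ → MemLp (dgauss ν κ) q volume := by
  obtain ⟨C, hC, h⟩ := exists_norm_dgauss_le hν κ
  have hm := (continuous_dgauss ν κ).aestronglyMeasurable (μ := (volume : Measure (Rn n)))
  have hr := rate_pos hν
  rintro (rfl | rfl)
  · have hI : Integrable (fun ξ : Rn n => C * Real.exp (-rate ν * ‖ξ‖ ^ 2)) := by
      refine Integrable.const_mul ?_ C
      have := GaussianFourier.integrable_cexp_neg_mul_sq_norm_add (b := (rate ν : ℂ))
        (by simpa using hr) 0 (0 : Rn n)
      refine this.norm.congr (Eventually.of_forall fun ξ => ?_)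
      simp only [Complex.norm_exp]
      congr 1
      simp [← Complex.ofReal_pow]
    exact memLp_one_iff_integrable.2 (hI.mono' hm (Eventually.of_forall h))
  · refine memLp_top_of_bound (C := C) hm (Eventually.of_forall fun ξ => (h ξ).trans ?_)
    refine mul_le_of_le_one_right hC (Real.exp_le_one_iff.2 ?_)
    nlinarith [sq_nonneg ‖ξ‖]

theorem profTerm_eq (ν : ℂ) (κ : Fin n → ℕ) (t : ℝ) :
    profTerm ν κ t = ((t ^ (-(mlen κ : ℝ) / 2) : ℝ) : ℂ) • dilation t (dgauss ν κ) := rfl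

theorem eLpNorm_profTerm (ν : ℂ) (κ : Fin n → ℕ) {t : ℝ} (ht : 0 < t) (q : ℝ≥0∞) :
    eLpNorm (profTerm ν κ t) q volume = ENNReal.ofReal (t ^ (-(mlen κ : ℝ) / 2)) *
      (ENNReal.ofReal (t ^ (-decayExp n q)) * eLpNorm (dgauss ν κ) q volume) := by
  rw [profTerm_eq, eLpNorm_const_smul, eLpNorm_dilation ht (continuous_dgauss ν κ),
    ← ofReal_norm, Complex.norm_real, Real.norm_eq_abs, abs_of_pos (by positivity)]

theorem memLp_profTerm {ν : ℂ} (hν : 0 < ν.re) (κ : Fin n → ℕ) {t : ℝ} (ht : 0 < t) :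
    MemLp (profTerm ν κ t) 1 volume := by
  refine ⟨?_, ?_⟩
  · rw [profTerm_eq]
    exact ((continuous_dilation t (continuous_dgauss ν κ)).const_smul _).aestronglyMeasurable
  · rw [eLpNorm_profTerm ν κ ht]
    exact ENNReal.mul_lt_top ENNReal.ofReal_lt_top (ENNReal.mul_lt_top ENNReal.ofReal_lt_top
      (memLp_dgauss hν κ (Or.inl rfl)).2)

theorem coeFn_sub_sum (u : L1 n) {ι : Type*} (S : Finset ι) (c : ι → ℂ) {g : ι → Rn n → ℂ}
    (hg : ∀ κ, MemLp (g κ) 1 volume) :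
    (u - ∑ κ ∈ S, c κ • toL1 (g κ) : L1 n) =ᵐ[volume] fun x => u x - ∑ κ ∈ S, c κ * g κ x := by
  have h2 : ∀ κ ∈ S, ∀ᵐ x, (c κ • toL1 (g κ) : L1 n) x = c κ * g κ x := fun κ _ => by
    filter_upwards [Lp.coeFn_smul (c κ) (toL1 (g κ)), coeFn_toL1 (hg κ)] with x e1 e2
    rw [e1, Pi.smul_apply, e2, smul_eq_mul]
  filter_upwards [Lp.coeFn_sub u (∑ κ ∈ S, c κ • toL1 (g κ)),
    (Filter.eventually_all_finset S).2 h2, Lp.coeFn_finsetSum S fun κ => c κ • toL1 (g κ)]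
    with x e1 e3 e4
  rw [e1, Pi.sub_apply, e4, Finset.sum_apply]
  congr 1
  exact Finset.sum_congr rfl e3

theorem coeFn_toL1_sub_sum {ν : ℂ} (hν : 0 < ν.re) (N : ℕ) {t : ℝ} (ht : 0 < t) (s : ℝ)
    {φ : Rn n → ℂ} (hφ : MemLp φ 1 volume) :
    (toL1 (semigroup ν (t - s) φ) - ∑ κ ∈ lowIdx n N, momentAt ν κ s φ • toL1 (profTerm ν κ t) :
      L1 n) =ᵐ[volume] expErr ν N t s φ := by
  filter_upwards [coeFn_toL1 (memLp_semigroup hν (t - s) hφ),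
    coeFn_sub_sum (toL1 (semigroup ν (t - s) φ)) (lowIdx n N) (fun κ => momentAt ν κ s φ)
      fun κ => memLp_profTerm hν κ ht] with x e1 e2
  rw [e2, e1, expErr]

theorem eLpNorm_Lp_add_le {q : ℝ≥0∞} (hq : 1 ≤ q) (φ ψ : L1 n) :
    eLpNorm (φ + ψ : L1 n) q volume ≤ eLpNorm φ q volume + eLpNorm ψ q volume := by
  rw [eLpNorm_congr_ae (Lp.coeFn_add φ ψ)]
  exact eLpNorm_add_le (Lp.aestronglyMeasurable _) (Lp.aestronglyMeasurable _) hq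

theorem eLpNorm_Lp_sub_le {q : ℝ≥0∞} (hq : 1 ≤ q) (φ ψ : L1 n) :
    eLpNorm (φ - ψ : L1 n) q volume ≤ eLpNorm φ q volume + eLpNorm ψ q volume := by
  rw [eLpNorm_congr_ae (Lp.coeFn_sub φ ψ)]
  exact eLpNorm_sub_le (Lp.aestronglyMeasurable _) (Lp.aestronglyMeasurable _) hq

theorem eLpNorm_Lp_sum_smul_le {q : ℝ≥0∞} (hq : 1 ≤ q) {ι : Type*} (S : Finset ι) (c : ι → ℂ)
    (T : ι → L1 n) :
    eLpNorm (∑ κ ∈ S, c κ • T κ : L1 n) q volume ≤ ∑ κ ∈ S, ‖c κ‖ₑ * eLpNorm (T κ) q volume := by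
  classical
  induction S using Finset.induction_on with
  | empty =>
    rw [Finset.sum_empty, Finset.sum_empty, eLpNorm_congr_ae (Lp.coeFn_zero _ _ _), eLpNorm_zero]
  | insert a S ha ih =>
    rw [Finset.sum_insert ha, Finset.sum_insert ha]
    refine (eLpNorm_Lp_add_le hq _ _).trans (add_le_add (le_of_eq ?_) ih)
    rw [eLpNorm_congr_ae (Lp.coeFn_smul (c a) (T a)), eLpNorm_const_smul]

theorem eLpNorm_integral_le {q : ℝ≥0∞} (hq : q = 1 ∨ q = ∞) {S : Type*} [MeasurableSpace S]
    {μ : Measure S} {Φ : S → L1 n} (hΦ : Integrable Φ μ) :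
    eLpNorm (∫ s, Φ s ∂μ : L1 n) q volume ≤ ∫⁻ s, eLpNorm (Φ s) q volume ∂μ := by
  rcases hq with rfl | rfl
  · exact eLpNorm_one_integral_le Φ
  · exact eLpNorm_top_integral_le hΦ

theorem exists_eLpNorm_expErr_le {ν : ℂ} (hν : 0 < ν.re) (N : ℕ) {q : ℝ≥0∞}
    (hq : q = 1 ∨ q = ∞) :
    ∃ C : ℝ, 0 ≤ C ∧ ∀ t s : ℝ, 0 < t → 0 ≤ s → s ≤ t / 2 → ∀ φ : Rn n → ℂ, Integrable φ →
      ∫⁻ y, ENNReal.ofReal (‖y‖ ^ N) * ‖φ y‖ₑ ≠ ∞ →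
      eLpNorm (expErr ν N t s φ) q volume ≤
        ENNReal.ofReal C * ENNReal.ofReal (t ^ (-(N : ℝ) / 2) * t ^ (-decayExp n q)) *
          errMass N t s φ := by
  obtain ⟨C, hC, h⟩ := exists_expErr_bounds (n := n) hν N
  refine ⟨C, hC, fun t s ht hs hst φ hφ hφN => ?_⟩
  obtain ⟨h1, h2⟩ := h t s ht hs hst φ hφ hφN
  rw [← ENNReal.ofReal_mul hC]
  rcases hq with rfl | rfl
  · simpa [decayExp_one] using h1
  · rw [decayExp_top, ← neg_div, ← mul_assoc]
    exact h2

/-- No smoothing is used: the semigroup is bounded on L¹ and on L^∞, and the source itself has the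
decay required in each. The bound therefore has no singularity as s → t. -/
theorem exists_eLpNorm_duhamel_le {ν : ℂ} (hν : 0 < ν.re) {p K A : ℝ} {f : ℂ → ℂ} {u : ℝ → L1 n}
    (hf : PowerNonlinearity p K f) (hu : FreeDecay u A) {q : ℝ≥0∞} (hq : q = 1 ∨ q = ∞) :
    ∃ C : ℝ, 0 ≤ C ∧ ∀ t s : ℝ, 0 < s → s < t →
      eLpNorm (duhamel ν f u t s) q volume ≤
        ENNReal.ofReal C * ENNReal.ofReal
          ((1 + s) ^ (-((n : ℝ) / 2 * (p - 1)) + -decayExp n q)) := by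
  obtain ⟨C, hC, h⟩ := exists_semigroup_bounds (n := n) hν
  have hA := hu.nonneg
  have hK := hf.pos
  refine ⟨C * (K * A ^ (p - 1) * A), by positivity, fun t s hs hst => ?_⟩
  obtain ⟨h1, h2⟩ := h (t - s) (by linarith) _ (Lp.aestronglyMeasurable (nonlin f u s))
  have hs1 : 0 < 1 + s := by linarith
  rw [eLpNorm_congr_ae (coeFn_duhamel hν f u t s), ENNReal.ofReal_mul hC, mul_assoc,
    ← ENNReal.ofReal_mul (p := K * A ^ (p - 1) * A) (by positivity)]
  rcases hq with rfl | rfl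
  · refine h1.trans (mul_le_mul_right ?_ _)
    rw [eLpNorm_one_eq_lintegral_enorm, decayExp_one, neg_zero, add_zero]
    exact hu.lintegral_nonlin_le hf hs
  · refine h2.trans (mul_le_mul_right ?_ _)
    rw [decayExp_top, ← neg_div]
    exact hu.eLpNorm_top_nonlin_le hf hs

theorem pow_le_modulus {r : ℝ} (hr : 1 / 2 ≤ r) {k M : ℕ} (hk : k ≤ M) :
    r ^ k ≤ 2 ^ (M + 1) * modulus M r := by
  have h1 : 1 / 2 ≤ min 1 r := le_min (by norm_num) hr
  have h2 : (2 * r) ^ k ≤ (2 * r) ^ M := pow_le_pow_right₀ (by linarith) hk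
  have h3 : r ^ k ≤ (2 * r) ^ k := pow_le_pow_left₀ (by linarith) (by linarith) k
  calc r ^ k ≤ (2 * r) ^ M := h3.trans h2
    _ = 2 ^ (M + 1) * (r ^ M * (1 / 2)) := by rw [mul_pow, pow_succ]; ring
    _ ≤ _ := by
      unfold modulus
      gcongr

/-- For late times the moments are controlled by the error mass. -/
theorem enorm_momentAt_le (ν : ℂ) {M : ℕ} {κ : Fin n → ℕ} (hκ : mlen κ ≤ M) {t s : ℝ}
    (ht : 0 < t) (hs : t / 2 ≤ s) {φ : Rn n → ℂ} (hφ : AEStronglyMeasurable φ volume) :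
    ENNReal.ofReal (t ^ (-(mlen κ : ℝ) / 2)) * ‖momentAt ν κ s φ‖ₑ ≤
      ENNReal.ofReal (((mlen κ + 1) * (1 + ‖ν‖) ^ mlen κ) ^ n * 2 ^ (M + 1)) *
        (ENNReal.ofReal (t ^ (-(M : ℝ) / 2)) * errMass M t s φ) := by
  set D : ℝ := ((mlen κ + 1) * (1 + ‖ν‖) ^ mlen κ) ^ n with hD
  have hD0 : 0 ≤ D := by positivity
  have hs0 : 0 ≤ s := by linarith
  set a := t ^ (-(1 : ℝ) / 2) with ha
  have ha0 : 0 < a := by positivity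
  -- Late times have parabolic radius √(s/t) ≥ 1/√2, where `modulus` is comparable to the power r^M.
  have hsa : 1 / 2 ≤ a * √s := by
    have e : (a * √s) ^ 2 = s / t := by
      rw [mul_pow, Real.sq_sqrt hs0, ha, rpow_neg_half_sq ht]; ring
    have h2 : 1 / 2 ≤ s / t := by rw [le_div_iff₀ ht]; linarith
    have := Real.sqrt_nonneg s
    nlinarith [mul_nonneg ha0.le this]
  have hpt : ∀ y : Rn n, t ^ (-(mlen κ : ℝ) / 2) * ‖heatCoeff ν κ s y‖ ≤
      D * 2 ^ (M + 1) * (t ^ (-(M : ℝ) / 2) * (tmod M t √s + tmod M t ‖y‖)) := by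
    intro y
    have h1 := norm_heatCoeff_le ν κ (ρ := max √s ‖y‖) (le_max_of_le_right (norm_nonneg _)) hs0
      (by
        calc s = √s ^ 2 := (Real.sq_sqrt hs0).symm
          _ ≤ _ := by gcongr; exact le_max_left _ _) (le_max_right √s ‖y‖)
    have h2 : 1 / 2 ≤ a * max √s ‖y‖ :=
      hsa.trans (by gcongr; exact le_max_left _ _)
    calc _ ≤ t ^ (-(mlen κ : ℝ) / 2) * (D * max √s ‖y‖ ^ mlen κ) := by gcongr
      _ = D * (a * max √s ‖y‖) ^ mlen κ := by rw [mul_pow, ha, rpow_neg_half_pow ht]; ring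
      _ ≤ D * (2 ^ (M + 1) * modulus M (a * max √s ‖y‖)) := by
          gcongr; exact pow_le_modulus h2 hκ
      _ ≤ D * (2 ^ (M + 1) * (modulus M (a * √s) + modulus M (a * ‖y‖))) := by
          gcongr
          rw [mul_max_of_nonneg _ _ ha0.le]
          exact modulus_max_le M (by positivity) (by positivity)
      _ = _ := by rw [modulus_scale M ht, modulus_scale M ht]; ring
  rw [momentAt, errMass]
  calc _ ≤ ENNReal.ofReal (t ^ (-(mlen κ : ℝ) / 2)) * ∫⁻ y, ‖heatCoeff ν κ s y * φ y‖ₑ :=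
        mul_le_mul_right (enorm_integral_le_lintegral_enorm _) _
    _ = ∫⁻ y, ENNReal.ofReal (t ^ (-(mlen κ : ℝ) / 2)) * ‖heatCoeff ν κ s y * φ y‖ₑ :=
        (lintegral_const_mul' _ _ ENNReal.ofReal_ne_top).symm
    _ ≤ ∫⁻ y, (ENNReal.ofReal (D * 2 ^ (M + 1)) * ENNReal.ofReal (t ^ (-(M : ℝ) / 2))) *
          (ENNReal.ofReal (tmod M t √s) * ‖φ y‖ₑ + ENNReal.ofReal (tmod M t ‖y‖) * ‖φ y‖ₑ) := by
        refine lintegral_mono fun y => ?_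
        have hn1 := tmod_nonneg (N := M) ht (Real.sqrt_nonneg s)
        have hn2 := tmod_nonneg (N := M) ht (norm_nonneg y)
        rw [enorm_mul, ← mul_assoc, ← add_mul, ← ENNReal.ofReal_add hn1 hn2, ← mul_assoc,
          ← ENNReal.ofReal_mul (by positivity), ← ENNReal.ofReal_mul (by positivity),
          ← ofReal_norm (heatCoeff ν κ s y), ← ENNReal.ofReal_mul (by positivity)]
        refine mul_le_mul_left (ENNReal.ofReal_le_ofReal ((hpt y).trans_eq ?_)) _
        ring
    _ = _ := by
        rw [lintegral_const_mul' _ _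
          (ENNReal.mul_ne_top ENNReal.ofReal_ne_top ENNReal.ofReal_ne_top),
          lintegral_add_left' (hφ.enorm.const_mul _),
          lintegral_const_mul' _ _ ENNReal.ofReal_ne_top, mul_assoc]

/-! ### The distance from the solution to its profile. -/

/-- The total error at time `t` of the expansion of order `M`. -/
def totalErr (M : ℕ) (θ t : ℝ) (f : ℂ → ℂ) (u₀ : Rn n → ℂ) (u : ℝ → L1 n) : ℝ≥0∞ :=
  errMass M t 0 u₀ + (∫⁻ s in Ioi (0 : ℝ), errMass M t s (nonlin f u s)) +
    ENNReal.ofReal (t ^ ((M : ℝ) / 2 + 1 - θ))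

namespace DecayingSolution

variable {ν : ℂ} {p K A : ℝ} {M : ℕ} {f : ℂ → ℂ} {u₀ : Rn n → ℂ} {u : ℝ → L1 n}

/-- The time integrals in the coefficients are cut at t/2. The early part is subtracted under the
Duhamel integral, where the expansion is accurate; the late Duhamel integral and the tail of the
moments are estimated separately. -/
theorem sub_sum_eq (h : DecayingSolution ν p K A M f u₀ u) (T : (Fin n → ℕ) → L1 n)
    {t : ℝ} (ht : 0 < t) :
    u t - ∑ κ ∈ lowIdx n M, ((-1) ^ mlen κ * fullCoeff ν f u₀ u κ) • T κ =
      (toL1 (semigroup ν (t - 0) u₀) - ∑ κ ∈ lowIdx n M, momentAt ν κ 0 u₀ • T κ) +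
      (∫ s in Ioc 0 (t / 2), (duhamel ν f u t s -
        ∑ κ ∈ lowIdx n M, momentAt ν κ s (nonlin f u s) • T κ)) +
      (∫ s in Ioc (t / 2) t, duhamel ν f u t s) -
      ∑ κ ∈ lowIdx n M, (∫ s in Ioi (t / 2), momentAt ν κ s (nonlin f u s)) • T κ := by
  obtain ⟨hint, heq⟩ := h.mild t ht
  have hint' := (intervalIntegrable_iff_integrableOn_Ioc_of_le ht.le).1 hint
  have hI : ∀ κ ∈ lowIdx n M,
      IntegrableOn (fun s => momentAt ν κ s (nonlin f u s)) (Ioi 0) := fun κ hκ =>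
    (h.fullCoeff_eq (mem_lowIdx.1 hκ)).1
  have hs1 : Ioc 0 (t / 2) ⊆ Ioc 0 t := Ioc_subset_Ioc_right (by linarith)
  have hs2 : Ioc (t / 2) t ⊆ Ioc 0 t := Ioc_subset_Ioc_left (by linarith)
  have hs3 : Ioc 0 (t / 2) ⊆ Ioi (0 : ℝ) := Ioc_subset_Ioi_self
  have hs4 : Ioi (t / 2) ⊆ Ioi (0 : ℝ) := Ioi_subset_Ioi (by linarith)
  have e1 : ∫ s in Ioc 0 t, duhamel ν f u t s =
      (∫ s in Ioc 0 (t / 2), duhamel ν f u t s) + ∫ s in Ioc (t / 2) t, duhamel ν f u t s := by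
    rw [← setIntegral_union (Ioc_disjoint_Ioc_of_le le_rfl) measurableSet_Ioc
      (hint'.mono_set hs1) (hint'.mono_set hs2), Ioc_union_Ioc_eq_Ioc (by linarith) (by linarith)]
  have e2 : ∑ κ ∈ lowIdx n M, ((-1) ^ mlen κ * fullCoeff ν f u₀ u κ) • T κ =
      ∑ κ ∈ lowIdx n M, (momentAt ν κ 0 u₀ • T κ +
        ((∫ s in Ioc 0 (t / 2), momentAt ν κ s (nonlin f u s)) • T κ +
        (∫ s in Ioi (t / 2), momentAt ν κ s (nonlin f u s)) • T κ)) := by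
    refine Finset.sum_congr rfl fun κ hκ => ?_
    rw [(h.fullCoeff_eq (mem_lowIdx.1 hκ)).2, ← add_smul, ← add_smul,
      ← setIntegral_union Ioc_disjoint_Ioi_same measurableSet_Ioi
        ((hI κ hκ).mono_set hs3) ((hI κ hκ).mono_set hs4),
      Ioc_union_Ioi_eq_Ioi (by linarith)]
  have e3 : ∫ s in Ioc 0 (t / 2), (duhamel ν f u t s -
        ∑ κ ∈ lowIdx n M, momentAt ν κ s (nonlin f u s) • T κ) =
      (∫ s in Ioc 0 (t / 2), duhamel ν f u t s) - ∑ κ ∈ lowIdx n M,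
        (∫ s in Ioc 0 (t / 2), momentAt ν κ s (nonlin f u s)) • T κ := by
    have hI2 : ∀ κ ∈ lowIdx n M, Integrable (fun s => momentAt ν κ s (nonlin f u s) • T κ)
        (volume.restrict (Ioc 0 (t / 2))) := fun κ hκ => ((hI κ hκ).mono_set hs3).smul_const _
    rw [integral_sub (hint'.mono_set hs1) (integrable_finsetSum _ hI2),
      integral_finsetSum _ hI2]
    congr 1
    exact Finset.sum_congr rfl fun κ _ => integral_smul_const _ _
  rw [heq, intervalIntegral.integral_of_le ht.le, e1, e2, e3, sub_zero, Finset.sum_add_distrib,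
    Finset.sum_add_distrib]
  abel

theorem integrable_duhamel_sub (h : DecayingSolution ν p K A M f u₀ u)
    (T : (Fin n → ℕ) → L1 n) {t : ℝ} (ht : 0 < t) :
    IntegrableOn (fun s => duhamel ν f u t s -
        ∑ κ ∈ lowIdx n M, momentAt ν κ s (nonlin f u s) • T κ) (Ioc 0 (t / 2)) := by
  refine Integrable.sub ?_ (integrable_finsetSum _ fun κ hκ => ?_)
  · exact ((intervalIntegrable_iff_integrableOn_Ioc_of_le ht.le).1 (h.mild t ht).1).mono_set
      (Ioc_subset_Ioc_right (by linarith))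
  · exact ((h.fullCoeff_eq (mem_lowIdx.1 hκ)).1.mono_set Ioc_subset_Ioi_self).smul_const _

/-- An interval of length t/2 times an integrand O(t^(-θ-d)), with θ = n(p-1)/2 and d the decay
exponent of the norm; relative to t^(-M/2-d) this gains the negative power t^(M/2+1-θ). -/
theorem exists_late_duhamel_le (h : DecayingSolution ν p K A M f u₀ u) {q : ℝ≥0∞}
    (hq : q = 1 ∨ q = ∞) :
    ∃ C : ℝ≥0∞, C ≠ ∞ ∧ ∀ t : ℝ, 0 < t →
      eLpNorm (∫ s in Ioc (t / 2) t, duhamel ν f u t s : L1 n) q volume ≤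
        C * ENNReal.ofReal (t ^ (-(M : ℝ) / 2) * t ^ (-decayExp n q)) *
          ENNReal.ofReal (t ^ ((M : ℝ) / 2 + 1 - (n : ℝ) / 2 * (p - 1))) := by
  obtain ⟨C, hC, hD⟩ := exists_eLpNorm_duhamel_le h.re_pos h.nl h.decay hq
  have hexp := h.exponent
  have hM0 : (0 : ℝ) ≤ (M : ℝ) / 2 := by positivity
  set θ := (n : ℝ) / 2 * (p - 1)
  set d := decayExp n q with hd
  have hd0 : 0 ≤ d := by
    rcases hq with rfl | rfl
    · rw [hd, decayExp_one]
    · rw [hd, decayExp_top]; positivity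
  refine ⟨ENNReal.ofReal (C * (1 / 2) ^ (1 - θ + -d)), ENNReal.ofReal_ne_top, fun t ht => ?_⟩
  have hh : 0 < t / 2 := by linarith
  have hI : IntegrableOn (duhamel ν f u t) (Ioc (t / 2) t) :=
    ((intervalIntegrable_iff_integrableOn_Ioc_of_le ht.le).1 (h.mild t ht).1).mono_set
      (Ioc_subset_Ioc_left hh.le)
  refine (eLpNorm_integral_le hq hI).trans ?_
  rw [setLIntegral_congr Ioo_ae_eq_Ioc.symm]
  calc _ ≤ ∫⁻ s in Ioo (t / 2) t, ENNReal.ofReal C * ENNReal.ofReal ((t / 2) ^ (-θ + -d)) := by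
        refine setLIntegral_mono' measurableSet_Ioo fun s hs => ?_
        refine (hD t s (by linarith [hs.1]) hs.2).trans
          (mul_le_mul_right (ENNReal.ofReal_le_ofReal ?_) _)
        exact Real.rpow_le_rpow_of_nonpos hh (by linarith [hs.1]) (by linarith)
    _ = _ := by
        rw [setLIntegral_const, Real.volume_Ioo, ← ENNReal.ofReal_mul hC,
          ← ENNReal.ofReal_mul (by positivity), ← ENNReal.ofReal_mul (by positivity),
          ← ENNReal.ofReal_mul (by positivity)]
        congr 1
        have e : t - t / 2 = (t / 2) ^ (1 : ℝ) := by rw [Real.rpow_one]; ring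
        rw [e, mul_assoc C, ← Real.rpow_add hh, mul_assoc C, mul_assoc C, ← Real.rpow_add ht,
          mul_assoc ((1 / 2 : ℝ) ^ _), ← Real.rpow_add ht, div_eq_mul_one_div,
          Real.mul_rpow ht.le (by norm_num), mul_comm (t ^ _)]
        congr 3 <;> ring

/-- The distance of the solution to the profile of order `M`, in `L¹` and `L^∞`. -/
theorem exists_eLpNorm_sub_profile_le (h : DecayingSolution ν p K A M f u₀ u) {q : ℝ≥0∞}
    (hq : q = 1 ∨ q = ∞) :
    ∃ C : ℝ≥0∞, C ≠ ∞ ∧ ∀ t : ℝ, 0 < t →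
      eLpNorm (fun x => u t x - profile ν f u₀ u M t x) q volume ≤
        C * ENNReal.ofReal (t ^ (-(M : ℝ) / 2) * t ^ (-decayExp n q)) *
          totalErr M ((n : ℝ) / 2 * (p - 1)) t f u₀ u := by
  obtain ⟨C₁, hC₁, h1⟩ := exists_eLpNorm_expErr_le (n := n) h.re_pos M hq
  obtain ⟨C₂, hC₂, h2⟩ := h.exists_late_duhamel_le hq
  have hq1 : 1 ≤ q := by rcases hq with rfl | rfl <;> simp
  set G : (Fin n → ℕ) → ℝ≥0∞ := fun κ => eLpNorm (dgauss ν κ) q volume *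
    ENNReal.ofReal (((mlen κ + 1) * (1 + ‖ν‖) ^ mlen κ) ^ n * 2 ^ (M + 1)) with hG
  have hGfin : ∑ κ ∈ lowIdx n M, G κ ≠ ∞ := ENNReal.sum_ne_top.2 fun κ _ =>
    ENNReal.mul_ne_top (memLp_dgauss h.re_pos κ hq).2.ne ENNReal.ofReal_ne_top
  refine ⟨ENNReal.ofReal C₁ + C₂ + ∑ κ ∈ lowIdx n M, G κ, ENNReal.add_ne_top.2
    ⟨ENNReal.add_ne_top.2 ⟨ENNReal.ofReal_ne_top, hC₂⟩, hGfin⟩, fun t ht => ?_⟩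
  set R := ENNReal.ofReal (t ^ (-(M : ℝ) / 2) * t ^ (-decayExp n q)) with hR
  set T : (Fin n → ℕ) → L1 n := fun κ => toL1 (profTerm ν κ t)
  set E₀ := errMass M t 0 u₀
  set E₁ := ∫⁻ s in Ioi (0 : ℝ), errMass M t s (nonlin f u s)
  have hh : 0 < t / 2 := by linarith
  have hV : (fun x => u t x - profile ν f u₀ u M t x) =ᵐ[volume]
      (u t - ∑ κ ∈ lowIdx n M, ((-1) ^ mlen κ * fullCoeff ν f u₀ u κ) • T κ : L1 n) := by
    filter_upwards [coeFn_sub_sum (u t) (lowIdx n M)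
      (fun κ => (-1) ^ mlen κ * fullCoeff ν f u₀ u κ)
      fun κ => memLp_profTerm h.re_pos κ ht] with x hx
    rw [hx, profile_eq ν f u₀ u M ht]
  rw [eLpNorm_congr_ae hV, h.sub_sum_eq T ht]
  have b0 : eLpNorm (toL1 (semigroup ν (t - 0) u₀) -
      ∑ κ ∈ lowIdx n M, momentAt ν κ 0 u₀ • T κ : L1 n) q volume ≤ ENNReal.ofReal C₁ * R * E₀ := by
    rw [eLpNorm_congr_ae (coeFn_toL1_sub_sum h.re_pos M ht 0
      (memLp_one_iff_integrable.2 h.integrable))]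
    exact h1 t 0 ht le_rfl hh.le u₀ h.integrable h.moments
  have b1 : eLpNorm (∫ s in Ioc 0 (t / 2), (duhamel ν f u t s -
        ∑ κ ∈ lowIdx n M, momentAt ν κ s (nonlin f u s) • T κ) : L1 n) q volume ≤
      ENNReal.ofReal C₁ * R * E₁ := by
    refine (eLpNorm_integral_le hq (h.integrable_duhamel_sub T ht)).trans ?_
    calc _ ≤ ∫⁻ s in Ioc 0 (t / 2), ENNReal.ofReal C₁ * R * errMass M t s (nonlin f u s) := by
          refine setLIntegral_mono' measurableSet_Ioc fun s hs => ?_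
          rw [duhamel, eLpNorm_congr_ae (coeFn_toL1_sub_sum h.re_pos M ht s (memLp_one_L1 _))]
          exact h1 t s ht hs.1.le hs.2 _ (h.integrable_nonlin s) (h.moments_nonlin hs.1)
      _ = ENNReal.ofReal C₁ * R * ∫⁻ s in Ioc 0 (t / 2), errMass M t s (nonlin f u s) :=
          lintegral_const_mul' _ _ (ENNReal.mul_ne_top ENNReal.ofReal_ne_top ENNReal.ofReal_ne_top)
      _ ≤ _ := mul_le_mul_right (lintegral_mono_set Ioc_subset_Ioi_self) _
  have b2 := h2 t ht
  have b3 : eLpNorm (∑ κ ∈ lowIdx n M,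
      (∫ s in Ioi (t / 2), momentAt ν κ s (nonlin f u s)) • T κ : L1 n) q volume ≤
      (∑ κ ∈ lowIdx n M, G κ) * R * E₁ := by
    refine (eLpNorm_Lp_sum_smul_le hq1 _ _ T).trans ?_
    rw [Finset.sum_mul, Finset.sum_mul]
    refine Finset.sum_le_sum fun κ hκ => ?_
    rw [eLpNorm_congr_ae (coeFn_toL1 (memLp_profTerm h.re_pos κ ht)), eLpNorm_profTerm ν κ ht]
    set g := eLpNorm (dgauss ν κ) q volume
    set B := ENNReal.ofReal (((mlen κ + 1) * (1 + ‖ν‖) ^ mlen κ) ^ n * 2 ^ (M + 1))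
    set w := ENNReal.ofReal (t ^ (-(mlen κ : ℝ) / 2))
    set e := ENNReal.ofReal (t ^ (-decayExp n q))
    -- The tail over s > t/2 needs no cancellation: late moments are dominated by the error mass.
    have hlate : w * ‖∫ s in Ioi (t / 2), momentAt ν κ s (nonlin f u s)‖ₑ ≤
        B * ENNReal.ofReal (t ^ (-(M : ℝ) / 2)) * E₁ := by
      calc _ ≤ w * ∫⁻ s in Ioi (t / 2), ‖momentAt ν κ s (nonlin f u s)‖ₑ :=
            mul_le_mul_right (enorm_integral_le_lintegral_enorm _) _
        _ = ∫⁻ s in Ioi (t / 2), w * ‖momentAt ν κ s (nonlin f u s)‖ₑ :=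
            (lintegral_const_mul' _ _ ENNReal.ofReal_ne_top).symm
        _ ≤ ∫⁻ s in Ioi (t / 2), B * ENNReal.ofReal (t ^ (-(M : ℝ) / 2)) *
              errMass M t s (nonlin f u s) := by
            refine setLIntegral_mono' measurableSet_Ioi fun s hs => ?_
            rw [mul_assoc]
            exact enorm_momentAt_le ν (mem_lowIdx.1 hκ) ht (mem_Ioi.1 hs).le
              (Lp.aestronglyMeasurable _)
        _ = B * ENNReal.ofReal (t ^ (-(M : ℝ) / 2)) *
              ∫⁻ s in Ioi (t / 2), errMass M t s (nonlin f u s) :=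
            lintegral_const_mul' _ _
              (ENNReal.mul_ne_top ENNReal.ofReal_ne_top ENNReal.ofReal_ne_top)
        _ ≤ _ := mul_le_mul_right (lintegral_mono_set (Ioi_subset_Ioi hh.le)) _
    calc _ = (w * ‖∫ s in Ioi (t / 2), momentAt ν κ s (nonlin f u s)‖ₑ) * (e * g) := by ring
      _ ≤ (B * ENNReal.ofReal (t ^ (-(M : ℝ) / 2)) * E₁) * (e * g) := mul_le_mul_left hlate _
      _ = _ := by
        rw [hR, ENNReal.ofReal_mul (by positivity)]
        simp only [hG]
        ring
  refine (eLpNorm_Lp_sub_le hq1 _ _).trans ?_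
  refine (add_le_add ((eLpNorm_Lp_add_le hq1 _ _).trans (add_le_add
    ((eLpNorm_Lp_add_le hq1 _ _).trans (add_le_add b0 b1)) b2)) b3).trans ?_
  rw [totalErr]
  set E₂ := ENNReal.ofReal (t ^ ((M : ℝ) / 2 + 1 - (n : ℝ) / 2 * (p - 1)))
  calc _ = (ENNReal.ofReal C₁ * R) * (E₀ + E₁) + C₂ * R * E₂ +
        (∑ κ ∈ lowIdx n M, G κ) * R * E₁ := by ring
    _ ≤ (ENNReal.ofReal C₁ * R) * (E₀ + E₁ + E₂) + C₂ * R * (E₀ + E₁ + E₂) +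
        (∑ κ ∈ lowIdx n M, G κ) * R * (E₀ + E₁ + E₂) := by
        refine add_le_add (add_le_add (mul_le_mul_right ?_ _) (mul_le_mul_right ?_ _))
          (mul_le_mul_right ?_ _)
        · exact le_self_add
        · exact le_add_self
        · exact le_add_self.trans le_self_add
    _ = _ := by ring

end DecayingSolution

/-! ### Dominated convergence, interpolation and the limit. -/

theorem tmod_le {M : ℕ} {t r : ℝ} (hr : 0 ≤ r) : tmod M t r ≤ r ^ M :=
  mul_le_of_le_one_right (by positivity) (min_le_left _ _)

theorem tendsto_tmod (M : ℕ) (r : ℝ) : Tendsto (fun t => tmod M t r) atTop (𝓝 0) := by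
  have h1 : Tendsto (fun t : ℝ => t ^ (-(1 : ℝ) / 2)) atTop (𝓝 0) := by
    have := tendsto_rpow_neg_atTop (y := 1 / 2) (by norm_num)
    simpa [neg_div] using this
  have h2 : Tendsto (fun t : ℝ => min 1 (t ^ (-(1 : ℝ) / 2) * r)) atTop (𝓝 (min 1 (0 * r))) :=
    tendsto_const_nhds.min (h1.mul_const r)
  have h3 := h2.const_mul (r ^ M)
  simpa [tmod] using h3

theorem tendsto_ofReal_tmod (M : ℕ) (r : ℝ) :
    Tendsto (fun t => ENNReal.ofReal (tmod M t r)) atTop (𝓝 0) := by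
  simpa using ENNReal.tendsto_ofReal (tendsto_tmod M r)

theorem errMass_le_mass (M : ℕ) (t s : ℝ) (φ : Rn n → ℂ) : errMass M t s φ ≤ mass M s φ := by
  rw [errMass, mass]
  refine add_le_add (mul_le_mul_left (ENNReal.ofReal_le_ofReal ?_) _)
    (lintegral_mono fun y => mul_le_mul_left (ENNReal.ofReal_le_ofReal
      (tmod_le (norm_nonneg y))) _)
  exact (tmod_le (Real.sqrt_nonneg s)).trans (by linarith)

/-- The weight tends to 0 pointwise and is dominated by |y|^M, so M moments suffice for a limit
without a rate. -/
theorem tendsto_errMass (M : ℕ) (s : ℝ) {φ : Rn n → ℂ} (hφ : Integrable φ)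
    (hφM : ∫⁻ y, ENNReal.ofReal (‖y‖ ^ M) * ‖φ y‖ₑ ≠ ∞) :
    Tendsto (fun t => errMass M t s φ) atTop (𝓝 0) := by
  have h1 : Tendsto (fun t => ENNReal.ofReal (tmod M t √s) * ∫⁻ y, ‖φ y‖ₑ) atTop (𝓝 0) := by
    simpa using ENNReal.Tendsto.mul_const (tendsto_ofReal_tmod M √s)
      (Or.inr (show ∫⁻ y, ‖φ y‖ₑ ≠ ∞ from hφ.2.ne))
  have h2 : Tendsto (fun t => ∫⁻ y, ENNReal.ofReal (tmod M t ‖y‖) * ‖φ y‖ₑ) atTop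
      (𝓝 (∫⁻ _ : Rn n, 0)) := by
    refine tendsto_lintegral_filter_of_dominated_convergence' _
      (Eventually.of_forall fun t => ?_) (Eventually.of_forall fun t =>
        Eventually.of_forall fun y => mul_le_mul_left (ENNReal.ofReal_le_ofReal
          (tmod_le (norm_nonneg y))) _) hφM ?_
    · exact ((measurable_tmod M t).comp measurable_norm).ennreal_ofReal.aemeasurable.mul
        hφ.1.enorm
    · filter_upwards with y
      simpa using ENNReal.Tendsto.mul_const (tendsto_ofReal_tmod M ‖y‖)
        (Or.inr (enorm_ne_top (x := φ y)))
  simpa [errMass] using h1.add h2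

/-- Interpolation between `L¹` and `L^∞`. -/
theorem eLpNorm_le_of_one_of_top {g : Rn n → ℂ} (hg : AEStronglyMeasurable g volume)
    {X b : ℝ≥0∞} (h1 : eLpNorm g 1 volume ≤ X) (h2 : eLpNorm g ∞ volume ≤ b * X)
    {q : ℝ≥0∞} (hq : 1 ≤ q) :
    eLpNorm g q volume ≤ b ^ (1 - (q⁻¹).toReal) * X := by
  rcases eq_or_ne q ∞ with rfl | hqt
  · simpa using h2
  have hq0 : q ≠ 0 := (zero_lt_one.trans_le hq).ne'
  set r := q.toReal with hr
  have hr1 : 1 ≤ r := by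
    rw [hr, ← ENNReal.toReal_one]; exact ENNReal.toReal_mono hqt hq
  have hr0 : 0 < r := by linarith
  -- Uses |g|^r ≤ ‖g‖_∞^(r-1) |g|.
  have key : ∫⁻ x, ‖g x‖ₑ ^ r ≤ b ^ (r - 1) * X ^ r := by
    calc _ ≤ ∫⁻ x, (b * X) ^ (r - 1) * ‖g x‖ₑ := by
          refine lintegral_mono_ae ?_
          rw [eLpNorm_exponent_top] at h2
          filter_upwards [enorm_ae_le_eLpNormEssSup g volume] with x hx
          calc ‖g x‖ₑ ^ r = ‖g x‖ₑ ^ ((r - 1) + 1) := by rw [sub_add_cancel]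
            _ = ‖g x‖ₑ ^ (r - 1) * ‖g x‖ₑ := by
              rw [ENNReal.rpow_add_of_nonneg _ _ (by linarith) zero_le_one, ENNReal.rpow_one]
            _ ≤ _ := mul_le_mul_left (ENNReal.rpow_le_rpow (hx.trans h2) (by linarith)) _
      _ = (b * X) ^ (r - 1) * eLpNorm g 1 volume := by
          rw [lintegral_const_mul'' _ hg.enorm, eLpNorm_one_eq_lintegral_enorm]
      _ ≤ (b * X) ^ (r - 1) * X := mul_le_mul_right h1 _
      _ = b ^ (r - 1) * X ^ ((r - 1) + 1) := by
          rw [ENNReal.mul_rpow_of_nonneg _ _ (by linarith), ENNReal.rpow_add_of_nonneg _ _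
            (by linarith) zero_le_one, ENNReal.rpow_one, mul_assoc]
      _ = _ := by rw [sub_add_cancel]
  rw [eLpNorm_eq_lintegral_rpow_enorm_toReal hq0 hqt]
  refine (ENNReal.rpow_le_rpow key (by positivity)).trans (le_of_eq ?_)
  rw [ENNReal.mul_rpow_of_nonneg _ _ (by positivity), ← ENNReal.rpow_mul, ← ENNReal.rpow_mul,
    mul_one_div_cancel hr0.ne', ENNReal.rpow_one, ENNReal.toReal_inv]
  congr 2
  rw [← hr]
  field_simp

theorem memLp_topProfile {ν : ℂ} (hν : 0 < ν.re) (f : ℂ → ℂ) (u₀ : Rn n → ℂ) (u : ℝ → L1 n)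
    (N : ℕ) {q : ℝ≥0∞} (hq : 1 ≤ q) : MemLp (topProfile ν f u₀ u N) q volume := by
  have h : ∀ q : ℝ≥0∞, q = 1 ∨ q = ∞ → MemLp (topProfile ν f u₀ u N) q volume := fun q hq =>
    memLp_finsetSum _ fun κ _ => (memLp_dgauss hν κ hq).const_mul _
  refine ⟨(h 1 (Or.inl rfl)).1, ?_⟩
  refine (eLpNorm_le_of_one_of_top (h 1 (Or.inl rfl)).1 (b := 1)
    (X := eLpNorm (topProfile ν f u₀ u N) 1 volume + eLpNorm (topProfile ν f u₀ u N) ∞ volume)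
    le_self_add (by rw [one_mul]; exact le_add_self) hq).trans_lt ?_
  rw [ENNReal.one_rpow, one_mul]
  exact ENNReal.add_lt_top.2 ⟨(h 1 (Or.inl rfl)).2, (h ∞ (Or.inr rfl)).2⟩

theorem eLpNorm_topProfile_ne_zero {ν : ℂ} {f : ℂ → ℂ} {u₀ : Rn n → ℂ} {u : ℝ → L1 n} {N : ℕ}
    (h : ∃ x, topProfile ν f u₀ u N x ≠ 0) {q : ℝ≥0∞} (hq : 1 ≤ q) :
    eLpNorm (topProfile ν f u₀ u N) q volume ≠ 0 := by
  intro h0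
  obtain ⟨x, hx⟩ := h
  have hc := continuous_topProfile ν f u₀ u N
  rw [eLpNorm_eq_zero_iff hc.aestronglyMeasurable (zero_lt_one.trans_le hq).ne'] at h0
  have h1 := (hc.ae_eq_iff_eq volume continuous_zero).1 h0
  exact hx (congrFun h1 x)

theorem continuous_profile (ν : ℂ) (f : ℂ → ℂ) (u₀ : Rn n → ℂ) (u : ℝ → L1 n) (N : ℕ) {t : ℝ}
    (ht : 0 < t) : Continuous (profile ν f u₀ u N t) := by
  rw [funext fun x => profile_eq ν f u₀ u N ht x]
  refine continuous_finsetSum _ fun κ _ => continuous_const.mul ?_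
  exact continuous_const.mul (continuous_dilation t (continuous_dgauss ν κ))

theorem eLpNorm_profile_succ_sub (ν : ℂ) (f : ℂ → ℂ) (u₀ : Rn n → ℂ) (u : ℝ → L1 n) (m : ℕ)
    {t : ℝ} (ht : 0 < t) (q : ℝ≥0∞) :
    ENNReal.ofReal (t ^ (decayExp n q + (m : ℝ) / 2 + 1 / 2)) * eLpNorm (fun x =>
      profile ν f u₀ u (m + 1) t x - profile ν f u₀ u m t x) q volume =
        eLpNorm (topProfile ν f u₀ u (m + 1)) q volume := by
  have e : (fun x => profile ν f u₀ u (m + 1) t x - profile ν f u₀ u m t x) =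
      ((t ^ (-((m : ℝ) + 1) / 2) : ℝ) : ℂ) • dilation t (topProfile ν f u₀ u (m + 1)) :=
    funext fun x => profile_succ_sub ν f u₀ u m ht x
  rw [e, eLpNorm_const_smul, eLpNorm_dilation ht (continuous_topProfile ν f u₀ u (m + 1)),
    ← ofReal_norm, Complex.norm_real, Real.norm_eq_abs, abs_of_pos (by positivity), ← mul_assoc,
    ← mul_assoc, ← ENNReal.ofReal_mul (by positivity), ← ENNReal.ofReal_mul (by positivity),
    ← Real.rpow_add ht, ← Real.rpow_add ht]
  have : decayExp n q + (m : ℝ) / 2 + 1 / 2 + -((m : ℝ) + 1) / 2 + -decayExp n q = 0 := by ring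
  rw [this, Real.rpow_zero, ENNReal.ofReal_one, one_mul]

namespace DecayingSolution

variable {ν : ℂ} {p K A : ℝ} {M m : ℕ} {f : ℂ → ℂ} {u₀ : Rn n → ℂ} {u : ℝ → L1 n}

/-- For almost every s the error mass of the source tends to 0, and it is dominated by the
time-integrable `mass`. The last term decays because its exponent is negative. -/
theorem tendsto_totalErr (h : DecayingSolution ν p K A M f u₀ u) :
    Tendsto (fun t => totalErr M ((n : ℝ) / 2 * (p - 1)) t f u₀ u) atTop (𝓝 0) := by
  have h1 := tendsto_errMass M 0 h.integrable h.moments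
  have h2 : Tendsto (fun t => ∫⁻ s in Ioi (0 : ℝ), errMass M t s (nonlin f u s)) atTop
      (𝓝 (∫⁻ _ in Ioi (0 : ℝ), 0)) := by
    have hm := h.decay.aestronglyMeasurable_nonlin h.nl
    refine tendsto_lintegral_filter_of_dominated_convergence'
      (fun s => mass M s (nonlin f u s)) (Eventually.of_forall fun t => ?_)
      (Eventually.of_forall fun t => Eventually.of_forall fun s => errMass_le_mass M t s _)
      h.lintegral_mass_ne_top ?_
    · have a1 : AEMeasurable (fun s => ∫⁻ y, ‖nonlin f u s y‖ₑ) (volume.restrict (Ioi 0)) := by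
        simp only [← enorm_L1]
        exact hm.enorm
      have a2 : AEMeasurable (fun s => ∫⁻ y, ENNReal.ofReal (tmod M t ‖y‖) * ‖nonlin f u s y‖ₑ)
          (volume.restrict (Ioi 0)) :=
        aemeasurable_wnorm ((measurable_tmod M t).comp measurable_norm).ennreal_ofReal hm
      exact (((measurable_tmod M t).comp
        Real.continuous_sqrt.measurable).ennreal_ofReal.aemeasurable.mul a1).add a2
    · filter_upwards [ae_restrict_mem measurableSet_Ioi] with s hs
      exact tendsto_errMass M s (h.integrable_nonlin s) (h.moments_nonlin hs)
  have h3 : Tendsto (fun t : ℝ => ENNReal.ofReal (t ^ ((M : ℝ) / 2 + 1 - (n : ℝ) / 2 * (p - 1))))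
      atTop (𝓝 0) := by
    have hexp := h.exponent
    have := tendsto_rpow_neg_atTop (y := (n : ℝ) / 2 * (p - 1) - ((M : ℝ) / 2 + 1)) (by linarith)
    simpa [neg_sub] using ENNReal.tendsto_ofReal this
  simpa [totalErr] using (h1.add h2).add h3

theorem exists_eLpNorm_sub_profile_le' (h : DecayingSolution ν p K A M f u₀ u) :
    ∃ C : ℝ≥0∞, C ≠ ∞ ∧ ∀ q : ℝ≥0∞, 1 ≤ q → ∀ t : ℝ, 0 < t →
      eLpNorm (fun x => u t x - profile ν f u₀ u M t x) q volume ≤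
        ENNReal.ofReal (t ^ (-decayExp n q - (M : ℝ) / 2)) *
          (C * totalErr M ((n : ℝ) / 2 * (p - 1)) t f u₀ u) := by
  obtain ⟨C₁, hC₁, h1⟩ := h.exists_eLpNorm_sub_profile_le (Or.inl rfl)
  obtain ⟨C₂, hC₂, h2⟩ := h.exists_eLpNorm_sub_profile_le (Or.inr rfl)
  refine ⟨C₁ + C₂, ENNReal.add_ne_top.2 ⟨hC₁, hC₂⟩, fun q hq t ht => ?_⟩
  have hg : AEStronglyMeasurable (fun x => u t x - profile ν f u₀ u M t x) volume :=
    (Lp.aestronglyMeasurable _).sub (continuous_profile ν f u₀ u M ht).aestronglyMeasurable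
  set E := totalErr M ((n : ℝ) / 2 * (p - 1)) t f u₀ u
  have hb := eLpNorm_le_of_one_of_top hg (b := ENNReal.ofReal (t ^ (-((n : ℝ) / 2))))
    (X := ENNReal.ofReal (t ^ (-(M : ℝ) / 2)) * ((C₁ + C₂) * E)) ?_ ?_ hq
  · refine hb.trans (le_of_eq ?_)
    rw [ENNReal.ofReal_rpow_of_pos (by positivity), ← Real.rpow_mul ht.le, ← mul_assoc,
      ← ENNReal.ofReal_mul (by positivity), ← Real.rpow_add ht]
    congr 3
    rw [decayExp]; ring
  · refine (h1 t ht).trans ?_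
    rw [decayExp_one, neg_zero, Real.rpow_zero, mul_one, mul_comm C₁, mul_assoc]
    exact mul_le_mul_right (mul_le_mul_left le_self_add _) _
  · refine (h2 t ht).trans ?_
    rw [decayExp_top, ENNReal.ofReal_mul (by positivity)]
    calc _ = ENNReal.ofReal (t ^ (-((n : ℝ) / 2))) *
          (ENNReal.ofReal (t ^ (-(M : ℝ) / 2)) * (C₂ * E)) := by ring
      _ ≤ _ := mul_le_mul_right (mul_le_mul_right (mul_le_mul_left le_add_self _) _) _

/-- Compare with the profile of order m + 1: the distance to it is negligible at this scale, and the
scaled norm of the difference of the two profiles equals the limit at every t > 0. -/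
theorem tendsto_eLpNorm_sub_profile (h : DecayingSolution ν p K A (m + 1) f u₀ u) {q : ℝ≥0∞}
    (hq : 1 ≤ q) :
    Tendsto (fun t : ℝ => ENNReal.ofReal (t ^ (decayExp n q + (m : ℝ) / 2 + 1 / 2)) *
        eLpNorm (fun x => u t x - profile ν f u₀ u m t x) q volume) atTop
      (𝓝 (eLpNorm (topProfile ν f u₀ u (m + 1)) q volume)) := by
  set L := eLpNorm (topProfile ν f u₀ u (m + 1)) q volume with hL
  have hLfin : L ≠ ∞ := (memLp_topProfile h.re_pos f u₀ u (m + 1) hq).2.ne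
  set a : ℝ → ℝ≥0∞ := fun t => ENNReal.ofReal (t ^ (decayExp n q + (m : ℝ) / 2 + 1 / 2)) with ha
  set w : ℝ → ℝ≥0∞ := fun t =>
    a t * eLpNorm (fun x => u t x - profile ν f u₀ u (m + 1) t x) q volume with hw
  have hw0 : Tendsto w atTop (𝓝 0) := by
    obtain ⟨C, hC, hle⟩ := h.exists_eLpNorm_sub_profile_le'
    have hE : Tendsto (fun t => C * totalErr (m + 1) ((n : ℝ) / 2 * (p - 1)) t f u₀ u) atTop
        (𝓝 0) := by
      simpa using ENNReal.Tendsto.const_mul h.tendsto_totalErr (Or.inr hC)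
    refine tendsto_of_tendsto_of_tendsto_of_le_of_le' tendsto_const_nhds hE
      (Eventually.of_forall fun _ => zero_le) ?_
    filter_upwards [eventually_gt_atTop 0] with t ht
    refine (mul_le_mul_right (hle q hq t ht) (a t)).trans (le_of_eq ?_)
    rw [← mul_assoc, ← ENNReal.ofReal_mul (by positivity), ← Real.rpow_add ht]
    have : decayExp n q + (m : ℝ) / 2 + 1 / 2 + (-decayExp n q - ((m + 1 : ℕ) : ℝ) / 2) = 0 := by
      push_cast; ring
    rw [this, Real.rpow_zero, ENNReal.ofReal_one, one_mul]
  -- The reverse triangle inequality in truncated subtraction, continuous here because L is finite.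
  have hlow : Tendsto (fun t => L - w t) atTop (𝓝 L) := by
    simpa using ENNReal.Tendsto.sub (tendsto_const_nhds (x := L)) hw0 (Or.inl hLfin)
  have hup : Tendsto (fun t => w t + L) atTop (𝓝 L) := by
    simpa using hw0.add_const L
  have hm : ∀ N t, 0 < t →
      AEStronglyMeasurable (fun x => u t x - profile ν f u₀ u N t x) volume := fun N t ht =>
    (Lp.aestronglyMeasurable _).sub (continuous_profile ν f u₀ u N ht).aestronglyMeasurable
  refine tendsto_of_tendsto_of_tendsto_of_le_of_le' hlow hup ?_ ?_
  · filter_upwards [eventually_gt_atTop 0] with t ht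
    rw [tsub_le_iff_right, hL, ← eLpNorm_profile_succ_sub ν f u₀ u m ht q, hw, ← mul_add]
    refine mul_le_mul_right ?_ _
    refine le_trans (le_of_eq ?_) (eLpNorm_sub_le (hm m t ht) (hm (m + 1) t ht) hq)
    congr 1
    funext x
    simp only [Pi.sub_apply]
    ring
  · filter_upwards [eventually_gt_atTop 0] with t ht
    rw [hL, ← eLpNorm_profile_succ_sub ν f u₀ u m ht q, hw, ← mul_add]
    refine mul_le_mul_right ?_ _
    refine le_trans (le_of_eq ?_) (eLpNorm_add_le (hm (m + 1) t ht)
      ((continuous_profile ν f u₀ u (m + 1) ht).sub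
        (continuous_profile ν f u₀ u m ht)).aestronglyMeasurable hq)
    congr 1
    funext x
    simp only [Pi.add_apply]
    ring

end DecayingSolution

/-! ### From the hypotheses of the theorem to a decaying solution. -/

theorem norm_pow_le_sum (hn : 0 < n) (M : ℕ) (y : Rn n) :
    ‖y‖ ^ M ≤ (n : ℝ) ^ M * ∑ j, |y j| ^ M := by
  have : Nonempty (Fin n) := ⟨⟨0, hn⟩⟩
  obtain ⟨j, -, hj⟩ := Finset.exists_max_image Finset.univ (fun j => |y j|) Finset.univ_nonempty
  have h1 : ‖y‖ ≤ n * |y j| := by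
    rw [EuclideanSpace.norm_eq]
    refine Real.sqrt_le_iff.2 ⟨by positivity, ?_⟩
    calc ∑ i, ‖y i‖ ^ 2 ≤ ∑ _i : Fin n, |y j| ^ 2 := by
          refine Finset.sum_le_sum fun i hi => ?_
          rw [Real.norm_eq_abs]
          exact pow_le_pow_left₀ (abs_nonneg _) (hj i hi) 2
      _ = n * |y j| ^ 2 := by simp
      _ ≤ (n * n) * |y j| ^ 2 := by
          have : (1 : ℝ) ≤ n := by exact_mod_cast hn
          gcongr
          nlinarith
      _ = _ := by ring
  calc ‖y‖ ^ M ≤ (n * |y j|) ^ M := by gcongr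
    _ = (n : ℝ) ^ M * |y j| ^ M := mul_pow _ _ _
    _ ≤ _ := by
      gcongr
      exact Finset.single_le_sum (f := fun j => |y j| ^ M) (fun i _ => by positivity)
        (Finset.mem_univ j)

/-- Only the pure powers y_j^M are needed: the largest coordinate controls the Euclidean norm up to
the factor n. -/
theorem MemWeightedL1.moments (hn : 0 < n) {M : ℕ} {φ : Rn n → ℂ} (h : MemWeightedL1 M φ) :
    ∫⁻ y, ENNReal.ofReal (‖y‖ ^ M) * ‖φ y‖ₑ ≠ ∞ := by
  have hI : ∀ j, Integrable fun y => (mpow y (Pi.single j M) : ℂ) * φ y := fun j =>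
    memLp_one_iff_integrable.1 (h.2 _ (by simp [mlen]))
  have hJ : Integrable fun y => (n : ℝ) ^ M * ∑ j, ‖(mpow y (Pi.single j M) : ℂ) * φ y‖ :=
    (integrable_finsetSum _ fun j _ => (hI j).norm).const_mul _
  have hp : ∀ (y : Rn n) j, mpow y (Pi.single j M) = y j ^ M := by
    intro y j
    rw [mpow, Finset.prod_eq_single j]
    · simp
    · intro b _ hb; simp [hb]
    · simp
  refine ne_top_of_le_ne_top hJ.lintegral_lt_top.ne (lintegral_mono fun y => ?_)
  rw [← ofReal_norm, ← ENNReal.ofReal_mul (by positivity)]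
  refine ENNReal.ofReal_le_ofReal
    ((mul_le_mul_of_nonneg_right (norm_pow_le_sum hn M y) (norm_nonneg _)).trans_eq ?_)
  rw [mul_assoc, Finset.sum_mul]
  congr 1
  refine Finset.sum_congr rfl fun j _ => ?_
  rw [hp, norm_mul, Complex.norm_real, norm_pow, Real.norm_eq_abs]

/-- The hypotheses of the theorem give a decaying solution. -/
theorem exists_decayingSolution (hn : 0 < n) {ν : ℂ} (hν : 0 < ν.re) {m : ℕ} {p : ℝ}
    (hp : 1 + ((m : ℝ) + 3) / (n : ℝ) < p) {f : ℂ → ℂ} (hf0 : f 0 = 0) {K : ℝ} (hK : 0 < K)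
    (hf : ∀ ξ η : ℂ, ‖f ξ - f η‖ ≤ K * (‖ξ‖ ^ (p - 1) + ‖η‖ ^ (p - 1)) * ‖ξ - η‖)
    {u₀ : Rn n → ℂ} (hu₀ : MemWeightedL1 (m + 1) u₀) {u : ℝ → L1 n}
    (hu : IsGlobalSolution ν f u₀ u) (hdecay : HasFreeDecay u) :
    ∃ A, DecayingSolution ν p K A (m + 1) f u₀ u := by
  obtain ⟨A, hA⟩ := exists_freeDecay hu.1 hdecay
  have hn' : (0 : ℝ) < n := by exact_mod_cast hn
  -- Half of this is the condition `exponent` for M = m + 1, as (m + 3)/2 = (m + 1)/2 + 1.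
  have h1 : (m : ℝ) + 3 < n * (p - 1) := by
    have : ((m : ℝ) + 3) / n < p - 1 := by linarith
    rw [div_lt_iff₀ hn'] at this
    linarith
  have h2 : 1 < p := by
    have : 0 < ((m : ℝ) + 3) / n := by positivity
    linarith
  refine ⟨A, hν, ⟨h2, hK, hf0, hf⟩, hA, hu.2, ?_, memLp_one_iff_integrable.1 hu₀.1,
    hu₀.moments hn⟩
  push_cast
  linarith

end CGL

end

/-! ### The theorem. -/

theorem theorem1p5 (n : ℕ) (hn : 0 < n) (ν : ℂ) (hν : 0 < ν.re) (m : ℕ)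
    (p : ℝ) (hp : 1 + ((m : ℝ) + 3) / (n : ℝ) < p)
    (f : ℂ → ℂ) (hf0 : f 0 = 0) (K : ℝ) (hK : 0 < K)
    (hf : ∀ ξ η : ℂ, ‖f ξ - f η‖ ≤ K * (‖ξ‖ ^ (p - 1) + ‖η‖ ^ (p - 1)) * ‖ξ - η‖)
    (u₀ : CGL.Rn n → ℂ) (hu₀ : CGL.MemWeightedL1 (m + 1) u₀) (hu₀' : MemLp u₀ ∞ volume)
    (u : ℝ → CGL.L1 n) (hu : CGL.IsGlobalSolution ν f u₀ u) (hdecay : CGL.HasFreeDecay u) :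
    -- the integrals defining the profiles of order at most `m + 1` converge
    ((∀ s : ℝ, 0 < s → MemLp (fun x => f (u s x)) 1 volume) ∧
      (∀ k : ℕ, 2 * k ≤ m + 1 →
        IntegrableOn (fun s : ℝ => s ^ k • CGL.nonlin f u s) (Ioi 0) volume) ∧
      (∀ (β : Fin n → ℕ) (k : ℕ), CGL.mlen β + 2 * k ≤ m + 1 →
        Integrable (fun y => (CGL.mpow y β : ℂ) * CGL.psi f u k y) volume)) ∧
    -- the limit
    (∀ q : ℝ≥0∞, 1 ≤ q →
      Tendsto (fun t : ℝ =>
          ENNReal.ofReal (t ^ (CGL.decayExp n q + (m : ℝ) / 2 + 1 / 2)) *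
            eLpNorm (fun x => u t x - CGL.profile ν f u₀ u m t x) q volume)
        atTop
        (𝓝 (eLpNorm (fun x =>
          CGL.profile ν f u₀ u (m + 1) 1 x - CGL.profile ν f u₀ u m 1 x) q volume))) ∧
    -- the equivalences
    List.TFAE [
      (∃ x, CGL.profile ν f u₀ u (m + 1) 1 x - CGL.profile ν f u₀ u m 1 x ≠ 0),
      (∃ α : Fin n → ℕ, CGL.mlen α = m + 1 ∧ CGL.profileCoeff ν f u₀ u (m + 1) α ≠ 0),
      (∀ q : ℝ≥0∞, 1 ≤ q → ∀ ε : ℝ, 0 < ε → ε < 1 → ∃ t₀ : ℝ, 0 < t₀ ∧ ∀ t : ℝ, t₀ < t →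
        0 < ENNReal.ofReal (t ^ (-(1 : ℝ) / 2) * (1 - ε)) *
            eLpNorm (fun x =>
              CGL.profile ν f u₀ u (m + 1) 1 x - CGL.profile ν f u₀ u m 1 x) q volume ∧
        ENNReal.ofReal (t ^ (-(1 : ℝ) / 2) * (1 - ε)) *
            eLpNorm (fun x =>
              CGL.profile ν f u₀ u (m + 1) 1 x - CGL.profile ν f u₀ u m 1 x) q volume ≤
          ENNReal.ofReal (t ^ (CGL.decayExp n q + (m : ℝ) / 2)) *
            eLpNorm (fun x => u t x - CGL.profile ν f u₀ u m t x) q volume ∧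
        ENNReal.ofReal (t ^ (CGL.decayExp n q + (m : ℝ) / 2)) *
            eLpNorm (fun x => u t x - CGL.profile ν f u₀ u m t x) q volume ≤
          ENNReal.ofReal (t ^ (-(1 : ℝ) / 2) * (1 + ε)) *
            eLpNorm (fun x =>
              CGL.profile ν f u₀ u (m + 1) 1 x - CGL.profile ν f u₀ u m 1 x) q volume)
    ] := by
  obtain ⟨A, h⟩ := CGL.exists_decayingSolution hn hν hp hf0 hK hf hu₀ hu hdecay
  have hν0 : ν ≠ 0 := fun h0 => by simp [h0] at hν
  have hlim := fun (q : ℝ≥0∞) (hq : 1 ≤ q) => h.tendsto_eLpNorm_sub_profile hq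
  simp only [CGL.profile_succ_sub_one]
  refine ⟨⟨fun s hs => h.decay.memLp_comp h.nl hs, fun k hk => h.integrableOn_smul_nonlin hk,
    fun β k hβ => h.integrable_mpow_mul_psi hβ⟩, hlim, ?_⟩
  tfae_have 1 ↔ 2 := by
    rw [CGL.topProfile_ne_zero_iff hν0]
    refine exists_congr fun α => and_congr_right fun hα => ?_
    rw [CGL.profileCoeff_eq ν f u₀ u hα.le]
  tfae_have 1 → 3 := by
    intro hne q hq ε hε hε1
    set L := eLpNorm (fun x => CGL.topProfile ν f u₀ u (m + 1) x) q volume with hL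
    have hL0 : L ≠ 0 := CGL.eLpNorm_topProfile_ne_zero hne hq
    have hLt : L ≠ ∞ := (CGL.memLp_topProfile hν f u₀ u (m + 1) hq).2.ne
    -- Both comparisons are strict because 0 < L < ∞, so convergence to L gives the two bounds for
    -- all large t.
    have hlow : ENNReal.ofReal (1 - ε) * L < L := by
      refine (ENNReal.mul_lt_mul_left hL0 hLt
        (b := ENNReal.ofReal (1 - ε)) (c := 1) ?_).trans_eq (one_mul L)
      rw [← ENNReal.ofReal_one]
      exact (ENNReal.ofReal_lt_ofReal_iff one_pos).2 (by linarith)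
    have hup : L < ENNReal.ofReal (1 + ε) * L := by
      refine (one_mul L).symm.trans_lt (ENNReal.mul_lt_mul_left hL0 hLt
        (b := 1) (c := ENNReal.ofReal (1 + ε)) ?_)
      rw [← ENNReal.ofReal_one]
      exact (ENNReal.ofReal_lt_ofReal_iff (by linarith)).2 (by linarith)
    obtain ⟨t₁, ht₁⟩ := eventually_atTop.1
      (((hlim q hq).eventually_const_lt hlow).and ((hlim q hq).eventually_lt_const hup))
    refine ⟨max t₁ 1, by positivity, fun t ht => ?_⟩
    have ht0 : 0 < t := one_pos.trans ((le_max_right _ _).trans_lt ht)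
    obtain ⟨h1, h2⟩ := ht₁ t ((le_max_left _ _).trans ht.le)
    have hr : 0 < t ^ (-(1 : ℝ) / 2) := by positivity
    have e : ENNReal.ofReal (t ^ (CGL.decayExp n q + (m : ℝ) / 2)) =
        ENNReal.ofReal (t ^ (-(1 : ℝ) / 2)) *
          ENNReal.ofReal (t ^ (CGL.decayExp n q + (m : ℝ) / 2 + 1 / 2)) := by
      rw [← ENNReal.ofReal_mul hr.le, ← Real.rpow_add ht0]
      congr 2; ring
    rw [e, ENNReal.ofReal_mul hr.le, ENNReal.ofReal_mul hr.le, mul_assoc, mul_assoc, mul_assoc]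
    refine ⟨?_, mul_le_mul_right h1.le _, mul_le_mul_right h2.le _⟩
    exact ENNReal.mul_pos (ENNReal.ofReal_pos.2 hr).ne'
      (mul_ne_zero (ENNReal.ofReal_pos.2 (by linarith)).ne' hL0)
  -- A vanishing difference has norm 0, against the strict positivity; one choice of q and ε is
  -- enough.
  tfae_have 3 → 1 := by
    intro h3
    by_contra! hz
    obtain ⟨t₀, -, ht₀⟩ := h3 1 le_rfl (1 / 2) (by norm_num) (by norm_num)
    have := (ht₀ (t₀ + 1) (by linarith)).1
    simp [hz] at this
  tfae_finish
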